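/- Let $N^3(c)$ be a smooth Riemannian $3$-manifold of constant sectional curvature $c$, let $M^2$ be a connected, oriented smooth surface, and let $\varphi:M\to N^3(c)$ be a smooth immersion with a smooth unit normal vector field $\eta$ along $\varphi$. Let $g=\langle\cdot,\cdot\rangle=\varphi^*\langle\cdot,\cdot\rangle_N$ be the induced metric, $K^M$ its Gaussian curvature, $B$ the second fundamental form with values in the normal bundle, $A_\xi$ the shape operator in the direction of a normal field $\xi$, that is $\langle A_\xi X,Y\rangle=\langle B(X,Y),\xi\rangle$, $A=A_\eta$, $f=\tfrac12\operatorname{trace}A$ the mean curvature function, and $H=f\eta$ the mean curvature vector field. For positively oriented local isothermal coordinates $(U;x,y)$ on $M$, with $g=\lambda^2(dx^2+dy^2)$, $\lambda>0$, write $z=x+iy$, $\partial_z=\tfrac12(\partial_x-i\,\partial_y)$, $\partial_{\bar z}=\tfrac12(\partial_x+i\,\partial_y)$, and put $$Q(z,\bar z)=\langle A_H(\partial_z),\partial_z\rangle ,$$ where $\langle\cdot,\cdot\rangle$ is extended complex bilinearly. We say that $Q$ is holomorphic if it is a holomorphic function of $z$ for all positively oriented local isothermal coordinates on $M$. Then $\det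 A=K^M-c$ on $M$, and: (a) If $\det A=K^M-c\neq 0$ at every point of $M$, then $f$ is constant if and only if $Q$ is holomorphic. (b) If $f$ is not constant and $Q$ is holomorphic, then $K^M=c$ on all of $M$. Moreover, in all positively oriented local isothermal coordinates, $$4\,\partial_{\bar z}Q=\lambda^2\left[\langle A(\operatorname{grad} f),\partial_x\rangle-i\,\langle A(\operatorname{grad} f),\partial_y\rangle\right].$$ -/

import Mathlib

open scoped Manifold ContDiff

noncomputable section

namespace SurfaceGeometry

/-! ### Riemannian geometry on an open subset of a vector space -/

section Local

/-- The Koszul expression `(∂_u G(v,w) + ∂_v G(u,w) - ∂_w G(u,v)) / 2`, as a covector in `w`,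
for constant vector fields `u`, `v`, `w` and a metric `G` on (an open subset of) `E`. -/
def koszul {E : Type*} [NormedAddCommGroup E] [NormedSpace ℝ E]
    (G : E → E →L[ℝ] E →L[ℝ] ℝ) (y u v : E) : E →L[ℝ] ℝ :=
  (1 / 2 : ℝ) • (fderiv ℝ G y u v + fderiv ℝ G y v u - ((fderiv ℝ G y).flip u).flip v)

/-- The Christoffel symbols `Γ(u, v) = ∇_u v` of the Levi-Civita connection of `G`
(`u`, `v` constant vector fields): the vector with `G(Γ(u,v), w) = koszul G y u v w`. -/
def christoffel {E : Type*} [NormedAddCommGroup E] [NormedSpace ℝ E]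
    (G : E → E →L[ℝ] E →L[ℝ] ℝ) (y u v : E) : E :=
  (G y).inverse (koszul G y u v)

/-- The Riemann curvature tensor `R(u,v)w = ∇_u ∇_v w - ∇_v ∇_u w` of `G`
(`u`, `v`, `w` constant vector fields). -/
def curvature {E : Type*} [NormedAddCommGroup E] [NormedSpace ℝ E]
    (G : E → E →L[ℝ] E →L[ℝ] ℝ) (y u v w : E) : E :=
  fderiv ℝ (fun x => christoffel G x v w) y u + christoffel G y u (christoffel G y v w)
    - (fderiv ℝ (fun x => christoffel G x u w) y v + christoffel G y v (christoffel G y u w))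

/-- The sectional curvature `G(R(u,v)v, u) / (G(u,u) G(v,v) - G(u,v)²)` of the plane spanned
by `u` and `v`. -/
def localSectionalCurvature {E : Type*} [NormedAddCommGroup E] [NormedSpace ℝ E]
    (G : E → E →L[ℝ] E →L[ℝ] ℝ) (y u v : E) : ℝ :=
  G y (curvature G y u v v) u / (G y u u * G y v v - G y u v ^ 2)

theorem christoffel_add_left {E : Type*} [NormedAddCommGroup E] [NormedSpace ℝ E]
    (G : E → E →L[ℝ] E →L[ℝ] ℝ) (y u u' v : E) :
    christoffel G y (u + u') v = christoffel G y u v + christoffel G y u' v := by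
  rw [christoffel, christoffel, christoffel, ← map_add]
  congr 1
  ext w
  simp [koszul]
  ring

theorem christoffel_smul_left {E : Type*} [NormedAddCommGroup E] [NormedSpace ℝ E]
    (G : E → E →L[ℝ] E →L[ℝ] ℝ) (y : E) (r : ℝ) (u v : E) :
    christoffel G y (r • u) v = r • christoffel G y u v := by
  rw [christoffel, christoffel, ← map_smul]
  congr 1
  ext w
  simp [koszul]
  ring

end Local

/-! ### Riemannian geometry on a manifold

A metric is a family of bilinear forms on the tangent spaces. -/

section Manifold

/-- The differential at `q` of a map `u : M → F` to a vector space (a chart, for instance), as a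
linear map with values in `F`. -/
def differential {E F : Type*} [NormedAddCommGroup E] [NormedSpace ℝ E]
    [NormedAddCommGroup F] [NormedSpace ℝ F]
    {M : Type*} [TopologicalSpace M] [ChartedSpace E M]
    (u : M → F) (q : M) : TangentSpace 𝓘(ℝ, E) q →L[ℝ] F :=
  mfderiv 𝓘(ℝ, E) 𝓘(ℝ, F) u q

/-- The metric `g` written in the preferred chart at `p`. -/
def metricInChart {E : Type*} [NormedAddCommGroup E] [NormedSpace ℝ E]
    {M : Type*} [TopologicalSpace M] [ChartedSpace E M]
    (g : ∀ q : M, TangentSpace 𝓘(ℝ, E) q →L[ℝ] TangentSpace 𝓘(ℝ, E) q →L[ℝ] ℝ)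
    (p : M) (y : E) : E →L[ℝ] E →L[ℝ] ℝ :=
  ContinuousLinearMap.bilinearComp (E := E) (F := E) (G := ℝ) (E' := E) (F' := E)
    (g ((chartAt E p).symm y))
    (mfderiv 𝓘(ℝ, E) 𝓘(ℝ, E) (chartAt E p).symm y)
    (mfderiv 𝓘(ℝ, E) 𝓘(ℝ, E) (chartAt E p).symm y)

/-- The sectional curvature at `p` of the plane spanned by the tangent vectors `X` and `Y`. -/
def sectionalCurvature {E : Type*} [NormedAddCommGroup E] [NormedSpace ℝ E]
    {M : Type*} [TopologicalSpace M] [ChartedSpace E M]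
    (g : ∀ q : M, TangentSpace 𝓘(ℝ, E) q →L[ℝ] TangentSpace 𝓘(ℝ, E) q →L[ℝ] ℝ)
    (p : M) (X Y : TangentSpace 𝓘(ℝ, E) p) : ℝ :=
  localSectionalCurvature (metricInChart g p) (chartAt E p p)
    (differential (chartAt E p) p X) (differential (chartAt E p) p Y)

/-- All sectional curvatures are equal to `c`. -/
def HasConstantCurvature {E : Type*} [NormedAddCommGroup E] [NormedSpace ℝ E]
    {M : Type*} [TopologicalSpace M] [ChartedSpace E M]
    (g : ∀ q : M, TangentSpace 𝓘(ℝ, E) q →L[ℝ] TangentSpace 𝓘(ℝ, E) q →L[ℝ] ℝ) (c : ℝ) : Prop :=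
  ∀ (p : M) (X Y : TangentSpace 𝓘(ℝ, E) p), LinearIndependent ℝ ![X, Y] →
    sectionalCurvature g p X Y = c

/-- The Gaussian curvature of a metric on a surface: the sectional curvature of the tangent plane,
computed on the coordinate basis of the preferred chart at `p`. -/
def gaussianCurvature
    {M : Type*} [TopologicalSpace M] [ChartedSpace (EuclideanSpace ℝ (Fin 2)) M]
    (g : ∀ q : M, TangentSpace (𝓡 2) q →L[ℝ] TangentSpace (𝓡 2) q →L[ℝ] ℝ) (p : M) : ℝ :=
  localSectionalCurvature (metricInChart g p) (chartAt (EuclideanSpace ℝ (Fin 2)) p p)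
    (EuclideanSpace.single 0 1) (EuclideanSpace.single 1 1)

/-- The gradient of `f` with respect to `g`: `g(grad f, X) = df(X)`. -/
def gradient {E : Type*} [NormedAddCommGroup E] [NormedSpace ℝ E]
    {M : Type*} [TopologicalSpace M] [ChartedSpace E M]
    (g : ∀ q : M, TangentSpace 𝓘(ℝ, E) q →L[ℝ] TangentSpace 𝓘(ℝ, E) q →L[ℝ] ℝ)
    (f : M → ℝ) (p : M) : TangentSpace 𝓘(ℝ, E) p :=
  (g p).inverse (differential f p)

end Manifold

/-! ### Immersions -/

section Immersion

/-- The metric `φ^* h` induced on `M` by a map `φ : M → N`. -/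
def inducedMetric {E F : Type*} [NormedAddCommGroup E] [NormedSpace ℝ E]
    [NormedAddCommGroup F] [NormedSpace ℝ F]
    {M : Type*} [TopologicalSpace M] [ChartedSpace E M]
    {N : Type*} [TopologicalSpace N] [ChartedSpace F N]
    (h : ∀ y : N, TangentSpace 𝓘(ℝ, F) y →L[ℝ] TangentSpace 𝓘(ℝ, F) y →L[ℝ] ℝ)
    (φ : M → N) (p : M) : TangentSpace 𝓘(ℝ, E) p →L[ℝ] TangentSpace 𝓘(ℝ, E) p →L[ℝ] ℝ :=
  ContinuousLinearMap.bilinearComp (E := F) (F := F) (G := ℝ) (E' := E) (F' := E)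
    (h (φ p)) (mfderiv 𝓘(ℝ, E) 𝓘(ℝ, F) φ p) (mfderiv 𝓘(ℝ, E) 𝓘(ℝ, F) φ p)

/-- The covariant derivative `∇_X V` at `p` of a vector field `V` along `φ : M → N`, for the
Levi-Civita connection of `h`. In the preferred chart at `φ p` it reads
`dV(X) + Γ(dφ(X), V)`. -/
def covDerivAlong {E F : Type*} [NormedAddCommGroup E] [NormedSpace ℝ E]
    [NormedAddCommGroup F] [NormedSpace ℝ F]
    {M : Type*} [TopologicalSpace M] [ChartedSpace E M]
    {N : Type*} [TopologicalSpace N] [ChartedSpace F N]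
    (h : ∀ y : N, TangentSpace 𝓘(ℝ, F) y →L[ℝ] TangentSpace 𝓘(ℝ, F) y →L[ℝ] ℝ)
    (φ : M → N) (V : ∀ q : M, TangentSpace 𝓘(ℝ, F) (φ q)) (p : M) (X : TangentSpace 𝓘(ℝ, E) p) :
    TangentSpace 𝓘(ℝ, F) (φ p) :=
  let ψ : OpenPartialHomeomorph N F := chartAt F (φ p)
  let dV : TangentSpace 𝓘(ℝ, E) p →L[ℝ] F :=
    differential (fun q : M => differential ψ (φ q) (V q)) p
  (differential ψ (φ p)).inverse
    (dV X + christoffel (metricInChart h (φ p)) (ψ (φ p))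
      (differential ψ (φ p) (mfderiv 𝓘(ℝ, E) 𝓘(ℝ, F) φ p X))
      (differential ψ (φ p) (V p)))

/-- The second fundamental form in the direction of the normal vector field `ξ` along `φ`:
`⟨B(X, Y), ξ⟩ = -⟨∇_X ξ, dφ(Y)⟩`, as a covector in `Y`. -/
def secondFundamentalForm {E F : Type*} [NormedAddCommGroup E] [NormedSpace ℝ E]
    [NormedAddCommGroup F] [NormedSpace ℝ F]
    {M : Type*} [TopologicalSpace M] [ChartedSpace E M]
    {N : Type*} [TopologicalSpace N] [ChartedSpace F N]
    (h : ∀ y : N, TangentSpace 𝓘(ℝ, F) y →L[ℝ] TangentSpace 𝓘(ℝ, F) y →L[ℝ] ℝ)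
    (φ : M → N) (ξ : ∀ q : M, TangentSpace 𝓘(ℝ, F) (φ q)) (p : M) (X : TangentSpace 𝓘(ℝ, E) p) :
    TangentSpace 𝓘(ℝ, E) p →L[ℝ] ℝ :=
  -(h (φ p) (covDerivAlong h φ ξ p X)).comp (mfderiv 𝓘(ℝ, E) 𝓘(ℝ, F) φ p)

theorem covDerivAlong_add {E F : Type*} [NormedAddCommGroup E] [NormedSpace ℝ E]
    [NormedAddCommGroup F] [NormedSpace ℝ F]
    {M : Type*} [TopologicalSpace M] [ChartedSpace E M]
    {N : Type*} [TopologicalSpace N] [ChartedSpace F N]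
    (h : ∀ y : N, TangentSpace 𝓘(ℝ, F) y →L[ℝ] TangentSpace 𝓘(ℝ, F) y →L[ℝ] ℝ)
    (φ : M → N) (V : ∀ q : M, TangentSpace 𝓘(ℝ, F) (φ q)) (p : M)
    (X Y : TangentSpace 𝓘(ℝ, E) p) :
    covDerivAlong h φ V p (X + Y) = covDerivAlong h φ V p X + covDerivAlong h φ V p Y := by
  simp only [covDerivAlong]
  rw [← map_add]
  simp only [map_add, christoffel_add_left]
  abel

theorem covDerivAlong_smul {E F : Type*} [NormedAddCommGroup E] [NormedSpace ℝ E]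
    [NormedAddCommGroup F] [NormedSpace ℝ F]
    {M : Type*} [TopologicalSpace M] [ChartedSpace E M]
    {N : Type*} [TopologicalSpace N] [ChartedSpace F N]
    (h : ∀ y : N, TangentSpace 𝓘(ℝ, F) y →L[ℝ] TangentSpace 𝓘(ℝ, F) y →L[ℝ] ℝ)
    (φ : M → N) (V : ∀ q : M, TangentSpace 𝓘(ℝ, F) (φ q)) (p : M)
    (r : ℝ) (X : TangentSpace 𝓘(ℝ, E) p) :
    covDerivAlong h φ V p (r • X) = r • covDerivAlong h φ V p X := by
  simp only [covDerivAlong]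
  rw [← map_smul]
  simp only [map_smul, christoffel_smul_left, smul_add]

/-- The shape operator `A_ξ` of `φ` in the direction of the normal vector field `ξ`:
`⟨A_ξ X, Y⟩ = ⟨B(X, Y), ξ⟩` for the induced metric. -/
def shapeOperator {E F : Type*} [NormedAddCommGroup E] [NormedSpace ℝ E]
    [NormedAddCommGroup F] [NormedSpace ℝ F]
    {M : Type*} [TopologicalSpace M] [ChartedSpace E M]
    {N : Type*} [TopologicalSpace N] [ChartedSpace F N]
    (h : ∀ y : N, TangentSpace 𝓘(ℝ, F) y →L[ℝ] TangentSpace 𝓘(ℝ, F) y →L[ℝ] ℝ)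
    (φ : M → N) (ξ : ∀ q : M, TangentSpace 𝓘(ℝ, F) (φ q)) (p : M) :
    TangentSpace 𝓘(ℝ, E) p →ₗ[ℝ] TangentSpace 𝓘(ℝ, E) p where
  toFun X := (inducedMetric h φ p).inverse (secondFundamentalForm h φ ξ p X)
  map_add' X Y := by
    rw [← map_add]
    congr 1
    ext Z
    simp only [secondFundamentalForm, covDerivAlong_add, map_add,
      neg_apply, add_apply, ContinuousLinearMap.comp_apply]
    ring
  map_smul' r X := by
    rw [RingHom.id_apply, ← map_smul]
    congr 1
    ext Z
    simp [secondFundamentalForm, covDerivAlong_smul]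

/-- The mean curvature function `f = (trace A) / 2` of a surface with respect to the unit normal
vector field `η`. -/
def meanCurvature {F : Type*} [NormedAddCommGroup F] [NormedSpace ℝ F]
    {M : Type*} [TopologicalSpace M] [ChartedSpace (EuclideanSpace ℝ (Fin 2)) M]
    {N : Type*} [TopologicalSpace N] [ChartedSpace F N]
    (h : ∀ y : N, TangentSpace 𝓘(ℝ, F) y →L[ℝ] TangentSpace 𝓘(ℝ, F) y →L[ℝ] ℝ)
    (φ : M → N) (η : ∀ q : M, TangentSpace 𝓘(ℝ, F) (φ q)) (p : M) : ℝ :=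
  (1 / 2 : ℝ) * LinearMap.trace ℝ (TangentSpace (𝓡 2) p) (shapeOperator h φ η p)

/-- The mean curvature vector field `H = f η`. -/
def meanCurvatureVector {F : Type*} [NormedAddCommGroup F] [NormedSpace ℝ F]
    {M : Type*} [TopologicalSpace M] [ChartedSpace (EuclideanSpace ℝ (Fin 2)) M]
    {N : Type*} [TopologicalSpace N] [ChartedSpace F N]
    (h : ∀ y : N, TangentSpace 𝓘(ℝ, F) y →L[ℝ] TangentSpace 𝓘(ℝ, F) y →L[ℝ] ℝ)
    (φ : M → N) (η : ∀ q : M, TangentSpace 𝓘(ℝ, F) (φ q)) (p : M) : TangentSpace 𝓘(ℝ, F) (φ p) :=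
  meanCurvature h φ η p • η p

end Immersion

/-! ### Oriented surfaces and isothermal coordinates -/

section Surface

/-- An orientation of a smooth surface: a family of charts of the maximal smooth atlas which
covers the surface and whose coordinate changes have positive Jacobian. -/
structure SurfaceOrientation (M : Type*) [TopologicalSpace M]
    [ChartedSpace (EuclideanSpace ℝ (Fin 2)) M] where
  charts : Set (OpenPartialHomeomorph M (EuclideanSpace ℝ (Fin 2)))
  subset_maximalAtlas : charts ⊆ IsManifold.maximalAtlas (𝓡 2) ∞ M
  cover : ∀ p : M, ∃ e ∈ charts, p ∈ e.source
  jacobian_pos : ∀ e ∈ charts, ∀ e' ∈ charts, ∀ q ∈ e.source ∩ e'.source,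
    0 < (fderiv ℝ (e' ∘ e.symm) (e q)).det

/-- `e` is a smooth chart whose coordinates `(x, y)` are positively oriented. -/
def IsPositiveChart {M : Type*} [TopologicalSpace M]
    [ChartedSpace (EuclideanSpace ℝ (Fin 2)) M] (o : SurfaceOrientation M)
    (e : OpenPartialHomeomorph M (EuclideanSpace ℝ (Fin 2))) : Prop :=
  e ∈ IsManifold.maximalAtlas (𝓡 2) ∞ M ∧
    ∀ e' ∈ o.charts, ∀ q ∈ e.source ∩ e'.source, 0 < (fderiv ℝ (e' ∘ e.symm) (e q)).det

/-- The coordinates `(x, y)` of the chart `e` are isothermal for `g`, with conformal factor `lam`: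
`lam > 0` and `g = lam² (dx² + dy²)` on the domain of `e`. -/
def IsIsothermal {M : Type*} [TopologicalSpace M] [ChartedSpace (EuclideanSpace ℝ (Fin 2)) M]
    (g : ∀ q : M, TangentSpace (𝓡 2) q →L[ℝ] TangentSpace (𝓡 2) q →L[ℝ] ℝ)
    (e : OpenPartialHomeomorph M (EuclideanSpace ℝ (Fin 2))) (lam : M → ℝ) : Prop :=
  ∀ q ∈ e.source, 0 < lam q ∧ ∀ X Y : TangentSpace (𝓡 2) q,
    g q X Y = lam q ^ 2 * inner ℝ (differential e q X) (differential e q Y)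

/-- The coordinate vector field `∂_x` (`i = 0`) or `∂_y` (`i = 1`) of the chart `e`, at `q`
in the domain of `e`. -/
def coordVector {M : Type*} [TopologicalSpace M] [ChartedSpace (EuclideanSpace ℝ (Fin 2)) M]
    (e : OpenPartialHomeomorph M (EuclideanSpace ℝ (Fin 2))) (i : Fin 2) (q : M) :
    TangentSpace (𝓡 2) q :=
  (differential e q).inverse (EuclideanSpace.single i (1 : ℝ))

/-- The complex bilinear extension of a real bilinear form `b`, evaluated at
`(v₁ + i v₂, w₁ + i w₂)`. -/
def complexBilin {V : Type*} (b : V → V → ℝ) (v₁ v₂ w₁ w₂ : V) : ℂ :=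
  ((b v₁ w₁ - b v₂ w₂ : ℝ) : ℂ) + Complex.I * ((b v₁ w₂ + b v₂ w₁ : ℝ) : ℂ)

/-- The point `(x, y)` of the plane with complex coordinate `z = x + i y`. -/
def toPlane (z : ℂ) : EuclideanSpace ℝ (Fin 2) := !₂[z.re, z.im]

/-- The operator `∂/∂z̄ = (∂/∂x + i ∂/∂y) / 2`. -/
def dbar (F : ℂ → ℂ) (z : ℂ) : ℂ :=
  (1 / 2 : ℂ) * (fderiv ℝ F z 1 + Complex.I * fderiv ℝ F z Complex.I)

/-- The function `Q = ⟨A_H ∂_z, ∂_z⟩` with `∂_z = (∂_x - i ∂_y) / 2`, in the chart `e`, as a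
function of `z = x + i y`. Here `⟨ , ⟩` is the complex bilinear extension of the induced metric,
and `A_H` is the shape operator in the direction of the mean curvature vector field `H`. -/
def hopfQ {F : Type*} [NormedAddCommGroup F] [NormedSpace ℝ F]
    {M : Type*} [TopologicalSpace M] [ChartedSpace (EuclideanSpace ℝ (Fin 2)) M]
    {N : Type*} [TopologicalSpace N] [ChartedSpace F N]
    (h : ∀ y : N, TangentSpace 𝓘(ℝ, F) y →L[ℝ] TangentSpace 𝓘(ℝ, F) y →L[ℝ] ℝ)
    (φ : M → N) (η : ∀ q : M, TangentSpace 𝓘(ℝ, F) (φ q))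
    (e : OpenPartialHomeomorph M (EuclideanSpace ℝ (Fin 2))) (z : ℂ) : ℂ :=
  let q : M := e.symm (toPlane z)
  complexBilin
    (fun X Y : TangentSpace (𝓡 2) q =>
      inducedMetric h φ q (shapeOperator h φ (meanCurvatureVector h φ η) q X) Y)
    ((1 / 2 : ℝ) • coordVector e 0 q) (-((1 / 2 : ℝ) • coordVector e 1 q))
    ((1 / 2 : ℝ) • coordVector e 0 q) (-((1 / 2 : ℝ) • coordVector e 1 q))

/-- `Q` is holomorphic: it is a holomorphic function of `z = x + i y` for all positively oriented
local isothermal coordinates `(x, y)`. -/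
def IsHolomorphicQ {F : Type*} [NormedAddCommGroup F] [NormedSpace ℝ F]
    {M : Type*} [TopologicalSpace M] [ChartedSpace (EuclideanSpace ℝ (Fin 2)) M]
    {N : Type*} [TopologicalSpace N] [ChartedSpace F N]
    (o : SurfaceOrientation M)
    (h : ∀ y : N, TangentSpace 𝓘(ℝ, F) y →L[ℝ] TangentSpace 𝓘(ℝ, F) y →L[ℝ] ℝ)
    (φ : M → N) (η : ∀ q : M, TangentSpace 𝓘(ℝ, F) (φ q)) : Prop :=
  ∀ (e : OpenPartialHomeomorph M (EuclideanSpace ℝ (Fin 2))) (lam : M → ℝ),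
    IsPositiveChart o e → IsIsothermal (inducedMetric h φ) e lam →
      DifferentiableOn ℂ (hopfQ h φ η e) (toPlane ⁻¹' e.target)

end Surface

end SurfaceGeometry

end

/-!
In isothermal coordinates, let `g = L (dx² + dy²)` and let `l`, `m`, `n` be the coefficients of the
second fundamental form, so that `2 L f = l + n` and `Q = f (l - n - 2 i m) / 4`. Gauss's equation
is `det A = K - c`. Inserting the Codazzi equations into `∂Q/∂z̄` gives
`4 ∂Q/∂z̄ = (l f_x + m f_y) - i (m f_x + n f_y)`, which is the formula for `∂Q/∂z̄`
(`dbar_localHopf`, `IsImmersedSurface.dbar_hopfQ`). Hence `Q` is holomorphic if `f` is constant;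
conversely, if `Q` is holomorphic then `A (grad f) = 0`, so that `det A = 0` wherever `df ≠ 0`. Since
positively oriented isothermal coordinates exist near every point (`exists_isothermal_chart`), a
non-vanishing `det A` forces `df = 0`, and `f` is constant by connectedness.

For part (b) the set `D = {df ≠ 0}` has to be shown to be dense. It is enough that `closure D` is
open (`eventually_mem_closure_support`). On `D`, `l n = m²`, whence `|Q| = f² L / 2`. Let `p` be in
the closure of `D`. Then `Q` does not vanish identically near `p`, since otherwise `f` would vanish
on an open subset of `D`; so `Q`, and with it `f`, has no zero in a punctured disc around `p`. On
`D`, `log |Q|` is harmonic and Gauss's equation reads `Δ (log L) = -2 c L`; thus `w = log |f|`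
satisfies `Δ w = c L` on `D` within the punctured disc. As the set `{dw ≠ 0}` is not empty there, it
is dense there (`subset_closure_of_laplacian`): if `c ≠ 0`, its closure is both the set where
`Δ w = c L ≠ 0` and the complement of a set on which `Δ w = 0`; if `c = 0`, then `w` is harmonic and
the identity theorem applies to `∂w/∂z`. So `det A = K - c` vanishes on a dense set, and by
continuity everywhere.

Isothermal coordinates are constructed by solving the Beltrami equation `∂w/∂z̄ = μ ∂w/∂z` near a
point where `μ = 0`. After a cut-off and a dilation, the Fourier transform of `μ` has small `L¹` norm
(`exists_lintegral_fourier_dilation_le`). On the Fourier side the Beurling transform is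
multiplication by `ξ̄ / ξ` and multiplication by `μ` is a convolution, so that the Neumann series
converges in `L¹` with every polynomial weight, and its inverse Fourier transform is smooth
(`exists_beltrami_solution_of_lintegral_fourier_le`).
-/

/-! ### The Neumann series on the Fourier side -/

section

open MeasureTheory Filter Topology
open scoped FourierTransform ENNReal ComplexConjugate

namespace SurfaceGeometry

/-- The Fourier multiplier `ξ̄ / ξ` of the Beurling transform, which takes `∂w/∂z̄` to `∂w/∂z`. -/
noncomputable def beurlingMultiplier (ξ : ℂ) : ℂ := conj ξ / ξ

theorem norm_beurlingMultiplier_le (ξ : ℂ) : ‖beurlingMultiplier ξ‖ ≤ 1 := by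
  rw [beurlingMultiplier, norm_div, RCLike.norm_conj]
  exact div_self_le_one _

theorem measurable_beurlingMultiplier : Measurable beurlingMultiplier := by
  unfold beurlingMultiplier
  exact (Complex.continuous_conj.measurable).div measurable_id

/-- The terms of the Neumann series for the Beltrami equation, on the Fourier side: multiplication
of a function by the Beltrami coefficient is convolution with its Fourier transform `k`. -/
noncomputable def neumannTerm (k : ℂ → ℂ) : ℕ → ℂ → ℂ
  | 0 => k
  | n + 1 => convolution (fun η => beurlingMultiplier η * neumannTerm k n η) k
      (ContinuousLinearMap.mul ℂ ℂ) volume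

theorem stronglyMeasurable_convolution {f k : ℂ → ℂ} (hf : StronglyMeasurable f)
    (hk : StronglyMeasurable k) :
    StronglyMeasurable (convolution f k (ContinuousLinearMap.mul ℂ ℂ) volume) := by
  have : StronglyMeasurable (fun p : ℂ × ℂ => f p.2 * k (p.1 - p.2)) :=
    (hf.comp_measurable measurable_snd).mul
      (hk.comp_measurable (measurable_fst.sub measurable_snd))
  exact this.integral_prod_right'

theorem stronglyMeasurable_neumannTerm {k : ℂ → ℂ} (hk : StronglyMeasurable k) (n : ℕ) :
    StronglyMeasurable (neumannTerm k n) := by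
  induction n with
  | zero => exact hk
  | succ n ih =>
    exact stronglyMeasurable_convolution (measurable_beurlingMultiplier.stronglyMeasurable.mul ih) hk

/-- Weighted `L¹` norms with a submultiplicative weight are submultiplicative for convolution. -/
theorem lintegral_weight_convolution_le {w : ℂ → ℝ≥0∞} (hw : Measurable w)
    (hwmul : ∀ ξ η, w (ξ + η) ≤ w ξ * w η) {f k : ℂ → ℂ} (hf : StronglyMeasurable f)
    (hk : StronglyMeasurable k) :
    ∫⁻ x, w x * ‖convolution f k (ContinuousLinearMap.mul ℂ ℂ) volume x‖ₑ ≤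
      (∫⁻ x, w x * ‖f x‖ₑ) * ∫⁻ x, w x * ‖k x‖ₑ := by
  have hfm := hf.measurable
  have hkm := hk.measurable
  have hm1 : Measurable (fun t => w t * ‖f t‖ₑ) := by fun_prop
  have hm2 : Measurable (fun t => w t * ‖k t‖ₑ) := by fun_prop
  calc ∫⁻ x, w x * ‖convolution f k (ContinuousLinearMap.mul ℂ ℂ) volume x‖ₑ
      ≤ ∫⁻ x, ∫⁻ t, (w t * ‖f t‖ₑ) * (w (x - t) * ‖k (x - t)‖ₑ) := by
        refine lintegral_mono fun x => ?_
        calc w x * ‖convolution f k (ContinuousLinearMap.mul ℂ ℂ) volume x‖ₑ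
            ≤ w x * ∫⁻ t, ‖f t * k (x - t)‖ₑ := by
              gcongr
              exact enorm_integral_le_lintegral_enorm _
          _ = ∫⁻ t, w x * ‖f t * k (x - t)‖ₑ := by
              rw [lintegral_const_mul]
              fun_prop
          _ ≤ _ := by
              refine lintegral_mono fun t => ?_
              calc w x * ‖f t * k (x - t)‖ₑ ≤ (w t * w (x - t)) * (‖f t‖ₑ * ‖k (x - t)‖ₑ) := by
                    rw [enorm_mul]
                    gcongr
                    simpa using hwmul t (x - t)
                _ = _ := by ring
    _ = ∫⁻ t, ∫⁻ x, (w t * ‖f t‖ₑ) * (w (x - t) * ‖k (x - t)‖ₑ) := by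
        apply lintegral_lintegral_swap
        fun_prop
    _ = ∫⁻ t, (w t * ‖f t‖ₑ) * ∫⁻ x, w x * ‖k x‖ₑ := by
        refine lintegral_congr fun t => ?_
        rw [lintegral_const_mul _ (by fun_prop)]
        congr 1
        exact lintegral_sub_right_eq_self (fun x => w x * ‖k x‖ₑ) t
    _ = _ := lintegral_mul_const _ hm1

/-- The multiplier has modulus at most `1`, so each step of the Neumann series costs one factor of the
weighted norm of `k`. -/
theorem lintegral_weight_neumannTerm_le {w : ℂ → ℝ≥0∞} (hw : Measurable w)
    (hwmul : ∀ ξ η, w (ξ + η) ≤ w ξ * w η) {k : ℂ → ℂ} (hk : StronglyMeasurable k) (n : ℕ) :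
    ∫⁻ x, w x * ‖neumannTerm k n x‖ₑ ≤ (∫⁻ x, w x * ‖k x‖ₑ) ^ (n + 1) := by
  induction n with
  | zero => simp [neumannTerm]
  | succ n ih =>
    have hb := stronglyMeasurable_neumannTerm hk n
    refine (lintegral_weight_convolution_le hw hwmul
      (measurable_beurlingMultiplier.stronglyMeasurable.mul hb) hk).trans ?_
    rw [pow_succ]
    gcongr
    refine le_trans (lintegral_mono fun x => ?_) ih
    gcongr
    rw [Pi.mul_apply, enorm_mul]
    calc ‖beurlingMultiplier x‖ₑ * ‖neumannTerm k n x‖ₑ ≤ 1 * ‖neumannTerm k n x‖ₑ := by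
          gcongr
          rw [← ofReal_norm]
          exact ENNReal.ofReal_le_one.2 (norm_beurlingMultiplier_le x)
      _ = _ := one_mul _

/-- The sum of the Neumann series on the Fourier side. -/
noncomputable def neumannSum (k : ℂ → ℂ) (ξ : ℂ) : ℂ := ∑' n, neumannTerm k n ξ

theorem measurable_neumannSum {k : ℂ → ℂ} (hk : StronglyMeasurable k) :
    Measurable (neumannSum k) := by
  unfold neumannSum
  exact Measurable.tsum fun n => (stronglyMeasurable_neumannTerm hk n).measurable

/-- A power weight becomes arbitrarily close to `1` in `L¹(|k|)` after rescaling. -/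
theorem exists_lintegral_weight_lt {k : ℂ → ℂ} (hkm : StronglyMeasurable k)
    (hk : ∫⁻ x, ‖k x‖ₑ ≤ 1 / 4) (N : ℕ)
    (hN : Integrable (fun x => (1 + ‖x‖) ^ N * ‖k x‖)) :
    ∃ δ : ℝ, 0 < δ ∧ ∫⁻ x, ENNReal.ofReal ((1 + δ * ‖x‖) ^ N) * ‖k x‖ₑ ≤ 1 / 2 := by
  set C : ℝ≥0∞ := ∫⁻ x, ENNReal.ofReal ((1 + ‖x‖) ^ N) * ‖k x‖ₑ with hC
  have hCfin : C ≠ ⊤ := by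
    have := hN.2
    rw [hasFiniteIntegral_iff_enorm] at this
    refine (lt_of_eq_of_lt (lintegral_congr fun x => ?_) this).ne
    rw [enorm_mul, Real.enorm_of_nonneg (by positivity), enorm_norm]
  -- by convexity `(1 + δ r) ^ N ≤ (1 - δ) + δ (1 + r) ^ N`, so a small `δ` adds at most `1 / 4`
  obtain ⟨δ, hδ0, hδ1, hδ⟩ : ∃ δ : ℝ, 0 < δ ∧ δ ≤ 1 ∧ ENNReal.ofReal δ * C ≤ 1 / 4 := by
    refine ⟨min 1 (1 / (4 * (C.toReal + 1))), by positivity, min_le_left _ _, ?_⟩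
    have hCr : C = ENNReal.ofReal C.toReal := (ENNReal.ofReal_toReal hCfin).symm
    have h0 : 0 ≤ C.toReal := ENNReal.toReal_nonneg
    rw [hCr, ← ENNReal.ofReal_mul (by positivity), ENNReal.toReal_ofReal h0]
    have : (1 / 4 : ℝ≥0∞) = ENNReal.ofReal (1 / 4) := by
      rw [ENNReal.ofReal_div_of_pos (by norm_num)]; simp
    rw [this]
    apply ENNReal.ofReal_le_ofReal
    calc min 1 (1 / (4 * (C.toReal + 1))) * C.toReal
        ≤ (1 / (4 * (C.toReal + 1))) * C.toReal := by gcongr; exact min_le_right _ _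
      _ ≤ 1 / 4 := by
        rw [div_mul_eq_mul_div, div_le_div_iff₀ (by positivity) (by norm_num)]
        linarith
  refine ⟨δ, hδ0, ?_⟩
  have hkm' := hkm.measurable
  calc ∫⁻ x, ENNReal.ofReal ((1 + δ * ‖x‖) ^ N) * ‖k x‖ₑ
      ≤ ∫⁻ x, (‖k x‖ₑ + ENNReal.ofReal δ * (ENNReal.ofReal ((1 + ‖x‖) ^ N) * ‖k x‖ₑ)) := by
        refine lintegral_mono fun x => ?_
        have h1 : (1 + δ * ‖x‖) ^ N ≤ 1 + δ * (1 + ‖x‖) ^ N := by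
          have := (convexOn_pow (𝕜 := ℝ) N).2 (show (1 : ℝ) ∈ Set.Ici 0 by simp)
            (show 1 + ‖x‖ ∈ Set.Ici (0 : ℝ) from Set.mem_Ici.2 (by positivity))
            (sub_nonneg.2 hδ1) hδ0.le (by ring)
          simp only [smul_eq_mul, one_pow, mul_one] at this
          have h2 : 1 - δ + δ * (1 + ‖x‖) = 1 + δ * ‖x‖ := by ring
          rw [h2] at this
          linarith
        calc ENNReal.ofReal ((1 + δ * ‖x‖) ^ N) * ‖k x‖ₑ
            ≤ ENNReal.ofReal (1 + δ * (1 + ‖x‖) ^ N) * ‖k x‖ₑ := by gcongr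
          _ = _ := by
            rw [ENNReal.ofReal_add zero_le_one (by positivity), ENNReal.ofReal_mul hδ0.le]
            simp only [ENNReal.ofReal_one]
            ring
    _ = (∫⁻ x, ‖k x‖ₑ) + ENNReal.ofReal δ * C := by
        rw [lintegral_add_left (by fun_prop), lintegral_const_mul _ (by fun_prop)]
    _ ≤ 1 / 4 + 1 / 4 := add_le_add hk hδ
    _ = 1 / 2 := by
      rw [show (4 : ℝ≥0∞) = 2 * 2 by norm_num, one_div, one_div,
        ENNReal.mul_inv (by simp) (by simp), ← two_mul, ← mul_assoc,
        ENNReal.mul_inv_cancel (by simp) (by simp), one_mul]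

/-- The sum of the Neumann series decays rapidly, in the sense that all its moments are finite. -/
theorem lintegral_weight_neumannSum_lt_top {k : ℂ → ℂ} (hkm : StronglyMeasurable k)
    (hk : ∫⁻ x, ‖k x‖ₑ ≤ 1 / 4)
    (hN : ∀ N : ℕ, Integrable (fun x => (1 + ‖x‖) ^ N * ‖k x‖)) (N : ℕ) :
    ∫⁻ x, ‖‖x‖ ^ N‖ₑ * ‖neumannSum k x‖ₑ < ⊤ := by
  obtain ⟨δ, hδ, hle⟩ := exists_lintegral_weight_lt hkm hk N (hN N)
  set w : ℂ → ℝ≥0∞ := fun x => ENNReal.ofReal ((1 + δ * ‖x‖) ^ N) with hw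
  have hwm : Measurable w := by fun_prop
  -- the weight is submultiplicative, and its norm of `k` is at most `1 / 2`: a geometric series
  have hwmul : ∀ ξ η, w (ξ + η) ≤ w ξ * w η := by
    intro ξ η
    simp only [hw]
    rw [← ENNReal.ofReal_mul (by positivity), ← mul_pow]
    apply ENNReal.ofReal_le_ofReal
    gcongr
    have := norm_add_le ξ η
    have h3 : 0 ≤ (δ * ‖ξ‖) * (δ * ‖η‖) := by positivity
    nlinarith [mul_le_mul_of_nonneg_left this hδ.le]
  have hterm : ∀ n, ∫⁻ x, w x * ‖neumannTerm k n x‖ₑ ≤ (1 / 2) ^ (n + 1) := fun n =>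
    (lintegral_weight_neumannTerm_le hwm hwmul hkm n).trans (by gcongr)
  have hsum : ∫⁻ x, w x * ‖neumannSum k x‖ₑ ≤ 1 := by
    calc ∫⁻ x, w x * ‖neumannSum k x‖ₑ ≤ ∫⁻ x, ∑' n, w x * ‖neumannTerm k n x‖ₑ := by
          refine lintegral_mono fun x => ?_
          rw [ENNReal.tsum_mul_left]
          gcongr
          exact enorm_tsum_le_tsum_enorm
      _ = ∑' n, ∫⁻ x, w x * ‖neumannTerm k n x‖ₑ := by
          refine lintegral_tsum fun n => ?_
          have := (stronglyMeasurable_neumannTerm hkm n).measurable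
          fun_prop
      _ ≤ ∑' n, (1 / 2 : ℝ≥0∞) ^ (n + 1) := ENNReal.tsum_le_tsum hterm
      _ = 1 := by
          rw [one_div, ENNReal.tsum_geometric_add_one, ENNReal.one_sub_inv_two, inv_inv,
            ENNReal.inv_mul_cancel (by simp) (by simp)]
  calc ∫⁻ x, ‖‖x‖ ^ N‖ₑ * ‖neumannSum k x‖ₑ
      ≤ ∫⁻ x, ENNReal.ofReal ((δ⁻¹) ^ N) * (w x * ‖neumannSum k x‖ₑ) := by
        refine lintegral_mono fun x => ?_
        rw [← mul_assoc]
        gcongr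
        simp only [hw]
        rw [← ENNReal.ofReal_mul (by positivity), ← mul_pow, Real.enorm_of_nonneg (by positivity)]
        apply ENNReal.ofReal_le_ofReal
        gcongr
        rw [mul_add, inv_mul_cancel_left₀ hδ.ne']
        have : 0 < δ⁻¹ := inv_pos.2 hδ
        linarith
    _ = ENNReal.ofReal ((δ⁻¹) ^ N) * ∫⁻ x, w x * ‖neumannSum k x‖ₑ := by
        rw [lintegral_const_mul]
        have := measurable_neumannSum hkm
        fun_prop
    _ < ⊤ := ENNReal.mul_lt_top (by simp) (hsum.trans_lt (by simp))

end SurfaceGeometry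

end

/-! ### The Beltrami equation with a small coefficient -/

section

open MeasureTheory Filter Topology
open scoped FourierTransform ENNReal ComplexConjugate SchwartzMap

namespace SurfaceGeometry

theorem contDiff_fourierInv {b : ℂ → ℂ}
    (hb : ∀ n : ℕ, Integrable (fun ξ => ‖ξ‖ ^ n * ‖b ξ‖)) : ContDiff ℝ ∞ (𝓕⁻ b) := by
  have h : 𝓕⁻ b = fun x => 𝓕 b (-x) := funext fun x => Real.fourierInv_eq_fourier_neg b x
  rw [h]
  exact (Real.contDiff_fourier (N := ⊤) fun n _ => hb n).comp contDiff_neg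

theorem integrable_pow_mul_of_lintegral_lt_top {b : ℂ → ℂ} (hbm : Measurable b) (n : ℕ)
    (hb : ∫⁻ x, ‖‖x‖ ^ n‖ₑ * ‖b x‖ₑ < ⊤) : Integrable (fun ξ => ‖ξ‖ ^ n * ‖b ξ‖) := by
  refine ⟨by fun_prop, ?_⟩
  rw [hasFiniteIntegral_iff_enorm]
  simpa only [enorm_mul, enorm_norm] using hb

theorem integrable_pow_mul_multiplier {b : ℂ → ℂ} (hbm : Measurable b) {n : ℕ}
    (hb : Integrable (fun ξ => ‖ξ‖ ^ n * ‖b ξ‖)) :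
    Integrable (fun ξ => ‖ξ‖ ^ n * ‖beurlingMultiplier ξ * b ξ‖) := by
  have hm := measurable_beurlingMultiplier
  refine hb.mono (by fun_prop) (Eventually.of_forall fun ξ => ?_)
  simp only [norm_mul, norm_norm]
  gcongr
  exact mul_le_of_le_one_left (norm_nonneg _) (norm_beurlingMultiplier_le ξ)

theorem integrable_of_pow_zero {b : ℂ → ℂ} (hbm : Measurable b)
    (hb : Integrable (fun ξ => ‖ξ‖ ^ 0 * ‖b ξ‖)) : Integrable b := by
  simp only [pow_zero, one_mul] at hb
  exact (integrable_norm_iff hbm.aestronglyMeasurable).1 hb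

section NeumannSum

variable {k : ℂ → ℂ}

theorem lintegral_neumannTerm_le (hkm : StronglyMeasurable k) (hk : ∫⁻ x, ‖k x‖ₑ ≤ 1 / 4) (n : ℕ) :
    ∫⁻ x, ‖neumannTerm k n x‖ₑ ≤ (1 / 4) ^ (n + 1) := by
  have := lintegral_weight_neumannTerm_le (w := fun _ => 1) measurable_const (by simp) hkm n
  simp only [one_mul] at this
  exact this.trans (by gcongr)

theorem integrable_neumannTerm (hkm : StronglyMeasurable k) (hk : ∫⁻ x, ‖k x‖ₑ ≤ 1 / 4) (n : ℕ) :
    Integrable (neumannTerm k n) := by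
  refine ⟨(stronglyMeasurable_neumannTerm hkm n).aestronglyMeasurable, ?_⟩
  rw [hasFiniteIntegral_iff_enorm]
  refine (lintegral_neumannTerm_le hkm hk n).trans_lt (ENNReal.pow_lt_top ?_)
  rw [one_div, ENNReal.inv_lt_top]
  norm_num

theorem integral_norm_neumannTerm_le (hkm : StronglyMeasurable k) (hk : ∫⁻ x, ‖k x‖ₑ ≤ 1 / 4)
    (n : ℕ) : ∫ x, ‖neumannTerm k n x‖ ≤ (1 / 4) ^ (n + 1) := by
  rw [integral_norm_eq_lintegral_enorm (integrable_neumannTerm hkm hk n).1]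
  refine ENNReal.toReal_le_of_le_ofReal (by positivity)
    ((lintegral_neumannTerm_le hkm hk n).trans_eq ?_)
  rw [ENNReal.ofReal_pow (by norm_num), ENNReal.ofReal_div_of_pos (by norm_num)]
  simp

/-- The Neumann series, possibly after a bounded multiplier, may be summed before or after the inverse
Fourier transform. -/
theorem hasSum_fourierInv_multiplier_neumannTerm (hkm : StronglyMeasurable k)
    (hk : ∫⁻ x, ‖k x‖ₑ ≤ 1 / 4) {m : ℂ → ℂ} (hm : Measurable m) (hm1 : ∀ ξ, ‖m ξ‖ ≤ 1) (x : ℂ) :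
    HasSum (fun n => 𝓕⁻ (fun ξ => m ξ * neumannTerm k n ξ) x)
      (𝓕⁻ (fun ξ => m ξ * neumannSum k ξ) x) := by
  simp only [Real.fourierInv_eq', smul_eq_mul]
  have key := hasSum_integral_of_summable_integral_norm (μ := (volume : Measure ℂ))
    (F := fun (n : ℕ) (ξ : ℂ) => Complex.exp (↑(2 * Real.pi * inner ℝ ξ x) * Complex.I) *
      (m ξ * neumannTerm k n ξ)) ?_ ?_
  · have hE : (fun ξ => Complex.exp (↑(2 * Real.pi * inner ℝ ξ x) * Complex.I) *
        (m ξ * neumannSum k ξ)) = fun ξ => ∑' n, Complex.exp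
          (↑(2 * Real.pi * inner ℝ ξ x) * Complex.I) * (m ξ * neumannTerm k n ξ) := by
      funext ξ
      rw [tsum_mul_left, tsum_mul_left]
      rfl
    rw [hE]
    exact key
  · intro n
    have hb := integrable_neumannTerm hkm hk n
    refine hb.mono ?_ (Eventually.of_forall fun ξ => ?_)
    · exact (Continuous.aestronglyMeasurable (by fun_prop)).mul
        (hm.aestronglyMeasurable.mul hb.1)
    · rw [norm_mul, norm_mul, Complex.norm_exp_ofReal_mul_I, one_mul]
      exact mul_le_of_le_one_left (norm_nonneg _) (hm1 ξ)
  · have hg : Summable (fun n : ℕ => (1 / 4 : ℝ) ^ (n + 1)) :=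
      (summable_nat_add_iff 1).2 (summable_geometric_of_lt_one (by norm_num) (by norm_num))
    refine hg.of_nonneg_of_le (fun n => integral_nonneg fun ξ => norm_nonneg _) fun n => ?_
    refine le_trans (integral_mono_of_nonneg (Eventually.of_forall fun ξ => norm_nonneg _)
      (integrable_neumannTerm hkm hk n).norm (Eventually.of_forall fun ξ => ?_))
      (integral_norm_neumannTerm_le hkm hk n)
    simp only [norm_mul, Complex.norm_exp_ofReal_mul_I, one_mul]
    exact mul_le_of_le_one_left (norm_nonneg _) (hm1 ξ)

/-- The `L¹` norm of the Neumann sum bounds `|S h|` below `1`, which makes `∂w/∂z = 1 + S h` non-zero. -/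
theorem integral_norm_neumannSum_lt_one (hkm : StronglyMeasurable k)
    (hk : ∫⁻ x, ‖k x‖ₑ ≤ 1 / 4) : ∫ x, ‖neumannSum k x‖ < 1 := by
  rw [integral_norm_eq_lintegral_enorm (measurable_neumannSum hkm).aestronglyMeasurable]
  have h : ∫⁻ x, ‖neumannSum k x‖ₑ ≤ 1 / 2 := by
    calc ∫⁻ x, ‖neumannSum k x‖ₑ ≤ ∫⁻ x, ∑' n, ‖neumannTerm k n x‖ₑ :=
          lintegral_mono fun x => enorm_tsum_le_tsum_enorm
      _ = ∑' n, ∫⁻ x, ‖neumannTerm k n x‖ₑ :=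
          lintegral_tsum fun n =>
            (stronglyMeasurable_neumannTerm hkm n).measurable.enorm.aemeasurable
      _ ≤ ∑' n : ℕ, ENNReal.ofReal ((1 / 4 : ℝ) ^ (n + 1)) := by
          refine ENNReal.tsum_le_tsum fun n => (lintegral_neumannTerm_le hkm hk n).trans_eq ?_
          rw [ENNReal.ofReal_pow (by norm_num), ENNReal.ofReal_div_of_pos (by norm_num)]
          simp
      _ ≤ ENNReal.ofReal (1 / 2) := by
          have hs : Summable (fun n : ℕ => (1 / 4 : ℝ) ^ (n + 1)) :=
            (summable_nat_add_iff 1).2 (summable_geometric_of_lt_one (by norm_num) (by norm_num))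
          rw [← ENNReal.ofReal_tsum_of_nonneg (fun n => by positivity) hs]
          apply ENNReal.ofReal_le_ofReal
          simp_rw [pow_succ]
          rw [tsum_mul_right, tsum_geometric_of_lt_one (by norm_num) (by norm_num)]
          norm_num
      _ = 1 / 2 := by rw [ENNReal.ofReal_div_of_pos (by norm_num)]; simp
  refine (ENNReal.toReal_mono (by simp) h).trans_lt ?_
  simp only [one_div, ENNReal.toReal_inv, ENNReal.toReal_ofNat]
  norm_num

theorem norm_fourierInv_multiplier_neumannSum_lt_one (hkm : StronglyMeasurable k)
    (hk : ∫⁻ x, ‖k x‖ₑ ≤ 1 / 4) (hint : Integrable (neumannSum k)) (x : ℂ) :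
    ‖𝓕⁻ (fun ξ => beurlingMultiplier ξ * neumannSum k ξ) x‖ < 1 := by
  rw [Real.fourierInv_eq']
  refine (norm_integral_le_integral_norm _).trans_lt
    (lt_of_le_of_lt ?_ (integral_norm_neumannSum_lt_one hkm hk))
  refine integral_mono_of_nonneg (Eventually.of_forall fun ξ => norm_nonneg _) hint.norm
    (Eventually.of_forall fun ξ => ?_)
  simp only [smul_eq_mul, norm_mul, Complex.norm_exp_ofReal_mul_I, one_mul]
  exact mul_le_of_le_one_left (norm_nonneg _) (norm_beurlingMultiplier_le ξ)

/-- The inverse Fourier transform `h` of the Neumann sum solves `h = ν (1 + S h)`, where `ν` is the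
inverse Fourier transform of `k` and `S` is the Beurling transform. -/
theorem fourierInv_neumannSum (hkm : StronglyMeasurable k) (hkint : Integrable k)
    (hk : ∫⁻ x, ‖k x‖ₑ ≤ 1 / 4) (x : ℂ) :
    𝓕⁻ (neumannSum k) x =
      𝓕⁻ k x * (1 + 𝓕⁻ (fun ξ => beurlingMultiplier ξ * neumannSum k ξ) x) := by
  have h1 : HasSum (fun n => 𝓕⁻ (neumannTerm k n) x) (𝓕⁻ (neumannSum k) x) := by
    simpa only [one_mul] using hasSum_fourierInv_multiplier_neumannTerm hkm hk
      (m := fun _ => 1) measurable_const (by simp) x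
  have h2 := hasSum_fourierInv_multiplier_neumannTerm hkm hk measurable_beurlingMultiplier
    norm_beurlingMultiplier_le x
  -- the inverse Fourier transform takes the convolution in `neumannTerm` to a product
  have hstep : ∀ n, 𝓕⁻ (neumannTerm k (n + 1)) x =
      𝓕⁻ k x * 𝓕⁻ (fun ξ => beurlingMultiplier ξ * neumannTerm k n ξ) x := by
    intro n
    have hb := integrable_neumannTerm hkm hk n
    have hmb : Integrable (fun ξ => beurlingMultiplier ξ * neumannTerm k n ξ) :=
      hb.mono (measurable_beurlingMultiplier.aestronglyMeasurable.mul hb.1)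
        (Eventually.of_forall fun ξ => by
          rw [norm_mul]
          exact mul_le_of_le_one_left (norm_nonneg _) (norm_beurlingMultiplier_le ξ))
    have hc := Real.fourier_mul_convolution_eq hmb hkint (-x)
    rw [Real.fourierInv_eq_fourier_neg, Real.fourierInv_eq_fourier_neg,
      Real.fourierInv_eq_fourier_neg, mul_comm, ← hc]
    rfl
  have h3 := h2.mul_left (𝓕⁻ k x)
  simp_rw [← hstep] at h3
  have h4 := ((hasSum_nat_add_iff' (f := fun n => 𝓕⁻ (neumannTerm k n) x) 1).2 h1).unique h3
  rw [Finset.sum_range_one, sub_eq_iff_eq_add] at h4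
  rw [h4, show neumannTerm k 0 = k from rfl]
  ring

end NeumannSum

/-- The Cauchy transform of `𝓕⁻ b`, normalized to vanish at the origin. -/
noncomputable def cauchyPotential (b : ℂ → ℂ) (x : ℂ) : ℂ :=
  ∫ ξ, b ξ * ((Complex.exp (↑(2 * Real.pi * inner ℝ ξ x) * Complex.I) - 1) /
    (Real.pi * Complex.I * ξ))

/-- For the Cauchy transform `u` of `h = 𝓕⁻ b`: `∂u/∂z̄ = h`, and `∂u/∂z` is the Beurling transform
of `h`. -/
theorem hasFDerivAt_cauchyPotential {b : ℂ → ℂ} (hbm : Measurable b) (hb : Integrable b) (x : ℂ) :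
    HasFDerivAt (cauchyPotential b)
      ((𝓕⁻ (fun ξ => beurlingMultiplier ξ * b ξ) x) • ContinuousLinearMap.id ℝ ℂ +
        (𝓕⁻ b x) • (Complex.conjCLE : ℂ →L[ℝ] ℂ)) x := by
  have hmm := measurable_beurlingMultiplier
  set e : ℂ → ℂ → ℂ := fun x ξ => Complex.exp (↑(2 * Real.pi * inner ℝ ξ x) * Complex.I) with he
  have hem : ∀ x, Measurable (e x) := fun x => by
    apply Continuous.measurable; simp only [he]; fun_prop
  have hmb : Integrable (fun ξ => beurlingMultiplier ξ * b ξ) :=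
    hb.mono (by fun_prop) (Eventually.of_forall fun ξ => by
      rw [norm_mul]
      exact mul_le_of_le_one_left (norm_nonneg _) (norm_beurlingMultiplier_le ξ))
  have hebi : ∀ {c : ℂ → ℂ}, Integrable c → Integrable (fun ξ => e x ξ * c ξ) := by
    intro c hc
    refine hc.mono ((hem x).aestronglyMeasurable.mul hc.1) (Eventually.of_forall fun ξ => ?_)
    simp [he, Complex.norm_exp_ofReal_mul_I, -Complex.ofReal_mul]
  have hF : HasFDerivAt (cauchyPotential b)
      (∫ ξ, ((e x ξ * (beurlingMultiplier ξ * b ξ)) • ContinuousLinearMap.id ℝ ℂ +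
        (e x ξ * b ξ) • (Complex.conjCLE : ℂ →L[ℝ] ℂ))) x := by
    -- differentiation under the integral sign; the quotient by `ξ` cancels upon differentiation
    refine hasFDerivAt_integral_of_dominated_of_fderiv_le (𝕜 := ℝ) (μ := volume)
      (F' := fun x ξ => (e x ξ * (beurlingMultiplier ξ * b ξ)) • ContinuousLinearMap.id ℝ ℂ +
        (e x ξ * b ξ) • (Complex.conjCLE : ℂ →L[ℝ] ℂ))
      (bound := fun ξ => 2 * ‖b ξ‖) (s := Set.univ) univ_mem ?_ ?_ ?_ ?_ ?_ ?_
    · refine Eventually.of_forall fun y => Measurable.aestronglyMeasurable ?_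
      have := hem y
      simp only [he] at this
      fun_prop
    · refine (hb.norm.const_mul (2 * ‖x‖)).mono' ?_ (Eventually.of_forall fun ξ => ?_)
      · refine Measurable.aestronglyMeasurable ?_
        have := hem x
        simp only [he] at this
        fun_prop
      · rw [norm_mul, norm_div, mul_comm (2 * ‖x‖)]
        gcongr
        rcases eq_or_ne ξ 0 with rfl | hξ
        · simp
        · rw [div_le_iff₀ (by simp [hξ, Real.pi_pos.ne'])]
          rw [mul_comm _ Complex.I]
          refine Real.norm_exp_I_mul_ofReal_sub_one_le.trans ?_
          rw [norm_mul, norm_mul, norm_mul (_ * _) ξ, norm_mul _ Complex.I, Complex.norm_real,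
            Complex.norm_I]
          have := norm_inner_le_norm (𝕜 := ℝ) ξ x
          simp only [Real.norm_ofNat, mul_one]
          calc 2 * ‖Real.pi‖ * ‖inner ℝ ξ x‖ ≤ 2 * ‖Real.pi‖ * (‖ξ‖ * ‖x‖) := by gcongr
            _ = _ := by ring
    · exact ((hebi hmb).1.smul_const _).add ((hebi hb).1.smul_const _)
    · refine Eventually.of_forall fun ξ y _ => ?_
      refine (norm_add_le _ _).trans ?_
      have h1 : ‖(Complex.conjCLE : ℂ →L[ℝ] ℂ)‖ ≤ 1 := Complex.conjCLE_norm.le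
      have h2 : ‖ContinuousLinearMap.id ℝ ℂ‖ ≤ 1 := ContinuousLinearMap.norm_id_le
      have h3 : ‖e y ξ‖ = 1 := Complex.norm_exp_ofReal_mul_I _
      rw [norm_smul, norm_smul, norm_mul, norm_mul, norm_mul, h3, two_mul, one_mul, one_mul]
      have h4 := norm_beurlingMultiplier_le ξ
      have h5 := norm_nonneg (b ξ)
      have h6 : ‖beurlingMultiplier ξ‖ * ‖b ξ‖ ≤ ‖b ξ‖ := mul_le_of_le_one_left h5 h4
      have h7 : 0 ≤ ‖beurlingMultiplier ξ‖ * ‖b ξ‖ := by positivity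
      exact add_le_add ((mul_le_of_le_one_right h7 h2).trans h6) (mul_le_of_le_one_right h5 h1)
    · exact hb.norm.const_mul 2
    · have h0 : ∀ᵐ ξ : ℂ, ξ ≠ 0 := by
        simp [ae_iff]
      filter_upwards [h0] with ξ hξ y _
      have hin : HasFDerivAt (fun y : ℂ => (↑(2 * Real.pi * inner ℝ ξ y) * Complex.I : ℂ))
          (((2 * Real.pi * Complex.I : ℂ)) • (Complex.ofRealCLM.comp (innerSL ℝ ξ))) y := by
        have := (Complex.ofRealCLM.hasFDerivAt.comp y (innerSL ℝ ξ).hasFDerivAt).const_mul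
          (2 * Real.pi * Complex.I : ℂ)
        refine this.congr_of_eventuallyEq (Eventually.of_forall fun z => ?_)
        simp
        ring
      have := (((hin.cexp.sub_const 1).mul_const (Real.pi * Complex.I * ξ)⁻¹).const_mul (b ξ))
      refine this.congr_fderiv ?_
      ext v
      have hpi : (Real.pi : ℂ) ≠ 0 := by exact_mod_cast Real.pi_pos.ne'
      have hinn : (2 : ℂ) * ((inner ℝ ξ v : ℝ) : ℂ) = conj ξ * v + ξ * conj v := by
        rw [Complex.inner]
        apply Complex.ext <;> simp <;> ring
      have hv : (2 : ℂ) * Real.pi * Complex.I * ((inner ℝ ξ v : ℝ) : ℂ) =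
          Real.pi * Complex.I * (conj ξ * v + ξ * conj v) := by rw [← hinn]; ring
      simp [beurlingMultiplier, he, div_eq_mul_inv, -Complex.inner]
      field_simp
      rw [← hinn]
      linear_combination (-2 * b ξ * ((inner ℝ ξ v : ℝ) : ℂ)) * Complex.I_sq
  refine hF.congr_fderiv ?_
  rw [integral_add ((hebi hmb).smul_const _) ((hebi hb).smul_const _), integral_smul_const,
    integral_smul_const, Real.fourierInv_eq', Real.fourierInv_eq']
  rfl

/-- The Beltrami equation `∂w/∂z̄ = ν ∂w/∂z`, for a Schwartz function `ν` whose Fourier transform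
has small `L¹` norm, has a smooth solution with non-vanishing `∂w/∂z`. -/
theorem exists_beltrami_solution_of_lintegral_fourier_le (ν : 𝓢(ℂ, ℂ))
    (hk : ∫⁻ x, ‖𝓕 (ν : ℂ → ℂ) x‖ₑ ≤ 1 / 4) :
    ∃ w ρ : ℂ → ℂ, ContDiff ℝ ∞ w ∧ (∀ x, ρ x ≠ 0) ∧
      ∀ x, HasFDerivAt w (ρ x • (ContinuousLinearMap.id ℝ ℂ +
        ν x • (Complex.conjCLE : ℂ →L[ℝ] ℂ))) x := by
  set k : ℂ → ℂ := 𝓕 (ν : ℂ → ℂ) with hkdef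
  have hk' : k = (𝓕 ν : 𝓢(ℂ, ℂ)) := (SchwartzMap.fourier_coe ν).symm
  have hkm : StronglyMeasurable k := by rw [hk']; exact (𝓕 ν).continuous.stronglyMeasurable
  have hkN : ∀ N : ℕ, Integrable (fun x => (1 + ‖x‖) ^ N * ‖k x‖) := by
    intro N
    have : (fun x : ℂ => (1 + ‖x‖) ^ N * ‖k x‖) =
        fun x => ∑ j ∈ Finset.range (N + 1), (N.choose j : ℝ) * (‖x‖ ^ j * ‖k x‖) := by
      funext x
      rw [add_comm, add_pow, Finset.sum_mul]
      refine Finset.sum_congr rfl fun j _ => ?_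
      ring
    rw [this]
    refine integrable_finsetSum _ fun j _ => Integrable.const_mul ?_ _
    rw [hk']
    exact (𝓕 ν).integrable_pow_mul volume j
  set a := neumannSum k
  have ham : Measurable a := measurable_neumannSum hkm
  have hmom : ∀ n : ℕ, Integrable (fun ξ => ‖ξ‖ ^ n * ‖a ξ‖) := fun n =>
    integrable_pow_mul_of_lintegral_lt_top ham n
      (lintegral_weight_neumannSum_lt_top hkm hk hkN n)
  have hai : Integrable a := integrable_of_pow_zero ham (hmom 0)
  set H := 𝓕⁻ a
  set S := 𝓕⁻ (fun ξ => beurlingMultiplier ξ * a ξ) with hS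
  have hHsmooth : ContDiff ℝ ∞ H := contDiff_fourierInv hmom
  have hSsmooth : ContDiff ℝ ∞ S :=
    contDiff_fourierInv fun n => integrable_pow_mul_multiplier ham (hmom n)
  have hkint : Integrable k := by rw [hk']; exact (𝓕 ν).integrable
  have hHS : ∀ x, H x = ν x * (1 + S x) := by
    intro x
    have hinv : 𝓕⁻ k x = ν x := by
      rw [hk', ← SchwartzMap.fourierInv_coe]; simp
    rw [← hinv]
    exact fourierInv_neumannSum hkm hkint hk x
  -- `w = z + u` with `u` the Cauchy transform of `H`: `∂w/∂z = 1 + S` and `∂w/∂z̄ = H = ν (1 + S)`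
  have hder : ∀ x, HasFDerivAt (fun x => x + cauchyPotential a x)
      ((1 + S x) • ContinuousLinearMap.id ℝ ℂ + H x • (Complex.conjCLE : ℂ →L[ℝ] ℂ)) x := by
    intro x
    refine ((hasFDerivAt_id x).add (hasFDerivAt_cauchyPotential ham hai x)).congr_fderiv ?_
    ext v
    simp only [add_apply, smul_apply, ContinuousLinearMap.id_apply, smul_eq_mul]
    ring
  refine ⟨fun x => x + cauchyPotential a x, fun x => 1 + S x, ?_, fun x h0 => ?_, fun x => ?_⟩
  · rw [contDiff_infty_iff_fderiv]
    refine ⟨fun x => (hder x).differentiableAt, ?_⟩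
    rw [show fderiv ℝ (fun x => x + cauchyPotential a x) = _ from funext fun x => (hder x).fderiv]
    fun_prop
  · have h1 : ‖S x‖ < 1 := norm_fourierInv_multiplier_neumannSum_lt_one hkm hk hai x
    have h2 : S x = -1 := by linear_combination h0
    rw [h2] at h1
    simp at h1
  · refine (hder x).congr_fderiv ?_
    rw [hHS, smul_add, smul_smul, mul_comm]

end SurfaceGeometry

end

/-! ### The local Beltrami equation -/

section

open MeasureTheory Filter Topology
open scoped FourierTransform ENNReal ComplexConjugate SchwartzMap

namespace SurfaceGeometry

/-- The translates of a Schwartz function depend in a Lipschitz way on the translation, with an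
integrable decay. -/
theorem exists_norm_translate_sub_le (g : 𝓢(ℂ, ℂ)) :
    ∃ C : ℝ, 0 ≤ C ∧ ∀ ξ v : ℂ,
      ‖g (ξ - v) - g ξ‖ ≤ C * (‖v‖ * (1 + ‖v‖) ^ 3) * ((1 + ‖ξ‖) ^ 3)⁻¹ := by
  set C := (2 ^ 3 * ((Finset.Iic (3, 1)).sup fun m => SchwartzMap.seminorm ℝ m.1 m.2) g : ℝ)
  have hC : ∀ ζ : ℂ, (1 + ‖ζ‖) ^ 3 * ‖fderiv ℝ g ζ‖ ≤ C := by
    intro ζ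
    have := SchwartzMap.one_add_le_sup_seminorm_apply (𝕜 := ℝ) (m := (3, 1)) (k := 3) (n := 1)
      le_rfl le_rfl g ζ
    rwa [norm_iteratedFDeriv_one] at this
  have hC0 : 0 ≤ C := le_trans (by positivity) (hC 0)
  refine ⟨C, hC0, fun ξ v => ?_⟩
  have hmv := Convex.norm_image_sub_le_of_norm_fderiv_le (𝕜 := ℝ) (f := g)
    (C := C * (1 + ‖v‖) ^ 3 * ((1 + ‖ξ‖) ^ 3)⁻¹) (s := segment ℝ ξ (ξ - v))
    (fun ζ _ => g.differentiableAt) ?_ (convex_segment _ _) (left_mem_segment _ _ _)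
    (right_mem_segment _ _ _)
  · calc _ ≤ _ := hmv
      _ = _ := by
        rw [sub_sub_cancel_left, norm_neg]; ring
  · intro ζ hζ
    have h1 : ‖ξ - ζ‖ ≤ ‖v‖ := by
      have := norm_sub_le_of_mem_segment hζ
      rw [norm_sub_rev]
      simpa using this
    have h2 : 1 + ‖ξ‖ ≤ (1 + ‖ζ‖) * (1 + ‖v‖) := by
      have h3 : ‖ξ‖ ≤ ‖ζ‖ + ‖v‖ := by
        calc ‖ξ‖ = ‖ζ + (ξ - ζ)‖ := by congr 1; ring
          _ ≤ ‖ζ‖ + ‖ξ - ζ‖ := norm_add_le _ _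
          _ ≤ _ := by gcongr
      nlinarith [norm_nonneg ζ, norm_nonneg v]
    rw [← div_eq_mul_inv, le_div_iff₀ (by positivity)]
    calc ‖fderiv ℝ g ζ‖ * (1 + ‖ξ‖) ^ 3 ≤ ‖fderiv ℝ g ζ‖ * ((1 + ‖ζ‖) * (1 + ‖v‖)) ^ 3 := by gcongr
      _ = ((1 + ‖ζ‖) ^ 3 * ‖fderiv ℝ g ζ‖) * (1 + ‖v‖) ^ 3 := by ring
      _ ≤ C * (1 + ‖v‖) ^ 3 := by gcongr; exact hC ζ

/-- The Fourier transform of `χ F(ε ·)` in terms of those of `χ` and `F`, if `F` vanishes at the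
origin. -/
theorem fourier_mul_dilation (χ F : 𝓢(ℂ, ℂ)) (hF0 : F 0 = 0) (ε : ℝ) (ξ : ℂ) :
    𝓕 (fun x : ℂ => χ x * F (ε • x)) ξ =
      ∫ η, (𝓕 F : 𝓢(ℂ, ℂ)) η *
        ((𝓕 χ : 𝓢(ℂ, ℂ)) (ξ - ε • η) - (𝓕 χ : 𝓢(ℂ, ℂ)) ξ) := by
  have hF : ∀ y, F y = ∫ η, Complex.exp (↑(2 * Real.pi * inner ℝ η y) * Complex.I) * (𝓕 F) η := by
    intro y
    have : 𝓕⁻ (⇑(𝓕 F : 𝓢(ℂ, ℂ))) y = F y := by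
      rw [← SchwartzMap.fourierInv_coe]; simp
    rw [← this, Real.fourierInv_eq']
    rfl
  -- this integral is `F 0`; it allows one to subtract the value at `ε = 0`
  have hint : ∫ η, (𝓕 F) η = 0 := by
    have := hF 0
    rw [hF0] at this
    simpa using this.symm
  have hχ : ∀ ζ, (𝓕 χ) ζ = ∫ x, Complex.exp (↑(-2 * Real.pi * inner ℝ x ζ) * Complex.I) * χ x := by
    intro ζ
    rw [SchwartzMap.fourier_coe, Real.fourier_eq']
    rfl
  have hFi : Integrable (𝓕 F : 𝓢(ℂ, ℂ)) := (𝓕 F : 𝓢(ℂ, ℂ)).integrable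
  have hb : ∃ C, ∀ x, ‖(𝓕 χ) x‖ ≤ C := by
    obtain ⟨C, hC⟩ := (𝓕 χ).decay 0 0
    exact ⟨C, fun x => by simpa using hC.2 x⟩
  obtain ⟨C, hC⟩ := hb
  have hi1 : Integrable (fun η => (𝓕 F) η * (𝓕 χ) (ξ - ε • η)) := by
    refine hFi.mul_bdd (c := C) ?_ (Eventually.of_forall fun η => hC _)
    exact ((𝓕 χ).continuous.comp (by fun_prop)).aestronglyMeasurable
  simp_rw [mul_sub]
  rw [integral_sub hi1 (hFi.mul_const _), integral_mul_const, hint, zero_mul, sub_zero,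
    Real.fourier_eq']
  simp_rw [hχ, hF, smul_eq_mul, ← integral_const_mul]
  rw [integral_integral_swap]
  · refine integral_congr_ae (Eventually.of_forall fun η => integral_congr_ae
      (Eventually.of_forall fun x => ?_))
    simp only
    have : Complex.exp (↑(-2 * Real.pi * inner ℝ x (ξ - ε • η)) * Complex.I) =
        Complex.exp (↑(-2 * Real.pi * inner ℝ x ξ) * Complex.I) *
          Complex.exp (↑(2 * Real.pi * inner ℝ η (ε • x)) * Complex.I) := by
      rw [← Complex.exp_add, ← add_mul, ← Complex.ofReal_add]
      congr 3
      rw [inner_sub_right, inner_smul_right, inner_smul_right, real_inner_comm x η]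
      ring
    rw [this]
    ring
  · have hp : Integrable (fun z : ℂ × ℂ => χ z.1 * (𝓕 F) z.2) (volume.prod volume) :=
      χ.integrable.mul_prod hFi
    refine hp.mono ?_ (Eventually.of_forall fun z => ?_)
    · apply Continuous.aestronglyMeasurable
      have h1 := χ.continuous
      have h2 := (𝓕 F).continuous
      unfold Function.uncurry
      fun_prop
    · simp only [Function.uncurry, norm_mul, Complex.norm_exp_ofReal_mul_I, one_mul]
      exact le_rfl

/-- Dilating a Schwartz function that vanishes at the origin makes it small near the origin, in the
norm which is the `L¹` norm of the Fourier transform. -/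
theorem exists_lintegral_fourier_dilation_le (χ F : 𝓢(ℂ, ℂ)) (hF0 : F 0 = 0) :
    ∃ ε : ℝ, 0 < ε ∧ ∫⁻ ξ, ‖𝓕 (fun x : ℂ => χ x * F (ε • x)) ξ‖ₑ ≤ 1 / 4 := by
  obtain ⟨C, hC0, hC⟩ := exists_norm_translate_sub_le (𝓕 χ)
  have hmom : Integrable (fun η => ‖(𝓕 F) η‖ * (‖η‖ * (1 + ‖η‖) ^ 3)) := by
    have : (fun η : ℂ => ‖(𝓕 F) η‖ * (‖η‖ * (1 + ‖η‖) ^ 3)) = fun η =>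
        ‖η‖ ^ 1 * ‖(𝓕 F) η‖ + 3 * (‖η‖ ^ 2 * ‖(𝓕 F) η‖) + 3 * (‖η‖ ^ 3 * ‖(𝓕 F) η‖) +
          ‖η‖ ^ 4 * ‖(𝓕 F) η‖ := by funext η; ring
    rw [this]
    have h := fun k => (𝓕 F).integrable_pow_mul volume k
    exact (((h 1).add ((h 2).const_mul 3)).add ((h 3).const_mul 3)).add (h 4)
  set D := ∫ η, ‖(𝓕 F) η‖ * (‖η‖ * (1 + ‖η‖) ^ 3) with hD
  have hD0 : 0 ≤ D := integral_nonneg fun η => by positivity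
  have hJint : Integrable (fun ξ : ℂ => ((1 + ‖ξ‖) ^ 3)⁻¹) := by
    have := integrable_one_add_norm (E := ℂ) (μ := volume) (r := 3) (by
      rw [Complex.finrank_real_complex]; norm_num)
    refine this.congr (Eventually.of_forall fun ξ => ?_)
    simp only
    rw [Real.rpow_neg (by positivity)]
    norm_cast
  set J := ∫ ξ : ℂ, ((1 + ‖ξ‖) ^ 3)⁻¹ with hJ
  have hJ0 : 0 ≤ J := integral_nonneg fun η => by positivity
  -- `C D J` bounds the `L¹` norm divided by `ε`
  obtain ⟨ε, hε0, hε1, hε⟩ : ∃ ε : ℝ, 0 < ε ∧ ε ≤ 1 ∧ ε * (C * D * J) ≤ 1 / 4 := by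
    have hP : 0 ≤ C * D * J := by positivity
    refine ⟨min 1 (1 / (4 * (C * D * J + 1))), by positivity, min_le_left _ _, ?_⟩
    calc min 1 (1 / (4 * (C * D * J + 1))) * (C * D * J)
        ≤ (1 / (4 * (C * D * J + 1))) * (C * D * J) := by gcongr; exact min_le_right _ _
      _ ≤ 1 / 4 := by
        rw [div_mul_eq_mul_div, div_le_div_iff₀ (by positivity) (by norm_num)]
        linarith
  refine ⟨ε, hε0, ?_⟩
  have hpt : ∀ ξ, ‖𝓕 (fun x : ℂ => χ x * F (ε • x)) ξ‖ ≤ ε * (C * D) * ((1 + ‖ξ‖) ^ 3)⁻¹ := by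
    intro ξ
    rw [fourier_mul_dilation χ F hF0]
    calc ‖∫ η, (𝓕 F) η * ((𝓕 χ) (ξ - ε • η) - (𝓕 χ) ξ)‖
        ≤ ∫ η, (ε * C * ((1 + ‖ξ‖) ^ 3)⁻¹) * (‖(𝓕 F) η‖ * (‖η‖ * (1 + ‖η‖) ^ 3)) := by
          refine norm_integral_le_of_norm_le (hmom.const_mul _) (Eventually.of_forall fun η => ?_)
          have hn : ‖ε • η‖ = ε * ‖η‖ := by rw [norm_smul, Real.norm_of_nonneg hε0.le]
          have hle : ε * ‖η‖ ≤ ‖η‖ := mul_le_of_le_one_left (norm_nonneg _) hε1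
          rw [norm_mul]
          calc ‖(𝓕 F) η‖ * ‖(𝓕 χ) (ξ - ε • η) - (𝓕 χ) ξ‖
              ≤ ‖(𝓕 F) η‖ * (C * (‖ε • η‖ * (1 + ‖ε • η‖) ^ 3) * ((1 + ‖ξ‖) ^ 3)⁻¹) := by
                gcongr; exact hC ξ (ε • η)
            _ ≤ ‖(𝓕 F) η‖ * (C * ((ε * ‖η‖) * (1 + ‖η‖) ^ 3) * ((1 + ‖ξ‖) ^ 3)⁻¹) := by
                rw [hn]; gcongr
            _ = _ := by ring
      _ = _ := by rw [integral_const_mul, ← hD]; ring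
  calc ∫⁻ ξ, ‖𝓕 (fun x : ℂ => χ x * F (ε • x)) ξ‖ₑ
      ≤ ∫⁻ ξ : ℂ, ENNReal.ofReal (ε * (C * D) * ((1 + ‖ξ‖) ^ 3)⁻¹) := by
        refine lintegral_mono fun ξ => ?_
        rw [← ofReal_norm]
        exact ENNReal.ofReal_le_ofReal (hpt ξ)
    _ = ENNReal.ofReal (ε * (C * D) * J) := by
        rw [← ofReal_integral_eq_lintegral_ofReal (hJint.const_mul _)
          (Eventually.of_forall fun ξ => by positivity), integral_const_mul]
    _ ≤ ENNReal.ofReal (1 / 4) := ENNReal.ofReal_le_ofReal (by linarith)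
    _ = 1 / 4 := by rw [ENNReal.ofReal_div_of_pos (by norm_num)]; simp

/-- A smooth function near a point of the plane extends, from a smaller neighbourhood, to a smooth
function with compact support. -/
theorem exists_schwartz_eventuallyEq {μ : ℂ → ℂ} (hμ : ∀ᶠ x in 𝓝 0, ContDiffAt ℝ ∞ μ x) :
    ∃ F : 𝓢(ℂ, ℂ), ∀ᶠ x in 𝓝 0, F x = μ x := by
  obtain ⟨r, hr, hball⟩ := Metric.eventually_nhds_iff_ball.1 hμ
  let b : ContDiffBump (0 : ℂ) := ⟨r / 4, r / 2, by positivity, by linarith⟩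
  have hsupp : HasCompactSupport (fun x : ℂ => (b x : ℂ) * μ x) := by
    refine HasCompactSupport.mul_right (f := fun x : ℂ => (b x : ℂ)) ?_
    exact b.hasCompactSupport.comp_left (g := ((↑) : ℝ → ℂ)) (by simp)
  have hsm : ContDiff ℝ ∞ (fun x : ℂ => (b x : ℂ) * μ x) := by
    rw [contDiff_iff_contDiffAt]
    intro x
    by_cases hx : x ∈ Metric.ball (0 : ℂ) r
    · exact (Complex.ofRealCLM.contDiff.contDiffAt.comp x b.contDiffAt).mul (hball x hx)
    · have h0 : (fun x : ℂ => (b x : ℂ) * μ x) =ᶠ[𝓝 x] fun _ => 0 := by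
        have hx' : x ∈ (Metric.closedBall (0 : ℂ) (r / 2))ᶜ := by
          simp only [Metric.mem_ball, not_lt, dist_zero_right] at hx
          simp only [Set.mem_compl_iff, Metric.mem_closedBall, not_le, dist_zero_right]
          linarith
        filter_upwards [Metric.isClosed_closedBall.isOpen_compl.mem_nhds hx'] with y hy
        have : b y = 0 := b.zero_of_le_dist (by
          simp only [Set.mem_compl_iff, Metric.mem_closedBall, not_le] at hy
          exact hy.le)
        simp [this]
      exact contDiffAt_const.congr_of_eventuallyEq h0
  refine ⟨hsupp.toSchwartzMap hsm, ?_⟩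
  filter_upwards [b.eventuallyEq_one] with x hx
  change (b x : ℂ) * μ x = μ x
  rw [hx]
  simp

/-- Local solvability of the Beltrami equation `∂w/∂z̄ = μ ∂w/∂z` for a smooth coefficient `μ` which
vanishes at the origin. -/
theorem exists_local_beltrami_solution {μ : ℂ → ℂ} (hμ : ∀ᶠ x in 𝓝 0, ContDiffAt ℝ ∞ μ x)
    (hμ0 : μ 0 = 0) :
    ∃ w ρ : ℂ → ℂ, ContDiff ℝ ∞ w ∧ (∀ x, ρ x ≠ 0) ∧
      ∀ᶠ x in 𝓝 0, HasFDerivAt w (ρ x • (ContinuousLinearMap.id ℝ ℂ +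
        μ x • (Complex.conjCLE : ℂ →L[ℝ] ℂ))) x := by
  obtain ⟨F, hF⟩ := exists_schwartz_eventuallyEq hμ
  obtain ⟨χ, hχ⟩ := exists_schwartz_eventuallyEq (μ := fun _ => 1)
    (Eventually.of_forall fun x => contDiffAt_const)
  have hF0 : F 0 = 0 := by rw [hF.self_of_nhds, hμ0]
  obtain ⟨ε, hε, hle⟩ := exists_lintegral_fourier_dilation_le χ F hF0
  have hcs : ∃ ν : 𝓢(ℂ, ℂ), (ν : ℂ → ℂ) = fun x : ℂ => χ x * F (ε • x) := by
    refine ⟨SchwartzMap.smulLeftCLM ℂ (fun x => F (ε • x)) χ, ?_⟩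
    funext x
    have ht : (fun x : ℂ => F (ε • x)).HasTemperateGrowth :=
      F.hasTemperateGrowth.comp
        (ε • ContinuousLinearMap.id ℝ ℂ : ℂ →L[ℝ] ℂ).hasTemperateGrowth
    rw [SchwartzMap.smulLeftCLM_apply_apply ht, smul_eq_mul, mul_comm]
  obtain ⟨ν, hν⟩ := hcs
  rw [← hν] at hle
  obtain ⟨w, ρ, hw, hρ, hd⟩ := exists_beltrami_solution_of_lintegral_fourier_le ν hle
  -- undo the dilation
  refine ⟨fun x => w (ε⁻¹ • x), fun x => ε⁻¹ • ρ (ε⁻¹ • x), by fun_prop, fun x =>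
    smul_ne_zero (inv_ne_zero hε.ne') (hρ _), ?_⟩
  have hscale : Tendsto (fun x : ℂ => ε⁻¹ • x) (𝓝 0) (𝓝 0) := by
    have : Continuous (fun x : ℂ => ε⁻¹ • x) := by fun_prop
    simpa using this.tendsto 0
  filter_upwards [hF, hscale.eventually hχ] with x hx1 hx2
  have h1 := (hd (ε⁻¹ • x)).comp x ((hasFDerivAt_id x).const_smul ε⁻¹)
  refine h1.congr_fderiv ?_
  have h2 : ν (ε⁻¹ • x) = μ x := by
    rw [hν]
    simp only [hx2, one_mul]
    rw [smul_smul, mul_inv_cancel₀ hε.ne', one_smul, hx1]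
  rw [h2]
  ext v
  simp
  ring

end SurfaceGeometry

end

/-! ### Isothermal coordinates in the plane -/

section

open Filter Topology Function
open scoped ComplexConjugate

namespace SurfaceGeometry

theorem contDiffAt_clm_of_apply {D E F : Type*} [NormedAddCommGroup D] [NormedSpace ℝ D]
    [NormedAddCommGroup E] [NormedSpace ℝ E] [FiniteDimensional ℝ E] [NormedAddCommGroup F]
    [NormedSpace ℝ F] {n : ℕ∞ω} {f : D → E →L[ℝ] F} {x : D}
    (h : ∀ y, ContDiffAt ℝ n (fun x => f x y) x) : ContDiffAt ℝ n f x := by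
  let d := Module.finrank ℝ E
  have hd : d = Module.finrank ℝ (Fin d → ℝ) := (Module.finrank_fin_fun ℝ).symm
  let e₁ := ContinuousLinearEquiv.ofFinrankEq hd
  let e₂ := (e₁.arrowCongr (1 : F ≃L[ℝ] F)).trans (ContinuousLinearEquiv.piRing (Fin d))
  rw [← id_comp f, ← e₂.symm_comp_self]
  exact e₂.symm.contDiff.contDiffAt.comp x (contDiffAt_pi.2 fun i => h _)

/-- A smooth complex coframe `θ` on the plane is, locally and up to a non-vanishing factor, the
differential of a complex function. -/
theorem exists_hasFDerivAt_smul_coframe {θ : ℂ → ℂ →L[ℝ] ℂ} {x₀ : ℂ}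
    (hθ : ∀ᶠ x in 𝓝 x₀, ContDiffAt ℝ ∞ θ x) (hdet : (θ x₀).det ≠ 0) :
    ∃ w ρ : ℂ → ℂ, ContDiff ℝ ∞ w ∧
      ∀ᶠ x in 𝓝 x₀, ρ x ≠ 0 ∧ HasFDerivAt w (ρ x • θ x) x := by
  -- normalize `θ` to be the identity at the origin
  set T : ℂ ≃L[ℝ] ℂ := (θ x₀).toContinuousLinearEquivOfDetNeZero hdet with hT
  have hTθ : ∀ v, T v = θ x₀ v := fun v => rfl
  set S : ℂ → ℂ := fun y => x₀ + T.symm y with hS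
  have hScont : Tendsto S (𝓝 0) (𝓝 x₀) := by
    have h1 : Continuous S := by fun_prop
    simpa [hS] using h1.tendsto 0
  have hSsm : ContDiff ℝ ∞ S := by fun_prop
  set θ' : ℂ → ℂ →L[ℝ] ℂ := fun y => (θ (S y)).comp (T.symm : ℂ →L[ℝ] ℂ) with hθ'
  have hθ'sm : ∀ᶠ y in 𝓝 0, ContDiffAt ℝ ∞ θ' y := by
    filter_upwards [hScont.eventually hθ] with y hy
    exact (hy.comp y hSsm.contDiffAt).clm_comp contDiffAt_const
  have hθ'0 : ∀ v, θ' 0 v = v := by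
    intro v
    simp only [hθ', hS, map_zero, add_zero, ContinuousLinearMap.comp_apply]
    rw [← hTθ]
    simp
  -- decompose `θ' = α dz + β dz̄`; the Beltrami coefficient is `β / α`
  set α : ℂ → ℂ := fun y => (θ' y 1 - Complex.I * θ' y Complex.I) / 2 with hα
  set β : ℂ → ℂ := fun y => (θ' y 1 + Complex.I * θ' y Complex.I) / 2 with hβ
  have hαβ : ∀ y v, θ' y v = α y * v + β y * conj v := by
    intro y v
    have hv : v = v.re • (1 : ℂ) + v.im • Complex.I := by
      apply Complex.ext <;> simp
    have hcv : conj v = v.re - v.im * Complex.I := by apply Complex.ext <;> simp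
    have hvv : v = v.re + v.im * Complex.I := by apply Complex.ext <;> simp
    have h1 : θ' y v = v.re * θ' y 1 + v.im * θ' y Complex.I := by
      conv_lhs => rw [hv]
      rw [map_add, map_smul, map_smul, Complex.real_smul, Complex.real_smul]
    rw [h1, hcv]
    nth_rewrite 3 [hvv]
    simp only [hα, hβ]
    linear_combination ((v.im : ℂ) * θ' y Complex.I) * Complex.I_sq
  have hα0 : α 0 = 1 := by
    simp only [hα, hθ'0]
    linear_combination (-1 / 2) * Complex.I_sq
  have hβ0 : β 0 = 0 := by
    simp only [hβ, hθ'0]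
    linear_combination (1 / 2) * Complex.I_sq
  have hαsm : ∀ᶠ y in 𝓝 0, ContDiffAt ℝ ∞ α y := by
    filter_upwards [hθ'sm] with y hy
    exact ((hy.clm_apply contDiffAt_const).sub
      (contDiffAt_const.mul (hy.clm_apply contDiffAt_const))).div_const 2
  have hβsm : ∀ᶠ y in 𝓝 0, ContDiffAt ℝ ∞ β y := by
    filter_upwards [hθ'sm] with y hy
    exact ((hy.clm_apply contDiffAt_const).add
      (contDiffAt_const.mul (hy.clm_apply contDiffAt_const))).div_const 2
  have hαne : ∀ᶠ y in 𝓝 0, α y ≠ 0 :=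
    hαsm.self_of_nhds.continuousAt.eventually_ne (by rw [hα0]; exact one_ne_zero)
  have hμsm : ∀ᶠ y in 𝓝 0, ContDiffAt ℝ ∞ (fun y => β y / α y) y := by
    filter_upwards [hαsm, hβsm, hαne] with y h1 h2 h3
    simp only [div_eq_mul_inv]
    exact h2.mul (h1.inv h3)
  obtain ⟨w, ρ, hw, hρ, hd⟩ := exists_local_beltrami_solution hμsm (by simp [hβ0])
  set R : ℂ → ℂ := fun x => T (x - x₀) with hR
  have hRS : ∀ x, S (R x) = x := fun x => by simp [hS, hR]
  have hRt : Tendsto R (𝓝 x₀) (𝓝 0) := by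
    have h1 : Continuous R := by fun_prop
    simpa [hR] using h1.tendsto x₀
  refine ⟨fun x => w (R x), fun x => ρ (R x) / α (R x), by fun_prop, ?_⟩
  filter_upwards [hRt.eventually hd, hRt.eventually hαne] with x h1 h2
  refine ⟨div_ne_zero (hρ _) h2, ?_⟩
  have hRd : HasFDerivAt R (T : ℂ →L[ℝ] ℂ) x :=
    T.hasFDerivAt.comp x ((hasFDerivAt_id x).sub_const x₀)
  refine (h1.comp x hRd).congr_fderiv ?_
  ext v
  have h3 : θ x v = θ' (R x) (T v) := by
    simp only [hθ', hRS, ContinuousLinearMap.comp_apply]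
    simp
  simp only [ContinuousLinearMap.comp_apply, smul_apply, h3, hαβ]
  simp
  field_simp

theorem det_clm_complex (L : ℂ →L[ℝ] ℂ) :
    L.det = (L 1).re * (L Complex.I).im - (L Complex.I).re * (L 1).im := by
  rw [ContinuousLinearMap.det, ← LinearMap.det_toMatrix Complex.basisOneI, Matrix.det_fin_two]
  simp [LinearMap.toMatrix_apply]

/-- The complex coframe obtained from a positive definite form on the plane by orthonormalizing the
coframe `(dx, dy)`. -/
noncomputable def metricCoframe (G : ℂ →L[ℝ] ℂ →L[ℝ] ℝ) : ℂ →L[ℝ] ℂ :=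
  Complex.reCLM.smulRight ((√(G 1 1) : ℝ) : ℂ) +
    Complex.imCLM.smulRight ((G 1 Complex.I / √(G 1 1) : ℝ) +
      (√(G 1 1 * G Complex.I Complex.I - G 1 Complex.I ^ 2) / √(G 1 1) : ℝ) * Complex.I)

/-- The strict Cauchy-Schwarz inequality. -/
theorem gram_pos {V : Type*} [AddCommGroup V] [Module ℝ V] [TopologicalSpace V]
    {G : V →L[ℝ] V →L[ℝ] ℝ}
    (hs : ∀ u v, G u v = G v u) (hp : ∀ v, v ≠ 0 → 0 < G v v) {u v : V}
    (h : LinearIndependent ℝ ![u, v]) : 0 < G u u * G v v - G u v ^ 2 := by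
  have hu : u ≠ 0 := h.ne_zero 0
  have huu := hp u hu
  set z := G u u • v - G u v • u with hz
  have hz0 : z ≠ 0 := by
    intro h0
    have := LinearIndependent.pair_iff.1 h (-(G u v)) (G u u) (by rw [← h0, hz]; module)
    exact huu.ne' this.2
  have h1 := hp z hz0
  have h2 : G z z = G u u * (G u u * G v v - G u v ^ 2) := by
    simp only [hz, map_sub, map_smul, sub_apply, smul_apply,
      smul_eq_mul, hs v u]
    ring
  rw [h2] at h1
  exact pos_of_mul_pos_right h1 huu.le

theorem linearIndependent_one_I : LinearIndependent ℝ ![(1 : ℂ), Complex.I] := by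
  have := Complex.basisOneI.linearIndependent
  rwa [Complex.coe_basisOneI] at this

section MetricCoframe

variable {G : ℂ →L[ℝ] ℂ →L[ℝ] ℝ} (hs : ∀ u v, G u v = G v u) (hp : ∀ v, v ≠ 0 → 0 < G v v)
include hs hp

/-- The metric is the pullback of the Euclidean one by its coframe, `G = |θ|²`. -/
theorem inner_metricCoframe (u v : ℂ) :
    inner ℝ (metricCoframe G u) (metricCoframe G v) = G u v := by
  have hE : 0 < G 1 1 := hp 1 one_ne_zero
  have hD := gram_pos hs hp linearIndependent_one_I
  have hv : ∀ v : ℂ, v = v.re • (1 : ℂ) + v.im • Complex.I := fun v => by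
    apply Complex.ext <;> simp
  have h1 : G u v = u.re * v.re * G 1 1 + (u.re * v.im + u.im * v.re) * G 1 Complex.I +
      u.im * v.im * G Complex.I Complex.I := by
    conv_lhs => rw [hv u, hv v]
    simp only [map_add, map_smul, add_apply, smul_apply, smul_eq_mul, hs Complex.I 1]
    ring
  have hsE := Real.sq_sqrt hE.le
  have hsD := Real.sq_sqrt hD.le
  have hsE0 : √(G 1 1) ≠ 0 := (Real.sqrt_pos.2 hE).ne'
  rw [h1, Complex.inner]
  set s := √(G 1 1)
  set t := √(G 1 1 * G Complex.I Complex.I - G 1 Complex.I ^ 2)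
  have e1 : G 1 1 = s ^ 2 := hsE.symm
  have e2 : G Complex.I Complex.I = (t ^ 2 + G 1 Complex.I ^ 2) / s ^ 2 := by
    rw [hsD, hsE]; field_simp; ring
  have hc : ∀ v, metricCoframe G v =
      ⟨v.re * s + v.im * (G 1 Complex.I / s), v.im * (t / s)⟩ := by
    intro v
    apply Complex.ext <;> simp [metricCoframe, s, t]
  rw [hc, hc, e2, e1]
  simp
  field_simp
  ring

theorem det_metricCoframe_pos : 0 < (metricCoframe G).det := by
  have hE : 0 < G 1 1 := hp 1 one_ne_zero
  have hD := gram_pos hs hp linearIndependent_one_I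
  have hsE0 := Real.sqrt_pos.2 hE
  have hsD0 := Real.sqrt_pos.2 hD
  rw [det_clm_complex]
  simp [metricCoframe]
  positivity

end MetricCoframe

theorem contDiffAt_metricCoframe {G : ℂ → ℂ →L[ℝ] ℂ →L[ℝ] ℝ} {x : ℂ} (hG : ContDiffAt ℝ ∞ G x)
    (hs : ∀ u v, G x u v = G x v u) (hp : ∀ v, v ≠ 0 → 0 < G x v v) :
    ContDiffAt ℝ ∞ (fun x => metricCoframe (G x)) x := by
  have hE : 0 < G x 1 1 := hp 1 one_ne_zero
  have hD := gram_pos hs hp linearIndependent_one_I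
  have hsE0 := Real.sqrt_pos.2 hE
  have happ : ∀ u v, ContDiffAt ℝ ∞ (fun x => G x u v) x := fun u v =>
    (hG.clm_apply contDiffAt_const).clm_apply contDiffAt_const
  have h1 : ContDiffAt ℝ ∞ (fun x => √(G x 1 1)) x := (happ 1 1).sqrt hE.ne'
  have h2 : ContDiffAt ℝ ∞
      (fun x => √(G x 1 1 * G x Complex.I Complex.I - G x 1 Complex.I ^ 2)) x :=
    (((happ _ _).mul (happ _ _)).sub ((happ _ _).pow 2)).sqrt hD.ne'
  have hr : ∀ {f : ℂ → ℝ}, ContDiffAt ℝ ∞ f x → ContDiffAt ℝ ∞ (fun x => (f x : ℂ)) x :=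
    fun hf => Complex.ofRealCLM.contDiff.contDiffAt.comp x hf
  unfold metricCoframe
  refine (contDiffAt_const.smulRight (hr h1)).add (contDiffAt_const.smulRight ?_)
  exact (hr ((happ _ _).div h1 hsE0.ne')).add ((hr (h2.div h1 hsE0.ne')).mul contDiffAt_const)

/-- Existence of isothermal coordinates for a smooth metric on a domain of the complex plane. -/
theorem exists_isothermal_complex {G : ℂ → ℂ →L[ℝ] ℂ →L[ℝ] ℝ} {x₀ : ℂ}
    (hG : ∀ᶠ x in 𝓝 x₀, ContDiffAt ℝ ∞ G x) (hs : ∀ᶠ x in 𝓝 x₀, ∀ u v, G x u v = G x v u)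
    (hp : ∀ᶠ x in 𝓝 x₀, ∀ v, v ≠ 0 → 0 < G x v v) :
    ∃ (w : ℂ → ℂ) (lam : ℂ → ℝ), ContDiff ℝ ∞ w ∧ ∀ᶠ x in 𝓝 x₀, 0 < lam x ∧
      0 < (fderiv ℝ w x).det ∧
      ∀ u v, G x u v = lam x ^ 2 * inner ℝ (fderiv ℝ w x u) (fderiv ℝ w x v) := by
  obtain ⟨w, ρ, hw, hd⟩ := exists_hasFDerivAt_smul_coframe
    (θ := fun x => metricCoframe (G x)) (x₀ := x₀)
    (by filter_upwards [hG, hs, hp] with x h1 h2 h3 using contDiffAt_metricCoframe h1 h2 h3)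
    (det_metricCoframe_pos hs.self_of_nhds hp.self_of_nhds).ne'
  refine ⟨w, fun x => ‖ρ x‖⁻¹, hw, ?_⟩
  filter_upwards [hd, hs, hp] with x h1 h2 h3
  obtain ⟨hρ, h1⟩ := h1
  have hρ0 : 0 < ‖ρ x‖ := norm_pos_iff.2 hρ
  have hns : ‖ρ x‖ ^ 2 = (ρ x).re ^ 2 + (ρ x).im ^ 2 := by
    rw [← Complex.normSq_eq_norm_sq, Complex.normSq_apply]; ring
  refine ⟨inv_pos.2 hρ0, ?_, fun u v => ?_⟩
  · have h4 := det_metricCoframe_pos h2 h3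
    rw [h1.fderiv, det_clm_complex]
    rw [det_clm_complex] at h4
    have : ((ρ x • metricCoframe (G x)) 1).re * ((ρ x • metricCoframe (G x)) Complex.I).im -
        ((ρ x • metricCoframe (G x)) Complex.I).re * ((ρ x • metricCoframe (G x)) 1).im =
        ‖ρ x‖ ^ 2 * ((metricCoframe (G x) 1).re * (metricCoframe (G x) Complex.I).im -
          (metricCoframe (G x) Complex.I).re * (metricCoframe (G x) 1).im) := by
      rw [hns]
      simp only [smul_apply, smul_eq_mul, Complex.mul_re, Complex.mul_im]
      ring
    rw [this]
    positivity
  · rw [h1.fderiv, ← inner_metricCoframe h2 h3 u v]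
    have : inner ℝ ((ρ x • metricCoframe (G x)) u) ((ρ x • metricCoframe (G x)) v) =
        ‖ρ x‖ ^ 2 * inner ℝ (metricCoframe (G x) u) (metricCoframe (G x) v) := by
      rw [hns]
      simp only [smul_apply, smul_eq_mul, Complex.inner, Complex.mul_re, Complex.mul_im,
        map_mul, Complex.conj_re, Complex.conj_im]
      ring
    rw [this, ← mul_assoc, inv_pow, inv_mul_cancel₀ (by positivity), one_mul]

/-- The isometry `x + i y ↦ (x, y)` between the complex plane and the Euclidean plane. -/
noncomputable def planeEquiv : ℂ ≃ₗᵢ[ℝ] EuclideanSpace ℝ (Fin 2) :=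
  Complex.orthonormalBasisOneI.repr

theorem planeEquiv_apply (z : ℂ) : planeEquiv z = toPlane z := by
  ext i
  fin_cases i <;> simp [planeEquiv, toPlane]

theorem planeEquiv_one : planeEquiv 1 = EuclideanSpace.single 0 1 := by
  rw [planeEquiv_apply]; ext i; fin_cases i <;> simp [toPlane]

theorem planeEquiv_I : planeEquiv Complex.I = EuclideanSpace.single 1 1 := by
  rw [planeEquiv_apply]; ext i; fin_cases i <;> simp [toPlane]

/-- Existence of isothermal coordinates for a smooth metric on a domain of the Euclidean plane. -/
theorem exists_isothermal_plane
    {G : EuclideanSpace ℝ (Fin 2) → EuclideanSpace ℝ (Fin 2) →L[ℝ] EuclideanSpace ℝ (Fin 2) →L[ℝ] ℝ}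
    {x₀ : EuclideanSpace ℝ (Fin 2)}
    (hG : ∀ᶠ x in 𝓝 x₀, ContDiffAt ℝ ∞ G x) (hs : ∀ᶠ x in 𝓝 x₀, ∀ u v, G x u v = G x v u)
    (hp : ∀ᶠ x in 𝓝 x₀, ∀ v, v ≠ 0 → 0 < G x v v) :
    ∃ (w : EuclideanSpace ℝ (Fin 2) → EuclideanSpace ℝ (Fin 2))
      (lam : EuclideanSpace ℝ (Fin 2) → ℝ), ContDiff ℝ ∞ w ∧ ∀ᶠ x in 𝓝 x₀, 0 < lam x ∧
      0 < (fderiv ℝ w x).det ∧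
      ∀ u v, G x u v = lam x ^ 2 * inner ℝ (fderiv ℝ w x u) (fderiv ℝ w x v) := by
  set ι : ℂ ≃L[ℝ] EuclideanSpace ℝ (Fin 2) := planeEquiv.toContinuousLinearEquiv with hι
  have hιt : Tendsto ι (𝓝 (ι.symm x₀)) (𝓝 x₀) := by
    have := ι.continuous.tendsto (ι.symm x₀)
    simpa using this
  have hιs : Tendsto ι.symm (𝓝 x₀) (𝓝 (ι.symm x₀)) := ι.symm.continuous.tendsto _
  obtain ⟨w, lam, hw, h⟩ := exists_isothermal_complex
    (G := fun z => (G (ι z)).bilinearComp (ι : ℂ →L[ℝ] _) (ι : ℂ →L[ℝ] _)) (x₀ := ι.symm x₀)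
    (by
      filter_upwards [hιt.eventually hG] with z hz
      have h1 : ContDiffAt ℝ ∞ (fun z => G (ι z)) z := hz.comp z ι.contDiff.contDiffAt
      refine contDiffAt_clm_of_apply fun u => contDiffAt_clm_of_apply fun v => ?_
      simp only [ContinuousLinearMap.bilinearComp_apply]
      exact (h1.clm_apply contDiffAt_const).clm_apply contDiffAt_const)
    (by
      filter_upwards [hιt.eventually hs] with z hz u v
      simp only [ContinuousLinearMap.bilinearComp_apply, hz])
    (by
      filter_upwards [hιt.eventually hp] with z hz v hv
      simp only [ContinuousLinearMap.bilinearComp_apply]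
      exact hz _ (by simpa using hv))
  refine ⟨fun x => ι (w (ι.symm x)), fun x => lam (ι.symm x),
    ι.contDiff.comp (hw.comp ι.symm.contDiff), ?_⟩
  filter_upwards [hιs.eventually h] with x hx
  have hder : fderiv ℝ (fun x => ι (w (ι.symm x))) x =
      (ι : ℂ →L[ℝ] _).comp ((fderiv ℝ w (ι.symm x)).comp (ι.symm : _ →L[ℝ] ℂ)) := by
    refine (ι.hasFDerivAt.comp x
      (((hw.differentiable (by simp)) _).hasFDerivAt.comp x ι.symm.hasFDerivAt)).fderiv
  refine ⟨hx.1, ?_, fun u v => ?_⟩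
  · rw [hder]
    have := LinearMap.det_conj (fderiv ℝ w (ι.symm x) : ℂ →ₗ[ℝ] ℂ) ι.toLinearEquiv
    have h2 := hx.2.1
    rw [ContinuousLinearMap.det, ← this] at h2
    exact h2
  · have h3 := hx.2.2 (ι.symm u) (ι.symm v)
    simp only [ContinuousLinearMap.bilinearComp_apply, ContinuousLinearEquiv.coe_coe,
      ContinuousLinearEquiv.apply_symm_apply] at h3
    rw [h3, hder]
    congr 1
    exact (planeEquiv.inner_map_map _ _).symm

end SurfaceGeometry

end

/-! ### The Levi-Civita connection in coordinates -/

section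

open Filter Topology
set_option maxSynthPendingDepth 3

namespace SurfaceGeometry

theorem two_le_infty : minSmoothness ℝ 2 ≤ ∞ := by
  rw [minSmoothness_of_isRCLikeNormedField]
  norm_cast

section LocalGeometry

variable {E F : Type*} [NormedAddCommGroup E] [NormedSpace ℝ E] [NormedAddCommGroup F]
  [NormedSpace ℝ F]

/-- `H` is a smooth Riemannian metric on the open set `W`. -/
structure IsMetricOn (H : F → F →L[ℝ] F →L[ℝ] ℝ) (W : Set F) : Prop where
  isOpen : IsOpen W
  contDiffAt : ∀ y ∈ W, ContDiffAt ℝ ∞ H y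
  symm : ∀ y ∈ W, ∀ u v, H y u v = H y v u
  pos : ∀ y ∈ W, ∀ v, v ≠ 0 → 0 < H y v v

theorem isInvertible_of_pos [FiniteDimensional ℝ F] {B : F →L[ℝ] F →L[ℝ] ℝ}
    (hp : ∀ v, v ≠ 0 → 0 < B v v) : B.IsInvertible := by
  have hinj : Function.Injective (B : F →ₗ[ℝ] (F →L[ℝ] ℝ)) := by
    refine (injective_iff_map_eq_zero _).2 fun v hv => ?_
    by_contra h0
    have h1 := hp v h0
    have h2 : B v = 0 := hv
    rw [h2] at h1
    simp at h1
  have hrank : Module.finrank ℝ F = Module.finrank ℝ (F →L[ℝ] ℝ) := by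
    rw [← (LinearMap.toContinuousLinearMap (𝕜 := ℝ) (E := F) (F' := ℝ)).finrank_eq]
    exact (Subspace.dual_finrank_eq (K := ℝ) (V := F)).symm
  refine ⟨(LinearEquiv.ofInjectiveOfFinrankEq _ hinj hrank).toContinuousLinearEquiv, ?_⟩
  ext v w
  rfl

theorem apply_inverse_of_pos [FiniteDimensional ℝ F] {B : F →L[ℝ] F →L[ℝ] ℝ}
    (hp : ∀ v, v ≠ 0 → 0 < B v v) (k : F →L[ℝ] ℝ) : B (B.inverse k) = k := by
  obtain ⟨e, rfl⟩ := isInvertible_of_pos hp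
  simp

theorem eq_of_forall_apply_eq {B : F →L[ℝ] F →L[ℝ] ℝ}
    (hp : ∀ v, v ≠ 0 → 0 < B v v) {a b : F} (h : ∀ w, B a w = B b w) : a = b := by
  by_contra hab
  have h1 := hp (a - b) (sub_ne_zero.2 hab)
  have h2 : B (a - b) (a - b) = 0 := by
    rw [map_sub B, sub_apply, h, sub_self]
  exact h1.ne' h2

theorem koszul_apply (H : F → F →L[ℝ] F →L[ℝ] ℝ) (y u v w : F) :
    koszul H y u v w =
      1 / 2 * (fderiv ℝ H y u v w + fderiv ℝ H y v u w - fderiv ℝ H y w u v) := by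
  simp [koszul]

theorem christoffel_add_right (H : F → F →L[ℝ] F →L[ℝ] ℝ) (y u v v' : F) :
    christoffel H y u (v + v') = christoffel H y u v + christoffel H y u v' := by
  rw [christoffel, christoffel, christoffel, ← map_add]
  congr 1
  ext w
  simp [koszul]
  ring

theorem christoffel_smul_right (H : F → F →L[ℝ] F →L[ℝ] ℝ) (y : F) (r : ℝ) (u v : F) :
    christoffel H y u (r • v) = r • christoffel H y u v := by
  rw [christoffel, christoffel, ← map_smul]
  congr 1
  ext w
  simp [koszul]
  ring

/-- The Christoffel symbols at a point, as a bilinear map. -/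
noncomputable def christoffelMap [FiniteDimensional ℝ F] (H : F → F →L[ℝ] F →L[ℝ] ℝ) (y : F) :
    F →L[ℝ] F →L[ℝ] F :=
  (LinearMap.mk₂ ℝ (christoffel H y) (christoffel_add_left H y)
    (christoffel_smul_left H y) (christoffel_add_right H y)
    (christoffel_smul_right H y)).toContinuousBilinearMap

@[simp] theorem christoffelMap_apply [FiniteDimensional ℝ F] (H : F → F →L[ℝ] F →L[ℝ] ℝ)
    (y u v : F) : christoffelMap H y u v = christoffel H y u v := rfl

namespace IsMetricOn

variable {H : F → F →L[ℝ] F →L[ℝ] ℝ} {W : Set F} (hH : IsMetricOn H W) {y : F} (hy : y ∈ W)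
include hH hy

theorem eventually_mem : ∀ᶠ z in 𝓝 y, z ∈ W := hH.isOpen.mem_nhds hy

theorem differentiableAt : DifferentiableAt ℝ H y :=
  (hH.contDiffAt y hy).differentiableAt (by simp)

variable [FiniteDimensional ℝ F]

omit [FiniteDimensional ℝ F] in
theorem fderiv_apply (u v w : F) : fderiv ℝ (fun z => H z v w) y u = fderiv ℝ H y u v w := by
  have h := hH.differentiableAt hy
  have h1 := (h.hasFDerivAt.clm_apply (hasFDerivAt_const v y)).clm_apply (hasFDerivAt_const w y)
  rw [h1.fderiv]
  simp

theorem fderiv_symm (u v w : F) : fderiv ℝ H y u v w = fderiv ℝ H y u w v := by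
  rw [← hH.fderiv_apply hy, ← hH.fderiv_apply hy]
  congr 1
  refine Filter.EventuallyEq.fderiv_eq ?_
  filter_upwards [hH.eventually_mem hy] with z hz using hH.symm z hz v w

theorem apply_christoffel (u v w : F) : H y (christoffel H y u v) w = koszul H y u v w := by
  rw [christoffel, apply_inverse_of_pos (hH.pos y hy)]

theorem christoffel_symm (u v : F) : christoffel H y u v = christoffel H y v u := by
  refine eq_of_forall_apply_eq (hH.pos y hy) fun w => ?_
  rw [hH.apply_christoffel hy, hH.apply_christoffel hy, koszul_apply, koszul_apply,
    hH.fderiv_symm hy w u v]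
  ring

/-- The Levi-Civita connection is compatible with the metric. -/
theorem fderiv_eq_christoffel (u v w : F) :
    fderiv ℝ H y u v w = H y (christoffel H y u v) w + H y v (christoffel H y u w) := by
  rw [hH.symm y hy v, hH.apply_christoffel hy, hH.apply_christoffel hy, koszul_apply, koszul_apply,
    hH.fderiv_symm hy u w v, hH.fderiv_symm hy w u v, hH.fderiv_symm hy v u w,
    hH.fderiv_symm hy w v u]
  ring

theorem contDiffAt_christoffelMap : ContDiffAt ℝ ∞ (christoffelMap H) y := by
  have hd : ContDiffAt ℝ ∞ (fderiv ℝ H) y := (hH.contDiffAt y hy).fderiv_right (by simp)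
  refine contDiffAt_clm_of_apply fun u => contDiffAt_clm_of_apply fun v => ?_
  simp only [christoffelMap_apply, christoffel]
  have hk : ContDiffAt ℝ ∞ (fun z => koszul H z u v) y := by
    refine contDiffAt_clm_of_apply fun w => ?_
    simp only [koszul_apply]
    have h3 : ∀ a b d : F, ContDiffAt ℝ ∞ (fun z => fderiv ℝ H z a b d) y := fun a b d =>
      ((hd.clm_apply contDiffAt_const).clm_apply contDiffAt_const).clm_apply contDiffAt_const
    exact contDiffAt_const.mul (((h3 _ _ _).add (h3 _ _ _)).sub (h3 _ _ _))
  obtain ⟨e, he⟩ := isInvertible_of_pos (hH.pos y hy)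
  have hinv : ContDiffAt ℝ ∞ (fun z => (H z).inverse) y := by
    have h1 := contDiffAt_map_inverse (n := ∞) (𝕜 := ℝ) e
    rw [he] at h1
    exact h1.comp y (hH.contDiffAt y hy)
  exact hinv.clm_apply hk

theorem fderiv_christoffel (a b d : F) : fderiv ℝ (fun z => christoffel H z a b) y d =
    fderiv ℝ (christoffelMap H) y d a b := by
  have hΓ := (hH.contDiffAt_christoffelMap hy).differentiableAt (by simp)
  have h1 := (hΓ.hasFDerivAt.clm_apply (hasFDerivAt_const a _)).clm_apply (hasFDerivAt_const b _)
  refine (congrArg (fun L : F →L[ℝ] F => L d) h1.fderiv).trans ?_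
  simp

end IsMetricOn

/-- The covariant derivative of the vector field `V` along the map `Φ` between (open subsets of)
vector spaces. -/
noncomputable def covDeriv (H : F → F →L[ℝ] F →L[ℝ] ℝ) (Φ : E → F) (V : E → F) (x u : E) : F :=
  fderiv ℝ V x u + christoffel H (Φ x) (fderiv ℝ Φ x u) (V x)

section CovDeriv

variable [FiniteDimensional ℝ F] {H : F → F →L[ℝ] F →L[ℝ] ℝ} {W : Set F} (hH : IsMetricOn H W)
  {Φ : E → F} {x : E} (hx : Φ x ∈ W)
include hH hx

theorem contDiffAt_covDeriv (hΦ : ContDiffAt ℝ ∞ Φ x) {V : E → F} (hV : ContDiffAt ℝ ∞ V x)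
    (u : E) : ContDiffAt ℝ ∞ (fun z => covDeriv H Φ V z u) x := by
  have hdV : ContDiffAt ℝ ∞ (fderiv ℝ V) x := hV.fderiv_right (by simp)
  have hdΦ : ContDiffAt ℝ ∞ (fderiv ℝ Φ) x := hΦ.fderiv_right (by simp)
  have hΓ : ContDiffAt ℝ ∞ (fun z => christoffelMap H (Φ z)) x :=
    (hH.contDiffAt_christoffelMap hx).comp x hΦ
  exact (hdV.clm_apply contDiffAt_const).add
    ((hΓ.clm_apply (hdΦ.clm_apply contDiffAt_const)).clm_apply hV)

/-- Product rule for the covariant derivative. -/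
theorem fderiv_metric_apply (hΦ : DifferentiableAt ℝ Φ x) {V V' : E → F}
    (hV : DifferentiableAt ℝ V x) (hV' : DifferentiableAt ℝ V' x) (u : E) :
    fderiv ℝ (fun z => H (Φ z) (V z) (V' z)) x u =
      H (Φ x) (covDeriv H Φ V x u) (V' x) + H (Φ x) (V x) (covDeriv H Φ V' x u) := by
  have h1 := (hH.differentiableAt hx).hasFDerivAt.comp x hΦ.hasFDerivAt
  have h2 := (h1.clm_apply hV.hasFDerivAt).clm_apply hV'.hasFDerivAt
  refine (congrArg (fun L : E →L[ℝ] ℝ => L u) h2.fderiv).trans ?_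
  simp only [covDeriv, map_add, add_apply, ContinuousLinearMap.flip_apply,
    ContinuousLinearMap.comp_apply, Function.comp_apply]
  rw [hH.fderiv_eq_christoffel hx]
  ring

/-- The curvature measures the failure of covariant derivatives along a map to commute. -/
theorem curvature_eq_covDeriv (hΦ : ContDiffAt ℝ ∞ Φ x) {V : E → F} (hV : ContDiffAt ℝ ∞ V x)
    (u v : E) :
    curvature H (Φ x) (fderiv ℝ Φ x u) (fderiv ℝ Φ x v) (V x) =
      covDeriv H Φ (fun z => covDeriv H Φ V z v) x u -
        covDeriv H Φ (fun z => covDeriv H Φ V z u) x v := by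
  have hdV : DifferentiableAt ℝ (fderiv ℝ V) x :=
    ((hV.fderiv_right (m := ∞) (by simp)).differentiableAt (by simp))
  have hdΦ : DifferentiableAt ℝ (fderiv ℝ Φ) x :=
    ((hΦ.fderiv_right (m := ∞) (by simp)).differentiableAt (by simp))
  have hΓ := (hH.contDiffAt_christoffelMap hx).differentiableAt (by simp)
  have hΓΦ := hΓ.hasFDerivAt.comp x (hΦ.differentiableAt (by simp)).hasFDerivAt
  have hsΦ := (hΦ.isSymmSndFDerivAt two_le_infty).eq u v
  have hsV := (hV.isSymmSndFDerivAt two_le_infty).eq u v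
  have hcov : ∀ a b : E, fderiv ℝ (fun z => covDeriv H Φ V z a) x b =
      fderiv ℝ (fderiv ℝ V) x b a +
        (fderiv ℝ (christoffelMap H) (Φ x) (fderiv ℝ Φ x b) (fderiv ℝ Φ x a) (V x) +
          christoffel H (Φ x) (fderiv ℝ (fderiv ℝ Φ) x b a) (V x) +
          christoffel H (Φ x) (fderiv ℝ Φ x a) (fderiv ℝ V x b)) := by
    intro a b
    have h1 := (hdV.hasFDerivAt.clm_apply (hasFDerivAt_const a x)).add
      ((hΓΦ.clm_apply (hdΦ.hasFDerivAt.clm_apply (hasFDerivAt_const a x))).clm_apply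
        (hV.differentiableAt (by simp)).hasFDerivAt)
    have h2 := congrArg (fun L : E →L[ℝ] F => L b) h1.fderiv
    refine Eq.trans h2 ?_
    simp only [add_apply, ContinuousLinearMap.flip_apply,
      ContinuousLinearMap.comp_apply, Function.comp_apply, ContinuousLinearMap.comp_zero,
      zero_add, christoffelMap_apply]
    abel
  have e1 : ∀ a b : E, covDeriv H Φ (fun z => covDeriv H Φ V z a) x b =
      fderiv ℝ (fun z => covDeriv H Φ V z a) x b +
        christoffel H (Φ x) (fderiv ℝ Φ x b) (covDeriv H Φ V x a) := fun a b => rfl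
  rw [curvature, hH.fderiv_christoffel hx, hH.fderiv_christoffel hx, e1, e1, hcov, hcov, hsΦ, hsV]
  simp only [covDeriv, christoffel_add_right]
  abel

/-- The Levi-Civita connection is torsion-free along a map: `∇_u (dΦ v) = ∇_v (dΦ u)` for constant
`u`, `v`. -/
theorem covDeriv_fderiv_symm (hΦ : ContDiffAt ℝ ∞ Φ x) (a b : E) :
    covDeriv H Φ (fun z => fderiv ℝ Φ z b) x a = covDeriv H Φ (fun z => fderiv ℝ Φ z a) x b := by
  have hdΦ : ContDiffAt ℝ ∞ (fderiv ℝ Φ) x := hΦ.fderiv_right (by simp)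
  have hs := (hΦ.isSymmSndFDerivAt two_le_infty).eq a b
  have h1 : ∀ a b, fderiv ℝ (fun z => fderiv ℝ Φ z b) x a = fderiv ℝ (fderiv ℝ Φ) x a b := by
    intro a b
    have h2 := (hdΦ.differentiableAt (by simp)).hasFDerivAt.clm_apply (hasFDerivAt_const b x)
    have h3 := congrArg (fun L : E →L[ℝ] F => L a) h2.fderiv
    refine Eq.trans h3 ?_
    simp
  rw [covDeriv, covDeriv, h1, h1, hs, hH.christoffel_symm hx]

/-- The tangential part of `∇_u (dΦ v)` is given by the Koszul formula for the induced metric. -/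
theorem apply_covDeriv_fderiv [FiniteDimensional ℝ E] (hΦ : ContDiffAt ℝ ∞ Φ x) (u v w : E) :
    H (Φ x) (covDeriv H Φ (fun z => fderiv ℝ Φ z v) x u) (fderiv ℝ Φ x w) =
      koszul (fun z => (H (Φ z)).bilinearComp (fderiv ℝ Φ z) (fderiv ℝ Φ z)) x u v w := by
  have hdΦ : ContDiffAt ℝ ∞ (fderiv ℝ Φ) x := hΦ.fderiv_right (by simp)
  have hdap : ∀ a, DifferentiableAt ℝ (fun z => fderiv ℝ Φ z a) x := fun a =>
    (hdΦ.clm_apply contDiffAt_const).differentiableAt (by simp)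
  have hG : DifferentiableAt ℝ
      (fun z => (H (Φ z)).bilinearComp (fderiv ℝ Φ z) (fderiv ℝ Φ z)) x := by
    refine ContDiffAt.differentiableAt (n := ∞) ?_ (by simp)
    refine contDiffAt_clm_of_apply fun a => contDiffAt_clm_of_apply fun b => ?_
    simp only [ContinuousLinearMap.bilinearComp_apply]
    exact (((hH.contDiffAt _ hx).comp x hΦ).clm_apply (hdΦ.clm_apply contDiffAt_const)).clm_apply
      (hdΦ.clm_apply contDiffAt_const)
  have hfd : ∀ a b d : E,
      fderiv ℝ (fun z => (H (Φ z)).bilinearComp (fderiv ℝ Φ z) (fderiv ℝ Φ z)) x a b d =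
        H (Φ x) (covDeriv H Φ (fun z => fderiv ℝ Φ z b) x a) (fderiv ℝ Φ x d) +
          H (Φ x) (fderiv ℝ Φ x b) (covDeriv H Φ (fun z => fderiv ℝ Φ z d) x a) := by
    intro a b d
    rw [← fderiv_metric_apply hH hx (hΦ.differentiableAt (by simp)) (hdap b) (hdap d)]
    have h1 := (hG.hasFDerivAt.clm_apply (hasFDerivAt_const b x)).clm_apply (hasFDerivAt_const d x)
    have h2 := congrArg (fun L : E →L[ℝ] ℝ => L a) h1.fderiv
    refine Eq.trans ?_ h2.symm
    simp
  have hsym := covDeriv_fderiv_symm hH hx hΦ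
  rw [koszul_apply, hfd, hfd, hfd, hsym v u, hsym w u, hsym w v,
    hH.symm _ hx (fderiv ℝ Φ x v), hH.symm _ hx (fderiv ℝ Φ x u),
    hH.symm _ hx (covDeriv H Φ (fun z => fderiv ℝ Φ z w) x u)]
  ring

end CovDeriv

end LocalGeometry

end SurfaceGeometry

end

/-! ### Constant curvature, Gauss and Codazzi equations -/

section

open Filter Topology
set_option maxSynthPendingDepth 3

namespace SurfaceGeometry

/-- An algebraic curvature tensor is determined by its sectional curvatures. -/
theorem algebraicCurvature_eq_zero {V : Type*} [AddCommGroup V] {S : V → V → V → V → ℝ}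
    (add₁ : ∀ x x' y z w, S (x + x') y z w = S x y z w + S x' y z w)
    (add₂ : ∀ x y y' z w, S x (y + y') z w = S x y z w + S x y' z w)
    (add₃ : ∀ x y z z' w, S x y (z + z') w = S x y z w + S x y z' w)
    (add₄ : ∀ x y z w w', S x y z (w + w') = S x y z w + S x y z w')
    (skew₁₂ : ∀ x y z w, S y x z w = -S x y z w) (skew₃₄ : ∀ x y z w, S x y w z = -S x y z w)
    (bianchi : ∀ x y z w, S x y z w + S y z x w + S z x y w = 0)
    (diag : ∀ x y, S x y y x = 0) (x y z w : V) : S x y z w = 0 := by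
  -- pair symmetry is a combination of four Bianchi identities
  have pair : ∀ x y z w, S x y z w = S z w x y := by
    intro x y z w
    linarith [bianchi x y z w, bianchi y z w x, bianchi z w x y, bianchi w x y z,
      skew₁₂ x y z w, skew₁₂ y z x w, skew₁₂ z x y w, skew₁₂ y z w x, skew₁₂ z w y x,
      skew₁₂ w y z x, skew₁₂ z w x y, skew₁₂ w x z y, skew₁₂ x z w y, skew₁₂ w x y z,
      skew₁₂ x y w z, skew₁₂ y w x z,
      skew₃₄ x y z w, skew₃₄ y z x w, skew₃₄ z x y w, skew₃₄ z w y x, skew₃₄ w y z x,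
      skew₃₄ w x z y, skew₃₄ z w x y, skew₃₄ x z w y, skew₃₄ y w x z, skew₃₄ x y w z,
      skew₃₄ w x y z, skew₃₄ y z w x, skew₃₄ z x w y, skew₃₄ y w z x, skew₃₄ w y x z,
      skew₃₄ x z y w]
  -- polarize twice: `S` is alternating in all arguments, and the Bianchi identity gives `3 S = 0`
  have h1 : ∀ x y z, S x y z x = 0 := by
    intro x y z
    have h := diag x (y + z)
    rw [add₂, add₃, add₃, diag, diag] at h
    linarith [pair x z y x, skew₁₂ x y x z, skew₃₄ x y z x, skew₃₄ y x z x, skew₁₂ x y z x]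
  have h2 : ∀ x y z w, S x y z w = -S w y z x := by
    intro x y z w
    have h := h1 (x + w) y z
    rw [add₁, add₄, add₄, h1, h1] at h
    linarith
  have h3 : ∀ x y z w, S x y z w = -S x z y w := by
    intro x y z w
    linarith [h2 x y z w, pair w y z x, skew₁₂ x z w y, skew₃₄ z x y w, skew₃₄ x z y w]
  linarith [bianchi x y z w, h3 x y z w, h3 y z x w, h3 z x y w, skew₁₂ x y z w, skew₁₂ y z x w,
    skew₁₂ z x y w, skew₁₂ x z y w]

section Curvature

variable {F : Type*} [NormedAddCommGroup F] [NormedSpace ℝ F]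

theorem curvature_skew (H : F → F →L[ℝ] F →L[ℝ] ℝ) (y u v w : F) :
    curvature H y v u w = -curvature H y u v w := by
  simp only [curvature]
  abel

variable [FiniteDimensional ℝ F]
  {H : F → F →L[ℝ] F →L[ℝ] ℝ} {W : Set F} (hH : IsMetricOn H W) {y : F} (hy : y ∈ W)
include hH hy

theorem curvature_eq_christoffelMap (u v w : F) : curvature H y u v w =
    fderiv ℝ (christoffelMap H) y u v w + christoffelMap H y u (christoffelMap H y v w) -
      (fderiv ℝ (christoffelMap H) y v u w + christoffelMap H y v (christoffelMap H y u w)) := by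
  rw [curvature, hH.fderiv_christoffel hy, hH.fderiv_christoffel hy]
  rfl

/-- The first Bianchi identity. -/
theorem curvature_bianchi (u v w : F) :
    curvature H y u v w + curvature H y v w u + curvature H y w u v = 0 := by
  have hs : ∀ a b d : F, fderiv ℝ (fun z => christoffel H z a b) y d =
      fderiv ℝ (fun z => christoffel H z b a) y d := by
    intro a b d
    congr 1
    refine Filter.EventuallyEq.fderiv_eq ?_
    filter_upwards [hH.eventually_mem hy] with z hz using hH.christoffel_symm hz a b
  simp only [curvature]
  rw [hs w u, hs v u, hs w v, hH.christoffel_symm hy w u, hH.christoffel_symm hy v u,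
    hH.christoffel_symm hy w v]
  abel

/-- The curvature operators are skew-symmetric for the metric. -/
theorem apply_curvature_skew (u v w z : F) :
    H y (curvature H y u v z) w = -H y (curvature H y u v w) z := by
  have hid : ContDiffAt ℝ ∞ (id : F → F) y := contDiffAt_id
  have hc : ∀ w : F, ContDiffAt ℝ ∞ (fun _ : F => w) y := fun w => contDiffAt_const
  have hy' : (id y : F) ∈ W := hy
  -- second derivatives of `H(w, z)`
  have key : ∀ u v : F, fderiv ℝ (fderiv ℝ (fun x => H x w z)) y u v =
      (H y (covDeriv H id (fun x => covDeriv H id (fun _ => w) x v) y u) z +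
        H y (covDeriv H id (fun _ => w) y v) (covDeriv H id (fun _ => z) y u)) +
      (H y (covDeriv H id (fun _ => w) y u) (covDeriv H id (fun _ => z) y v) +
        H y w (covDeriv H id (fun x => covDeriv H id (fun _ => z) x v) y u)) := by
    intro u v
    have hw := (contDiffAt_covDeriv hH hy' hid (hc w) v).differentiableAt (by simp)
    have hz := (contDiffAt_covDeriv hH hy' hid (hc z) v).differentiableAt (by simp)
    have e1 := fderiv_metric_apply hH hy' differentiableAt_id hw
      ((hc z).differentiableAt (by simp)) u
    have e2 := fderiv_metric_apply hH hy' differentiableAt_id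
      ((hc w).differentiableAt (by simp)) hz u
    simp only [id] at e1 e2
    rw [← e1, ← e2]
    have hsm : ContDiffAt ℝ ∞ (fun x => H x w z) y :=
      ((hH.contDiffAt y hy).clm_apply contDiffAt_const).clm_apply contDiffAt_const
    have hd : DifferentiableAt ℝ (fderiv ℝ (fun x => H x w z)) y :=
      (hsm.fderiv_right (m := ∞) (by simp)).differentiableAt (by simp)
    have h1 := hd.hasFDerivAt.clm_apply (hasFDerivAt_const v y)
    have h2 := congrArg (fun L : F →L[ℝ] ℝ => L u) h1.fderiv
    have h3 : fderiv ℝ (fderiv ℝ (fun x => H x w z)) y u v =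
        fderiv ℝ (fun x => fderiv ℝ (fun x => H x w z) x v) y u := by
      refine Eq.trans ?_ h2.symm
      simp
    rw [h3]
    have hA : DifferentiableAt ℝ (fun x => H x (covDeriv H id (fun _ => w) x v) z) y :=
      ((hH.differentiableAt hy).clm_apply hw).clm_apply (differentiableAt_const z)
    have hB : DifferentiableAt ℝ (fun x => H x w (covDeriv H id (fun _ => z) x v)) y :=
      ((hH.differentiableAt hy).clm_apply (differentiableAt_const w)).clm_apply hz
    have h4 := congrArg (fun L : F →L[ℝ] ℝ => L u) (fderiv_add hA hB)
    refine Eq.trans ?_ h4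
    congr 1
    refine Filter.EventuallyEq.fderiv_eq ?_
    filter_upwards [hH.eventually_mem hy] with x hx
    have hx' : (id x : F) ∈ W := hx
    have e3 := fderiv_metric_apply hH hx' differentiableAt_id (differentiableAt_const w)
      (differentiableAt_const z) v
    exact e3
  have hsm : ContDiffAt ℝ ∞ (fun x => H x w z) y :=
    ((hH.contDiffAt y hy).clm_apply contDiffAt_const).clm_apply contDiffAt_const
  have hsym := (hsm.isSymmSndFDerivAt two_le_infty).eq u v
  rw [key, key] at hsym
  have hR : ∀ w : F, curvature H y u v w = covDeriv H id (fun x => covDeriv H id (fun _ => w) x v) y u -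
      covDeriv H id (fun x => covDeriv H id (fun _ => w) x u) y v := by
    intro w
    have := curvature_eq_covDeriv hH hy' hid (hc w) u v
    simpa using this
  rw [hR, hR, hH.symm y hy _ w]
  simp only [map_sub, sub_apply]
  linarith

/-- If all sectional curvatures at `y` are equal to `c`, then the curvature tensor at `y` is
`R(u, v)w = c (⟨v, w⟩ u - ⟨u, w⟩ v)`. -/
theorem apply_curvature_of_constant {c : ℝ} (hc : ∀ u v : F, LinearIndependent ℝ ![u, v] →
    localSectionalCurvature H y u v = c) (u v w z : F) :
    H y (curvature H y u v w) z = c * (H y v w * H y u z - H y u w * H y v z) := by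
  have hs := hH.symm y hy
  have hp := hH.pos y hy
  have hcurv := curvature_eq_christoffelMap hH hy
  rw [← sub_eq_zero]
  refine algebraicCurvature_eq_zero (S := fun u v w z => H y (curvature H y u v w) z -
    c * (H y v w * H y u z - H y u w * H y v z)) ?_ ?_ ?_ ?_ ?_ ?_ ?_ ?_ u v w z
  · intro x x' y z w
    simp only [hcurv, map_add, add_apply, map_sub, sub_apply]
    ring
  · intro x y y' z w
    simp only [hcurv, map_add, add_apply, map_sub, sub_apply]
    ring
  · intro x y z z' w
    simp only [hcurv, map_add, add_apply, map_sub, sub_apply]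
    ring
  · intro x y z w w'
    simp only [map_add]
    ring
  · intro x y z w
    simp only [curvature_skew H _ x y, map_neg, neg_apply]
    ring
  · intro x y' z w
    rw [apply_curvature_skew hH hy]
    ring
  · intro x y' z w
    have h1 := congrArg (fun a => H y a w) (curvature_bianchi hH hy x y' z)
    simp only [map_add, add_apply, map_zero, zero_apply] at h1
    rw [hs z x, hs z y', hs y' x]
    linear_combination h1
  · intro u v
    by_cases hli : LinearIndependent ℝ ![u, v]
    · have h1 := hc u v hli
      have h2 := (gram_pos hs hp hli).ne'
      rw [localSectionalCurvature, div_eq_iff h2] at h1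
      rw [h1, hs v u]
      ring
    · by_cases hu : u = 0
      · subst hu
        simp
      · rw [LinearIndependent.pair_iff' hu] at hli
        push Not at hli
        obtain ⟨a, rfl⟩ := hli
        have h0 : ∀ w, curvature H y u u w = 0 := by
          intro w
          have := curvature_skew H y u u w
          rw [← add_eq_zero_iff_eq_neg, ← two_smul ℝ] at this
          exact (smul_eq_zero.1 this).resolve_left two_ne_zero
        have h1 : curvature H y u (a • u) (a • u) = (a * a) • curvature H y u u u := by
          simp only [hcurv, map_smul, smul_apply]
          module
        rw [h1, h0]
        simp only [map_smul, smul_apply, smul_zero, map_zero, zero_apply, smul_eq_mul]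
        ring

end Curvature

section Hypersurface

variable {E F : Type*} [NormedAddCommGroup E] [NormedSpace ℝ E] [FiniteDimensional ℝ E]
  [NormedAddCommGroup F] [NormedSpace ℝ F] [FiniteDimensional ℝ F]

/-- The metric induced by a map between (open subsets of) vector spaces. -/
noncomputable def pullbackMetric (H : F → F →L[ℝ] F →L[ℝ] ℝ) (Φ : E → F) (x : E) :
    E →L[ℝ] E →L[ℝ] ℝ :=
  (H (Φ x)).bilinearComp (fderiv ℝ Φ x) (fderiv ℝ Φ x)

omit [FiniteDimensional ℝ E] [FiniteDimensional ℝ F] in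
@[simp] theorem pullbackMetric_apply (H : F → F →L[ℝ] F →L[ℝ] ℝ) (Φ : E → F) (x u v : E) :
    pullbackMetric H Φ x u v = H (Φ x) (fderiv ℝ Φ x u) (fderiv ℝ Φ x v) := rfl

/-- The second fundamental form `-⟨∇_u n, dΦ(v)⟩` of a map between vector spaces. -/
noncomputable def localSecondForm (H : F → F →L[ℝ] F →L[ℝ] ℝ) (Φ n : E → F) (x u v : E) : ℝ :=
  -H (Φ x) (covDeriv H Φ n x u) (fderiv ℝ Φ x v)

/-- `Φ` is a smooth immersed hypersurface on `U`, with smooth unit normal field `n`, for the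
metric `H`. -/
structure IsHypersurfaceOn (H : F → F →L[ℝ] F →L[ℝ] ℝ) (W : Set F) (Φ n : E → F) (U : Set E) :
    Prop where
  metric : IsMetricOn H W
  isOpen : IsOpen U
  mapsTo : ∀ x ∈ U, Φ x ∈ W
  contDiffAt : ∀ x ∈ U, ContDiffAt ℝ ∞ Φ x
  contDiffAt_normal : ∀ x ∈ U, ContDiffAt ℝ ∞ n x
  injective : ∀ x ∈ U, Function.Injective (fderiv ℝ Φ x)
  unit : ∀ x ∈ U, H (Φ x) (n x) (n x) = 1
  normal : ∀ x ∈ U, ∀ u, H (Φ x) (n x) (fderiv ℝ Φ x u) = 0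
  finrank_eq : Module.finrank ℝ F = Module.finrank ℝ E + 1

omit [FiniteDimensional ℝ F] in
theorem contDiffAt_pullbackMetric {H : F → F →L[ℝ] F →L[ℝ] ℝ} {Φ : E → F} {x : E}
    (hH : ContDiffAt ℝ ∞ H (Φ x)) (hΦ : ContDiffAt ℝ ∞ Φ x) :
    ContDiffAt ℝ ∞ (pullbackMetric H Φ) x := by
  have hdΦ : ContDiffAt ℝ ∞ (fderiv ℝ Φ) x := hΦ.fderiv_right (by simp)
  refine contDiffAt_clm_of_apply fun a => contDiffAt_clm_of_apply fun b => ?_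
  simp only [pullbackMetric_apply]
  exact ((hH.comp x hΦ).clm_apply (hdΦ.clm_apply contDiffAt_const)).clm_apply
    (hdΦ.clm_apply contDiffAt_const)

namespace IsHypersurfaceOn

variable {H : F → F →L[ℝ] F →L[ℝ] ℝ} {W : Set F} {Φ n : E → F} {U : Set E}
  (hS : IsHypersurfaceOn H W Φ n U)
include hS

omit [FiniteDimensional ℝ F] in
theorem isMetricOn_pullback : IsMetricOn (pullbackMetric H Φ) U where
  isOpen := hS.isOpen
  contDiffAt x hx := contDiffAt_pullbackMetric (hS.metric.contDiffAt _ (hS.mapsTo x hx))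
    (hS.contDiffAt x hx)
  symm x hx _ _ := hS.metric.symm _ (hS.mapsTo x hx) _ _
  pos x hx _ hv := hS.metric.pos _ (hS.mapsTo x hx) _
    ((map_ne_zero_iff _ (hS.injective x hx)).2 hv)

variable {x : E} (hx : x ∈ U)
include hx

omit [FiniteDimensional ℝ E] [FiniteDimensional ℝ F] in
theorem eventually_mem : ∀ᶠ z in 𝓝 x, z ∈ U := hS.isOpen.mem_nhds hx

omit [FiniteDimensional ℝ E] [FiniteDimensional ℝ F] in
theorem contDiffAt_fderiv_apply (v : E) : ContDiffAt ℝ ∞ (fun z => fderiv ℝ Φ z v) x :=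
  ((hS.contDiffAt x hx).fderiv_right (m := ∞) (by simp)).clm_apply contDiffAt_const

omit [FiniteDimensional ℝ E] in
theorem contDiffAt_localSecondForm (u v : E) :
    ContDiffAt ℝ ∞ (fun z => localSecondForm H Φ n z u v) x :=
  (((hS.metric.contDiffAt _ (hS.mapsTo x hx)).comp x (hS.contDiffAt x hx)).clm_apply
    (contDiffAt_covDeriv hS.metric (hS.mapsTo x hx) (hS.contDiffAt x hx)
      (hS.contDiffAt_normal x hx) u)).clm_apply (hS.contDiffAt_fderiv_apply hx v) |>.neg

omit [FiniteDimensional ℝ E] in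
/-- The second fundamental form is the normal component of `∇_u (dΦ v)`. -/
theorem apply_covDeriv_normal (u v : E) :
    H (Φ x) (covDeriv H Φ (fun z => fderiv ℝ Φ z v) x u) (n x) = localSecondForm H Φ n x u v := by
  have hW := hS.mapsTo x hx
  have h0 : fderiv ℝ (fun z => H (Φ z) (n z) (fderiv ℝ Φ z v)) x u = 0 := by
    have : (fun z => H (Φ z) (n z) (fderiv ℝ Φ z v)) =ᶠ[𝓝 x] fun _ => 0 := by
      filter_upwards [hS.eventually_mem hx] with z hz using hS.normal z hz v
    rw [this.fderiv_eq]
    simp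
  rw [fderiv_metric_apply hS.metric hW ((hS.contDiffAt x hx).differentiableAt (by simp))
    ((hS.contDiffAt_normal x hx).differentiableAt (by simp))
    ((hS.contDiffAt_fderiv_apply hx v).differentiableAt (by simp))] at h0
  rw [localSecondForm, hS.metric.symm _ hW _ (n x)]
  linarith

theorem localSecondForm_symm (u v : E) :
    localSecondForm H Φ n x u v = localSecondForm H Φ n x v u := by
  rw [← hS.apply_covDeriv_normal hx, ← hS.apply_covDeriv_normal hx,
    covDeriv_fderiv_symm hS.metric (hS.mapsTo x hx) (hS.contDiffAt x hx)]

omit [FiniteDimensional ℝ E] in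
/-- `∇_u n` is tangential, because `n` has constant length. -/
theorem apply_covDeriv_normal_self (u : E) : H (Φ x) (covDeriv H Φ n x u) (n x) = 0 := by
  have hW := hS.mapsTo x hx
  have h0 : fderiv ℝ (fun z => H (Φ z) (n z) (n z)) x u = 0 := by
    have : (fun z => H (Φ z) (n z) (n z)) =ᶠ[𝓝 x] fun _ => 1 := by
      filter_upwards [hS.eventually_mem hx] with z hz using hS.unit z hz
    rw [this.fderiv_eq]
    simp
  have hn := (hS.contDiffAt_normal x hx).differentiableAt (n := ∞) (by simp)
  rw [fderiv_metric_apply hS.metric hW ((hS.contDiffAt x hx).differentiableAt (by simp)) hn hn,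
    hS.metric.symm _ hW (n x)] at h0
  linarith

theorem exists_eq_tangent_add_normal (a : F) : ∃ (v : E) (t : ℝ), a = fderiv ℝ Φ x v + t • n x := by
  have hW := hS.mapsTo x hx
  let L : (E × ℝ) →ₗ[ℝ] F := (fderiv ℝ Φ x : E →ₗ[ℝ] F).coprod (LinearMap.toSpanSingleton ℝ F (n x))
  have hL : ∀ p : E × ℝ, L p = fderiv ℝ Φ x p.1 + p.2 • n x := fun p => by
    simp [L, LinearMap.toSpanSingleton_apply]
  have hinj : Function.Injective L := by
    refine (injective_iff_map_eq_zero _).2 fun p hp => ?_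
    rw [hL] at hp
    have h2 : p.2 = 0 := by
      have := congrArg (H (Φ x) (n x)) hp
      simpa [hS.normal x hx, hS.unit x hx] using this
    have h1 : fderiv ℝ Φ x p.1 = 0 := by simpa [h2] using hp
    exact Prod.ext ((map_eq_zero_iff _ (hS.injective x hx)).1 h1) h2
  have hrank : Module.finrank ℝ (E × ℝ) = Module.finrank ℝ F := by
    rw [Module.finrank_prod, Module.finrank_self, hS.finrank_eq]
  obtain ⟨p, hp⟩ := (LinearMap.injective_iff_surjective_of_finrank_eq_finrank hrank).1 hinj a
  exact ⟨p.1, p.2, by rw [← hp, hL]⟩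

/-- The formula of Gauss: `∇_u (dΦ v)` is the sum of the derivative for the induced metric and of
the second fundamental form. -/
theorem covDeriv_fderiv_eq (u v : E) :
    covDeriv H Φ (fun z => fderiv ℝ Φ z v) x u =
      fderiv ℝ Φ x (christoffel (pullbackMetric H Φ) x u v) +
        localSecondForm H Φ n x u v • n x := by
  have hW := hS.mapsTo x hx
  refine eq_of_forall_apply_eq (hS.metric.pos _ hW) fun a => ?_
  obtain ⟨w, t, rfl⟩ := hS.exists_eq_tangent_add_normal hx a
  have h1 := apply_covDeriv_fderiv hS.metric hW (hS.contDiffAt x hx) u v w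
  have h2 := hS.isMetricOn_pullback.apply_christoffel hx u v w
  rw [pullbackMetric_apply] at h2
  simp only [map_add, map_smul, add_apply, smul_apply, smul_eq_mul]
  rw [hS.apply_covDeriv_normal hx, h1, h2, hS.normal x hx, hS.unit x hx,
    hS.metric.symm _ hW _ (n x), hS.normal x hx]
  change koszul (pullbackMetric H Φ) x u v w + _ = _
  ring

variable {c : ℝ} (hc : ∀ u v : F, LinearIndependent ℝ ![u, v] →
    localSectionalCurvature H (Φ x) u v = c)
include hc

/-- The Codazzi equation in a space of constant curvature. -/
theorem codazzi (u v w : E) :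
    fderiv ℝ (fun z => localSecondForm H Φ n z v w) x u +
        localSecondForm H Φ n x u (christoffel (pullbackMetric H Φ) x v w) =
      fderiv ℝ (fun z => localSecondForm H Φ n z u w) x v +
        localSecondForm H Φ n x v (christoffel (pullbackMetric H Φ) x u w) := by
  have hW := hS.mapsTo x hx
  have hΦ := hS.contDiffAt x hx
  have hw := hS.contDiffAt_fderiv_apply hx w
  -- each side is the normal component of a second covariant derivative of `dΦ w`; their difference is
  -- a curvature term, whose normal component vanishes for constant curvature
  have key : ∀ u v : E, fderiv ℝ (fun z => localSecondForm H Φ n z v w) x u +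
      localSecondForm H Φ n x u (christoffel (pullbackMetric H Φ) x v w) =
      H (Φ x) (covDeriv H Φ (fun z => covDeriv H Φ (fun z => fderiv ℝ Φ z w) z v) x u) (n x) := by
    intro u v
    have h1 : fderiv ℝ (fun z => localSecondForm H Φ n z v w) x u = fderiv ℝ
        (fun z => H (Φ z) (covDeriv H Φ (fun z => fderiv ℝ Φ z w) z v) (n z)) x u := by
      congr 1
      refine Filter.EventuallyEq.fderiv_eq ?_
      filter_upwards [hS.eventually_mem hx] with z hz
      exact (hS.apply_covDeriv_normal hz v w).symm
    rw [h1, fderiv_metric_apply hS.metric hW (hΦ.differentiableAt (by simp))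
      ((contDiffAt_covDeriv hS.metric hW hΦ hw v).differentiableAt (by simp))
      ((hS.contDiffAt_normal x hx).differentiableAt (by simp))]
    have h2 : H (Φ x) (covDeriv H Φ (fun z => fderiv ℝ Φ z w) x v) (covDeriv H Φ n x u) =
        -localSecondForm H Φ n x u (christoffel (pullbackMetric H Φ) x v w) := by
      rw [hS.metric.symm _ hW, hS.covDeriv_fderiv_eq hx, map_add, map_smul,
        hS.apply_covDeriv_normal_self hx]
      simp [localSecondForm]
    rw [h2]
    ring
  rw [key, key, ← sub_eq_zero, ← sub_apply, ← map_sub,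
    ← curvature_eq_covDeriv hS.metric hW hΦ hw u v,
    apply_curvature_of_constant hS.metric hW hc, hS.metric.symm _ hW _ (n x),
    hS.metric.symm _ hW _ (n x), hS.normal x hx, hS.normal x hx]
  ring

/-- The Gauss equation in a space of constant curvature. -/
theorem gauss (u v : E) :
    pullbackMetric H Φ x (curvature (pullbackMetric H Φ) x u v v) u =
      c * (pullbackMetric H Φ x u u * pullbackMetric H Φ x v v - pullbackMetric H Φ x u v ^ 2) +
        (localSecondForm H Φ n x u u * localSecondForm H Φ n x v v -
          localSecondForm H Φ n x u v ^ 2) := by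
  have hW := hS.mapsTo x hx
  have hΦ := hS.contDiffAt x hx
  have hG := hS.isMetricOn_pullback
  set G := pullbackMetric H Φ with hGdef
  have hx' : (id x : E) ∈ U := hx
  have hid : ContDiffAt ℝ ∞ (id : E → E) x := contDiffAt_id
  -- extrinsic second covariant derivatives
  have ext : ∀ u v w z : E,
      H (Φ x) (covDeriv H Φ (fun z => covDeriv H Φ (fun z => fderiv ℝ Φ z w) z v) x u)
        (fderiv ℝ Φ x z) = fderiv ℝ (fun y => koszul G y v w z) x u -
          (G x (christoffel G x v w) (christoffel G x u z) +
            localSecondForm H Φ n x v w * localSecondForm H Φ n x u z) := by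
    intro u v w z
    have hw := hS.contDiffAt_fderiv_apply hx w
    have h1 : fderiv ℝ (fun y => koszul G y v w z) x u = fderiv ℝ
        (fun y => H (Φ y) (covDeriv H Φ (fun z => fderiv ℝ Φ z w) y v) (fderiv ℝ Φ y z)) x u := by
      congr 1
      refine Filter.EventuallyEq.fderiv_eq ?_
      filter_upwards [hS.eventually_mem hx] with y hy
      exact (apply_covDeriv_fderiv hS.metric (hS.mapsTo y hy) (hS.contDiffAt y hy) v w z).symm
    rw [h1, fderiv_metric_apply hS.metric hW (hΦ.differentiableAt (by simp))
      ((contDiffAt_covDeriv hS.metric hW hΦ hw v).differentiableAt (by simp))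
      ((hS.contDiffAt_fderiv_apply hx z).differentiableAt (by simp))]
    have h2 : H (Φ x) (covDeriv H Φ (fun z => fderiv ℝ Φ z w) x v)
        (covDeriv H Φ (fun y => fderiv ℝ Φ y z) x u) =
        G x (christoffel G x v w) (christoffel G x u z) +
            localSecondForm H Φ n x v w * localSecondForm H Φ n x u z := by
      rw [hS.covDeriv_fderiv_eq hx, hS.covDeriv_fderiv_eq hx]
      simp only [map_add, map_smul, add_apply, smul_apply, smul_eq_mul]
      rw [hS.metric.symm _ hW _ (n x), hS.normal x hx, hS.normal x hx, hS.unit x hx]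
      simp only [hGdef, pullbackMetric_apply]
      ring
    rw [h2]
    ring
  -- intrinsic second covariant derivatives
  have int : ∀ u v w z : E,
      G x (covDeriv G id (fun y => covDeriv G id (fun _ => w) y v) x u) z =
        fderiv ℝ (fun y => koszul G y v w z) x u -
          G x (christoffel G x v w) (christoffel G x u z) := by
    intro u v w z
    have hcv : ∀ (y v w : E), covDeriv G id (fun _ => w) y v = christoffel G y v w := by
      intro y v w
      simp [covDeriv]
    have h1 : fderiv ℝ (fun y => koszul G y v w z) x u = fderiv ℝ
        (fun y => G (id y) (covDeriv G id (fun _ => w) y v) z) x u := by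
      congr 1
      refine Filter.EventuallyEq.fderiv_eq ?_
      filter_upwards [hS.eventually_mem hx] with y hy
      rw [hcv]
      exact (hG.apply_christoffel hy v w z).symm
    rw [h1, fderiv_metric_apply hG hx' differentiableAt_id
      ((contDiffAt_covDeriv hG hx' hid contDiffAt_const v).differentiableAt (by simp))
      (differentiableAt_const z), hcv, hcv]
    simp
  have hR : curvature G x u v v = covDeriv G id (fun y => covDeriv G id (fun _ => v) y v) x u -
      covDeriv G id (fun y => covDeriv G id (fun _ => v) y u) x v := by
    have := curvature_eq_covDeriv hG hx' hid (V := fun _ => v) contDiffAt_const u v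
    simpa using this
  have hRH := curvature_eq_covDeriv hS.metric hW hΦ (hS.contDiffAt_fderiv_apply hx v) u v
  have hcH := apply_curvature_of_constant hS.metric hW hc (fderiv ℝ Φ x u) (fderiv ℝ Φ x v)
    (fderiv ℝ Φ x v) (fderiv ℝ Φ x u)
  rw [hRH, map_sub, sub_apply, ext, ext] at hcH
  rw [hR, map_sub, sub_apply, int, int]
  simp only [hGdef, pullbackMetric_apply] at hcH ⊢
  rw [hS.localSecondForm_symm hx v u, hS.metric.symm _ hW (fderiv ℝ Φ x v) (fderiv ℝ Φ x u)] at hcH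
  linear_combination hcH

end IsHypersurfaceOn

omit [FiniteDimensional ℝ E] in
/-- The pairing of a covariant derivative with a vector does not depend on the coordinates of the
target. -/
theorem apply_covDeriv_comp {H H' : F → F →L[ℝ] F →L[ℝ] ℝ} {W W' : Set F} (hH : IsMetricOn H W)
    (hH' : IsMetricOn H' W') {τ : F → F} {Φ V V' : E → F} {x : E} (hx : Φ x ∈ W)
    (hx' : τ (Φ x) ∈ W') (hτ : ContDiffAt ℝ ∞ τ (Φ x)) (hHτ : H =ᶠ[𝓝 (Φ x)] pullbackMetric H' τ)
    (hΦ : DifferentiableAt ℝ Φ x) (hV : DifferentiableAt ℝ V x)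
    (hV' : V' =ᶠ[𝓝 x] fun z => fderiv ℝ τ (Φ z) (V z)) (u : E) (w : F) :
    H' (τ (Φ x)) (covDeriv H' (fun z => τ (Φ z)) V' x u) (fderiv ℝ τ (Φ x) w) =
      H (Φ x) (covDeriv H Φ V x u) w := by
  have hdτ : DifferentiableAt ℝ (fderiv ℝ τ) (Φ x) :=
    (hτ.fderiv_right (m := ∞) (by simp)).differentiableAt (by simp)
  have h1 : fderiv ℝ (fun z => τ (Φ z)) x u = fderiv ℝ τ (Φ x) (fderiv ℝ Φ x u) := by
    have := (hτ.differentiableAt (by simp)).hasFDerivAt.comp x hΦ.hasFDerivAt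
    exact congrArg (fun L : E →L[ℝ] F => L u) this.fderiv
  have h2 : fderiv ℝ V' x u = fderiv ℝ (fderiv ℝ τ) (Φ x) (fderiv ℝ Φ x u) (V x) +
      fderiv ℝ τ (Φ x) (fderiv ℝ V x u) := by
    rw [hV'.fderiv_eq]
    have := (hdτ.hasFDerivAt.comp x hΦ.hasFDerivAt).clm_apply hV.hasFDerivAt
    refine (congrArg (fun L : E →L[ℝ] F => L u) this.fderiv).trans ?_
    simp [add_comm]
  have h3 : ∀ a b : F, fderiv ℝ (fun y => fderiv ℝ τ y b) (Φ x) a =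
      fderiv ℝ (fderiv ℝ τ) (Φ x) a b := by
    intro a b
    have := hdτ.hasFDerivAt.clm_apply (hasFDerivAt_const b (Φ x))
    refine (congrArg (fun L : F →L[ℝ] F => L a) this.fderiv).trans ?_
    simp
  have h4 := apply_covDeriv_fderiv hH' hx' hτ (fderiv ℝ Φ x u) (V x) w
  have h5 : koszul (fun z => (H' (τ z)).bilinearComp (fderiv ℝ τ z) (fderiv ℝ τ z)) (Φ x)
      (fderiv ℝ Φ x u) (V x) w = koszul H (Φ x) (fderiv ℝ Φ x u) (V x) w := by
    rw [koszul_apply, koszul_apply, hHτ.fderiv_eq]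
    rfl
  have h6 : H (Φ x) (fderiv ℝ V x u) w =
      H' (τ (Φ x)) (fderiv ℝ τ (Φ x) (fderiv ℝ V x u)) (fderiv ℝ τ (Φ x) w) := by
    rw [hHτ.self_of_nhds]
    rfl
  rw [h5, ← hH.apply_christoffel hx, covDeriv, h3] at h4
  simp only [covDeriv]
  rw [h1, h2, hV'.self_of_nhds]
  simp only [map_add, add_apply] at h4 ⊢
  rw [h6]
  linarith

end Hypersurface

end SurfaceGeometry

end

/-! ### Metrics and second fundamental forms in a parametrization -/

section

open Filter Topology Bundle
set_option maxSynthPendingDepth 3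

namespace SurfaceGeometry

section Parametrization

variable {X : Type*} [NormedAddCommGroup X] [NormedSpace ℝ X]
  {E : Type*} [NormedAddCommGroup E] [NormedSpace ℝ E]
  {F : Type*} [NormedAddCommGroup F] [NormedSpace ℝ F]
  {M : Type*} [TopologicalSpace M] [ChartedSpace E M]
  {N : Type*} [TopologicalSpace N] [ChartedSpace F N]

/-- The metric `g` on `M` in the coordinates given by a parametrization `s : X → M`. -/
noncomputable def paramMetric
    (g : ∀ q : M, TangentSpace 𝓘(ℝ, E) q →L[ℝ] TangentSpace 𝓘(ℝ, E) q →L[ℝ] ℝ)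
    (s : X → M) (x : X) : X →L[ℝ] X →L[ℝ] ℝ :=
  ContinuousLinearMap.bilinearComp (E := E) (F := E) (G := ℝ) (E' := X) (F' := X)
    (g (s x)) (mfderiv 𝓘(ℝ, X) 𝓘(ℝ, E) s x) (mfderiv 𝓘(ℝ, X) 𝓘(ℝ, E) s x)

theorem paramMetric_apply
    (g : ∀ q : M, TangentSpace 𝓘(ℝ, E) q →L[ℝ] TangentSpace 𝓘(ℝ, E) q →L[ℝ] ℝ)
    (s : X → M) (x u v : X) :
    paramMetric g s x u v = g (s x) (mfderiv 𝓘(ℝ, X) 𝓘(ℝ, E) s x u)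
      (mfderiv 𝓘(ℝ, X) 𝓘(ℝ, E) s x v) := rfl

theorem metricInChart_eq_paramMetric
    (g : ∀ q : M, TangentSpace 𝓘(ℝ, E) q →L[ℝ] TangentSpace 𝓘(ℝ, E) q →L[ℝ] ℝ) (p : M) :
    metricInChart g p = paramMetric g (chartAt E p).symm := rfl

theorem mdifferentiable_of_mem_maximalAtlas [IsManifold 𝓘(ℝ, E) ∞ M]
    {e : OpenPartialHomeomorph M E} (he : e ∈ IsManifold.maximalAtlas 𝓘(ℝ, E) ∞ M) :
    e.MDifferentiable 𝓘(ℝ, E) 𝓘(ℝ, E) :=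
  ⟨(contMDiffOn_of_mem_maximalAtlas he).mdifferentiableOn (by simp),
    (contMDiffOn_symm_of_mem_maximalAtlas he).mdifferentiableOn (by simp)⟩

theorem contMDiffAt_mfderiv_apply [IsManifold 𝓘(ℝ, E) ∞ M] {s : X → M} {U : Set X} (hU : IsOpen U)
    (hs : ContMDiffOn 𝓘(ℝ, X) 𝓘(ℝ, E) ∞ s U) {x : X} (hx : x ∈ U) (a : X) :
    ContMDiffAt 𝓘(ℝ, X) (𝓘(ℝ, E).tangent) ∞
      (fun y => (⟨s y, mfderiv 𝓘(ℝ, X) 𝓘(ℝ, E) s y a⟩ : TangentBundle 𝓘(ℝ, E) M)) x := by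
  have h1 := hs.contMDiffOn_tangentMapWithin (m := ∞) (by simp) hU.uniqueMDiffOn
  have h2 : ContMDiff 𝓘(ℝ, X) (𝓘(ℝ, X).tangent) ∞
      (fun y => (⟨y, a⟩ : TangentBundle 𝓘(ℝ, X) X)) := by
    exact contMDiff_vectorSpace_iff_contDiff.2 contDiff_const
  have h3 := h1.comp (s := U) h2.contMDiffOn (fun y hy => hy)
  refine (h3.contMDiffAt (hU.mem_nhds hx)).congr_of_eventuallyEq ?_
  filter_upwards [hU.mem_nhds hx] with y hy
  simp only [Function.comp, tangentMapWithin, mfderivWithin_of_isOpen hU hy]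

theorem contDiffAt_paramMetric [FiniteDimensional ℝ X] [IsManifold 𝓘(ℝ, E) ∞ M]
    (h : ContMDiffRiemannianMetric 𝓘(ℝ, E) ∞ E (fun y : M => TangentSpace 𝓘(ℝ, E) y))
    {s : X → M} {U : Set X} (hU : IsOpen U) (hs : ContMDiffOn 𝓘(ℝ, X) 𝓘(ℝ, E) ∞ s U)
    {x : X} (hx : x ∈ U) : ContDiffAt ℝ ∞ (paramMetric h.inner s) x := by
  refine contDiffAt_clm_of_apply fun a => contDiffAt_clm_of_apply fun b => ?_
  rw [← contMDiffAt_iff_contDiffAt]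
  have hsx := hs.contMDiffAt (hU.mem_nhds hx)
  have : ContMDiffAt 𝓘(ℝ, X) (𝓘(ℝ, E).prod 𝓘(ℝ)) ∞
      (fun m ↦ TotalSpace.mk' ℝ (E := Bundle.Trivial M ℝ) (s m) (h.inner (s m)
        (mfderiv 𝓘(ℝ, X) 𝓘(ℝ, E) s m a) (mfderiv 𝓘(ℝ, X) 𝓘(ℝ, E) s m b))) x := by
    apply ContMDiffAt.clm_bundle_apply₂ (F₁ := E) (F₂ := E)
    · exact ContMDiffAt.comp x h.contMDiff.contMDiffAt hsx
    · exact contMDiffAt_mfderiv_apply hU hs hx a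
    · exact contMDiffAt_mfderiv_apply hU hs hx b
  simp only [contMDiffAt_totalSpace] at this
  exact this.2

/-- A metric in the coordinates of a chart, evaluated on vectors pushed forward by the chart. -/
theorem paramMetric_symm_apply [IsManifold 𝓘(ℝ, E) ∞ M]
    (g : ∀ q : M, TangentSpace 𝓘(ℝ, E) q →L[ℝ] TangentSpace 𝓘(ℝ, E) q →L[ℝ] ℝ)
    {e : OpenPartialHomeomorph M E} (he : e ∈ IsManifold.maximalAtlas 𝓘(ℝ, E) ∞ M)
    {q : M} (hq : q ∈ e.source) (a b : TangentSpace 𝓘(ℝ, E) q) :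
    paramMetric g e.symm (e q) (differential e q a) (differential e q b) = g q a b := by
  have h1 := (mdifferentiable_of_mem_maximalAtlas he).symm_comp_deriv hq
  have h2 : ∀ a : TangentSpace 𝓘(ℝ, E) q,
      mfderiv 𝓘(ℝ, E) 𝓘(ℝ, E) e.symm (e q) (differential e q a) = a :=
    fun a => congrArg (fun L : E →L[ℝ] E => L a) h1
  rw [paramMetric_apply]
  have h3 : ∀ q' : M, q' = q → ∀ a b : E, g q' a b = g q a b := by
    rintro _ rfl _ _
    rfl
  refine (h3 _ (e.left_inv hq) _ _).trans ?_
  erw [h2, h2]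

/-- A smooth vector field along `φ`, read in a chart of the target, is smooth. -/
theorem contMDiffAt_differential_apply [IsManifold 𝓘(ℝ, E) ∞ M] [IsManifold 𝓘(ℝ, F) ∞ N] {φ : M → N}
    {V : ∀ q : M, TangentSpace 𝓘(ℝ, F) (φ q)}
    (hV : ContMDiff 𝓘(ℝ, E) (𝓘(ℝ, F).tangent) ∞
      (fun q => (⟨φ q, V q⟩ : TangentBundle 𝓘(ℝ, F) N)))
    {ψ : OpenPartialHomeomorph N F} (hψ : ψ ∈ IsManifold.maximalAtlas 𝓘(ℝ, F) ∞ N)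
    {q : M} (hφ : ContinuousAt φ q) (hq : φ q ∈ ψ.source) :
    ContMDiffAt 𝓘(ℝ, E) 𝓘(ℝ, F) ∞ (fun q => differential ψ (φ q) (V q)) q := by
  have h1 := (contMDiffOn_of_mem_maximalAtlas hψ).contMDiffOn_tangentMapWithin (m := ∞) (by simp)
    ψ.open_source.uniqueMDiffOn
  have h2 : ContMDiffAt (𝓘(ℝ, F).tangent) (𝓘(ℝ, F).tangent) ∞
      (tangentMapWithin 𝓘(ℝ, F) 𝓘(ℝ, F) ψ ψ.source) (⟨φ q, V q⟩ : TangentBundle 𝓘(ℝ, F) N) :=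
    h1.contMDiffAt ((ψ.open_source.preimage
      (FiberBundle.continuous_proj F (TangentSpace 𝓘(ℝ, F) (M := N)))).mem_nhds hq)
  have h3 := (contMDiff_snd_tangentBundle_modelSpace F 𝓘(ℝ, F) (n := ∞)).contMDiffAt.comp q
    (h2.comp q hV.contMDiffAt)
  refine h3.congr_of_eventuallyEq ?_
  filter_upwards [hφ.preimage_mem_nhds (ψ.open_source.mem_nhds hq)] with y hy
  simp only [Function.comp, tangentMapWithin, mfderivWithin_of_isOpen ψ.open_source hy]
  rfl

section Chart

variable {φ : M → N} (hφ : ContMDiff 𝓘(ℝ, E) 𝓘(ℝ, F) ∞ φ)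
  {ψ : OpenPartialHomeomorph N F} (hψ : ψ ∈ IsManifold.maximalAtlas 𝓘(ℝ, F) ∞ N)
  {s : X → M} {x : X} (hs : ContMDiffAt 𝓘(ℝ, X) 𝓘(ℝ, E) ∞ s x) (hx : φ (s x) ∈ ψ.source)
include hφ hψ hs hx

theorem contDiffAt_chart_comp : ContDiffAt ℝ ∞ (fun z => ψ (φ (s z))) x := by
  rw [← contMDiffAt_iff_contDiffAt]
  exact (contMDiffAt_of_mem_maximalAtlas hψ hx).comp x (hφ.contMDiffAt.comp x hs)

theorem fderiv_chart_comp (u : X) :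
    fderiv ℝ (fun z => ψ (φ (s z))) x u = differential ψ (φ (s x))
      (mfderiv 𝓘(ℝ, E) 𝓘(ℝ, F) φ (s x) (mfderiv 𝓘(ℝ, X) 𝓘(ℝ, E) s x u)) := by
  rw [← mfderiv_eq_fderiv]
  have h1 := (hφ.contMDiffAt (x := s x)).mdifferentiableAt (by simp)
  have h2 := hs.mdifferentiableAt (by simp)
  have h3 := (contMDiffAt_of_mem_maximalAtlas hψ hx).mdifferentiableAt (by simp)
  have h4 := mfderiv_comp (I := 𝓘(ℝ, X)) (I' := 𝓘(ℝ, E)) (I'' := 𝓘(ℝ, F)) x h1 h2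
  have h5 := mfderiv_comp (I := 𝓘(ℝ, X)) (I' := 𝓘(ℝ, F)) (I'' := 𝓘(ℝ, F)) (f := φ ∘ s) x h3
    (h1.comp x h2)
  refine (congrArg (fun L : X →L[ℝ] F => L u) h5).trans ?_
  exact congrArg (fun a : F => differential ψ (φ (s x)) a)
    (congrArg (fun L : X →L[ℝ] F => L u) h4)

theorem pullbackMetric_chart_comp [IsManifold 𝓘(ℝ, F) ∞ N]
    (h : ∀ y : N, TangentSpace 𝓘(ℝ, F) y →L[ℝ] TangentSpace 𝓘(ℝ, F) y →L[ℝ] ℝ) :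
    pullbackMetric (paramMetric h ψ.symm) (fun z => ψ (φ (s z))) x =
      paramMetric (inducedMetric (E := E) h φ) s x := by
  ext u v
  rw [pullbackMetric_apply, fderiv_chart_comp hφ hψ hs hx, fderiv_chart_comp hφ hψ hs hx]
  exact paramMetric_symm_apply h hψ hx _ _

theorem fderiv_differential_apply [IsManifold 𝓘(ℝ, E) ∞ M] [IsManifold 𝓘(ℝ, F) ∞ N] {V : ∀ q : M, TangentSpace 𝓘(ℝ, F) (φ q)}
    (hV : ContMDiff 𝓘(ℝ, E) (𝓘(ℝ, F).tangent) ∞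
      (fun q => (⟨φ q, V q⟩ : TangentBundle 𝓘(ℝ, F) N))) (u : X) :
    ContDiffAt ℝ ∞ (fun z => differential ψ (φ (s z)) (V (s z))) x ∧
    fderiv ℝ (fun z => differential ψ (φ (s z)) (V (s z))) x u =
      differential (fun q => differential ψ (φ q) (V q)) (s x)
        (mfderiv 𝓘(ℝ, X) 𝓘(ℝ, E) s x u) := by
  have h1 := contMDiffAt_differential_apply (E := E) hV hψ hφ.continuous.continuousAt hx
  constructor
  · rw [← contMDiffAt_iff_contDiffAt]
    exact h1.comp x hs
  rw [← mfderiv_eq_fderiv]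
  have h4 := mfderiv_comp (I := 𝓘(ℝ, X)) (I' := 𝓘(ℝ, E)) (I'' := 𝓘(ℝ, F)) x
    (h1.mdifferentiableAt (by simp)) (hs.mdifferentiableAt (by simp))
  exact congrArg (fun L : X →L[ℝ] F => L u) h4

end Chart

/-- A coordinate change of the target is smooth, and its derivative relates the differentials of the
two charts. -/
theorem fderiv_chart_change_differential [IsManifold 𝓘(ℝ, F) ∞ N]
    {ψ ψ' : OpenPartialHomeomorph N F} (hψ : ψ ∈ IsManifold.maximalAtlas 𝓘(ℝ, F) ∞ N)
    (hψ' : ψ' ∈ IsManifold.maximalAtlas 𝓘(ℝ, F) ∞ N) {q : N} (hq : q ∈ ψ.source)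
    (hq' : q ∈ ψ'.source) (a : TangentSpace 𝓘(ℝ, F) q) :
    ContDiffAt ℝ ∞ (fun z => ψ' (ψ.symm z)) (ψ q) ∧
    fderiv ℝ (fun z => ψ' (ψ.symm z)) (ψ q) (differential ψ q a) = differential ψ' q a := by
  have h0 : ContMDiffAt 𝓘(ℝ, F) 𝓘(ℝ, F) ∞ (fun z => ψ' (ψ.symm z)) (ψ q) := by
    refine ContMDiffAt.comp (I' := 𝓘(ℝ, F)) (ψ q) ?_
      (contMDiffAt_symm_of_mem_maximalAtlas hψ (ψ.map_source hq))
    rw [ψ.left_inv hq]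
    exact contMDiffAt_of_mem_maximalAtlas hψ' hq'
  refine ⟨contMDiffAt_iff_contDiffAt.1 h0, ?_⟩
  have h1 := mfderiv_comp (I := 𝓘(ℝ, F)) (I' := 𝓘(ℝ, F)) (I'' := 𝓘(ℝ, F)) q
    (h0.mdifferentiableAt (by simp))
    ((contMDiffAt_of_mem_maximalAtlas hψ hq).mdifferentiableAt (by simp))
  have h2 : (fun z => ψ' (ψ.symm z)) ∘ ψ =ᶠ[𝓝 q] ψ' := by
    filter_upwards [ψ.open_source.mem_nhds hq] with z hz
    simp [ψ.left_inv hz]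
  rw [h2.mfderiv_eq, mfderiv_eq_fderiv] at h1
  exact (congrArg (fun L : F →L[ℝ] F => L a) h1).symm

theorem pullbackMetric_chart_change [IsManifold 𝓘(ℝ, F) ∞ N]
    {ψ ψ' : OpenPartialHomeomorph N F} (hψ : ψ ∈ IsManifold.maximalAtlas 𝓘(ℝ, F) ∞ N)
    (hψ' : ψ' ∈ IsManifold.maximalAtlas 𝓘(ℝ, F) ∞ N) {q : N} (hq : q ∈ ψ.source)
    (hq' : q ∈ ψ'.source)
    (h : ∀ y : N, TangentSpace 𝓘(ℝ, F) y →L[ℝ] TangentSpace 𝓘(ℝ, F) y →L[ℝ] ℝ) :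
    pullbackMetric (paramMetric h ψ'.symm) (fun z => ψ' (ψ.symm z)) (ψ q) =
      paramMetric h ψ.symm (ψ q) := by
  have h1 := pullbackMetric_chart_comp (φ := (id : N → N)) contMDiff_id hψ'
    (contMDiffAt_symm_of_mem_maximalAtlas hψ (ψ.map_source hq)) (x := ψ q)
    (by simpa [ψ.left_inv hq] using hq') h
  refine h1.trans ?_
  ext u v
  simp only [paramMetric_apply]
  change h _ (mfderiv 𝓘(ℝ, F) 𝓘(ℝ, F) (id : N → N) _ _)
    (mfderiv 𝓘(ℝ, F) 𝓘(ℝ, F) (id : N → N) _ _) = _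
  rw [mfderiv_id]
  rfl

theorem isMetricOn_paramMetric [FiniteDimensional ℝ X] [IsManifold 𝓘(ℝ, E) ∞ M]
    (h : ContMDiffRiemannianMetric 𝓘(ℝ, E) ∞ E (fun y : M => TangentSpace 𝓘(ℝ, E) y))
    {s : X → M} {U : Set X} (hU : IsOpen U) (hs : ContMDiffOn 𝓘(ℝ, X) 𝓘(ℝ, E) ∞ s U)
    (hinj : ∀ x ∈ U, Function.Injective (mfderiv 𝓘(ℝ, X) 𝓘(ℝ, E) s x)) :
    IsMetricOn (paramMetric h.inner s) U where
  isOpen := hU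
  contDiffAt x hx := contDiffAt_paramMetric h hU hs hx
  symm _ _ _ _ := h.symm _ _ _
  pos x hx _ hv := h.pos _ _ ((map_ne_zero_iff _ (hinj x hx)).2 hv)

theorem isMetricOn_paramMetric_symm [FiniteDimensional ℝ E] [IsManifold 𝓘(ℝ, E) ∞ M]
    (h : ContMDiffRiemannianMetric 𝓘(ℝ, E) ∞ E (fun y : M => TangentSpace 𝓘(ℝ, E) y))
    {e : OpenPartialHomeomorph M E} (he : e ∈ IsManifold.maximalAtlas 𝓘(ℝ, E) ∞ M) :
    IsMetricOn (paramMetric h.inner e.symm) e.target :=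
  isMetricOn_paramMetric h e.open_target (contMDiffOn_symm_of_mem_maximalAtlas he)
    fun _ hx => (mdifferentiable_of_mem_maximalAtlas he).symm.mfderiv_injective hx

/-- The second fundamental form of `φ` in the coordinates given by a parametrization `s : X → M`. -/
noncomputable def paramSecondForm
    (h : ∀ y : N, TangentSpace 𝓘(ℝ, F) y →L[ℝ] TangentSpace 𝓘(ℝ, F) y →L[ℝ] ℝ)
    (φ : M → N) (ξ : ∀ q : M, TangentSpace 𝓘(ℝ, F) (φ q)) (s : X → M) (x u v : X) : ℝ :=
  secondFundamentalForm h φ ξ (s x) (mfderiv 𝓘(ℝ, X) 𝓘(ℝ, E) s x u)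
    (mfderiv 𝓘(ℝ, X) 𝓘(ℝ, E) s x v)

section SecondForm

variable [FiniteDimensional ℝ X] [FiniteDimensional ℝ F]
  [IsManifold 𝓘(ℝ, E) ∞ M] [IsManifold 𝓘(ℝ, F) ∞ N]
  (h : ContMDiffRiemannianMetric 𝓘(ℝ, F) ∞ F (fun y : N => TangentSpace 𝓘(ℝ, F) y))
  {φ : M → N} (hφ : ContMDiff 𝓘(ℝ, E) 𝓘(ℝ, F) ∞ φ) {V : ∀ q : M, TangentSpace 𝓘(ℝ, F) (φ q)}
  (hV : ContMDiff 𝓘(ℝ, E) (𝓘(ℝ, F).tangent) ∞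
    (fun q => (⟨φ q, V q⟩ : TangentBundle 𝓘(ℝ, F) N)))
  {s : X → M} {x : X} (hs : ContMDiffAt 𝓘(ℝ, X) 𝓘(ℝ, E) ∞ s x)
include hφ hV hs

omit [FiniteDimensional ℝ X] [FiniteDimensional ℝ F] in
/-- In the preferred chart of the target, the second fundamental form agrees with the local one by the
definition of the covariant derivative along `φ`. -/
theorem paramSecondForm_eq_chartAt (u v : X) :
    paramSecondForm (E := E) h.inner φ V s x u v =
      localSecondForm (metricInChart h.inner (φ (s x))) (fun z => chartAt F (φ (s x)) (φ (s z)))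
        (fun z => differential (chartAt F (φ (s x))) (φ (s z)) (V (s z))) x u v := by
  have hx : φ (s x) ∈ (chartAt F (φ (s x))).source := mem_chart_source _ _
  have hψ : chartAt F (φ (s x)) ∈ IsManifold.maximalAtlas 𝓘(ℝ, F) ∞ N :=
    IsManifold.chart_mem_maximalAtlas _
  set ψ := chartAt F (φ (s x)) with hψdef
  have hinv : ∀ a : F, differential (E := F) ψ (φ (s x))
      ((differential (E := F) ψ (φ (s x))).inverse a) = a := by
    intro a
    have h1 : (differential ψ (φ (s x))).IsInvertible :=
      ⟨(mdifferentiable_of_mem_maximalAtlas hψ).mfderiv hx, rfl⟩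
    obtain ⟨L, hL⟩ := h1
    rw [← hL]
    simp
  rw [localSecondForm, covDeriv, fderiv_chart_comp hφ hψ hs hx, fderiv_chart_comp hφ hψ hs hx,
    (fderiv_differential_apply hφ hψ hs hx hV u).2]
  rw [paramSecondForm, secondFundamentalForm, neg_apply, ContinuousLinearMap.comp_apply]
  rw [← paramMetric_symm_apply h.inner hψ hx]
  have h1 : differential (E := F) ψ (φ (s x))
      (covDerivAlong h.inner φ V (s x) (mfderiv 𝓘(ℝ, X) 𝓘(ℝ, E) s x u)) = _ := hinv _
  rw [h1]
  rfl

/-- The second fundamental form may be computed in any chart of the target. The definition uses the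
chart preferred at `φ (s x)`, which varies with `x`; a single chart is needed to differentiate. -/
theorem paramSecondForm_eq {ψ : OpenPartialHomeomorph N F}
    (hψ : ψ ∈ IsManifold.maximalAtlas 𝓘(ℝ, F) ∞ N) (hx : φ (s x) ∈ ψ.source) (u v : X) :
    paramSecondForm (E := E) h.inner φ V s x u v =
      localSecondForm (paramMetric h.inner ψ.symm) (fun z => ψ (φ (s z)))
        (fun z => differential ψ (φ (s z)) (V (s z))) x u v := by
  rw [paramSecondForm_eq_chartAt h hφ hV hs, metricInChart_eq_paramMetric]
  have hx' : φ (s x) ∈ (chartAt F (φ (s x))).source := mem_chart_source _ _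
  have hψ' : chartAt F (φ (s x)) ∈ IsManifold.maximalAtlas 𝓘(ℝ, F) ∞ N :=
    IsManifold.chart_mem_maximalAtlas _
  set ψ' := chartAt F (φ (s x)) with hψdef
  have hc : ContinuousAt (fun z => φ (s z)) x := hφ.continuous.continuousAt.comp hs.continuousAt
  have hev : ∀ᶠ z in 𝓝 x, φ (s z) ∈ ψ.source ∩ ψ'.source :=
    hc.preimage_mem_nhds ((ψ.open_source.inter ψ'.open_source).mem_nhds ⟨hx, hx'⟩)
  have hτ := fun (z : X) (hz : φ (s z) ∈ ψ.source ∩ ψ'.source) =>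
    fderiv_chart_change_differential hψ hψ' hz.1 hz.2
  have hΦ' : (fun z => ψ' (φ (s z))) =ᶠ[𝓝 x] fun z => ψ' (ψ.symm (ψ (φ (s z)))) := by
    filter_upwards [hev] with z hz
    rw [ψ.left_inv hz.1]
  -- transfer from `ψ` to the preferred chart by the coordinate change `τ`
  have key := apply_covDeriv_comp (isMetricOn_paramMetric_symm h hψ)
    (isMetricOn_paramMetric_symm h hψ') (τ := fun z => ψ' (ψ.symm z))
    (Φ := fun z => ψ (φ (s z))) (V := fun z => differential ψ (φ (s z)) (V (s z)))
    (V' := fun z => differential ψ' (φ (s z)) (V (s z))) (x := x) (ψ.map_source hx)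
    (by simpa only [ψ.left_inv hx] using ψ'.map_source hx') (hτ x ⟨hx, hx'⟩ 0).1 ?_
    ((contDiffAt_chart_comp hφ hψ hs hx).differentiableAt (by simp))
    ((fderiv_differential_apply hφ hψ hs hx hV u).1.differentiableAt (by simp)) ?_ u
    (fderiv ℝ (fun z => ψ (φ (s z))) x v)
  · rw [localSecondForm, localSecondForm, ← key, fderiv_chart_comp hφ hψ' hs hx',
      fderiv_chart_comp hφ hψ hs hx, (hτ x ⟨hx, hx'⟩ _).2, covDeriv, covDeriv, hΦ'.fderiv_eq,
      ψ.left_inv hx]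
  · have h1 : ∀ᶠ y in 𝓝 (ψ (φ (s x))), y ∈ ψ.target ∩ ψ.symm ⁻¹' ψ'.source :=
      (ψ.isOpen_inter_preimage_symm ψ'.open_source).mem_nhds
        ⟨ψ.map_source hx, by simpa [ψ.left_inv hx] using hx'⟩
    filter_upwards [h1] with y hy
    have := pullbackMetric_chart_change hψ hψ' (ψ.map_target hy.1) hy.2 h.inner
    rw [ψ.right_inv hy.1] at this
    exact this.symm
  · filter_upwards [hev] with z hz
    exact (hτ z hz _).2.symm

end SecondForm

end Parametrization

end SurfaceGeometry

end

/-! ### The fundamental equations on a manifold -/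

section

open Filter Topology Bundle
set_option maxSynthPendingDepth 3

namespace SurfaceGeometry

section Germ

variable {E : Type*} [NormedAddCommGroup E] [NormedSpace ℝ E]
  {G G' : E → E →L[ℝ] E →L[ℝ] ℝ} {x : E}

theorem christoffel_congr (h : G =ᶠ[𝓝 x] G') (u v : E) :
    christoffel G x u v = christoffel G' x u v := by
  rw [christoffel, christoffel, koszul, koszul, h.fderiv_eq, h.self_of_nhds]

theorem curvature_congr (h : G =ᶠ[𝓝 x] G') (u v w : E) :
    curvature G x u v w = curvature G' x u v w := by
  have h1 : ∀ v w, fderiv ℝ (fun z => christoffel G z v w) x =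
      fderiv ℝ (fun z => christoffel G' z v w) x := by
    intro v w
    refine Filter.EventuallyEq.fderiv_eq ?_
    filter_upwards [h.eventuallyEq_nhds] with z hz using christoffel_congr hz v w
  simp only [curvature, h1, christoffel_congr h]

end Germ

/-- The equations of Gauss and Codazzi on the open set `U`, for the metric `G` and the second
fundamental form `b` of a hypersurface in a space of constant curvature `c`. -/
structure FundamentalEquations {X : Type*} [NormedAddCommGroup X] [NormedSpace ℝ X]
    (G : X → X →L[ℝ] X →L[ℝ] ℝ) (b : X → X → X → ℝ) (c : ℝ) (U : Set X) : Prop where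
  metric : IsMetricOn G U
  contDiffAt : ∀ x ∈ U, ∀ u v, ContDiffAt ℝ ∞ (fun z => b z u v) x
  symm : ∀ x ∈ U, ∀ u v, b x u v = b x v u
  add_right : ∀ x ∈ U, ∀ u v v', b x u (v + v') = b x u v + b x u v'
  smul_right : ∀ x ∈ U, ∀ (r : ℝ) (u v : X), b x u (r • v) = r * b x u v
  codazzi : ∀ x ∈ U, ∀ u v w,
    fderiv ℝ (fun z => b z v w) x u + b x u (christoffel G x v w) =
      fderiv ℝ (fun z => b z u w) x v + b x v (christoffel G x u w)
  gauss : ∀ x ∈ U, ∀ u v,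
    G x (curvature G x u v v) u =
      c * (G x u u * G x v v - G x u v ^ 2) + (b x u u * b x v v - b x u v ^ 2)

variable {X : Type*} [NormedAddCommGroup X] [NormedSpace ℝ X] [FiniteDimensional ℝ X]
  {E : Type*} [NormedAddCommGroup E] [NormedSpace ℝ E]
  {F : Type*} [NormedAddCommGroup F] [NormedSpace ℝ F] [FiniteDimensional ℝ F]
  {M : Type*} [TopologicalSpace M] [ChartedSpace E M] [IsManifold 𝓘(ℝ, E) ∞ M]
  {N : Type*} [TopologicalSpace N] [ChartedSpace F N] [IsManifold 𝓘(ℝ, F) ∞ N]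

omit [FiniteDimensional ℝ F] in
/-- Constant curvature, expressed at the centre of a preferred chart. -/
theorem HasConstantCurvature.localSectionalCurvature_eq
    {h : ∀ y : N, TangentSpace 𝓘(ℝ, F) y →L[ℝ] TangentSpace 𝓘(ℝ, F) y →L[ℝ] ℝ} {c : ℝ}
    (hc : HasConstantCurvature h c) (p : N) (u v : F) (huv : LinearIndependent ℝ ![u, v]) :
    localSectionalCurvature (metricInChart h p) (chartAt F p p) u v = c := by
  have hx : p ∈ (chartAt F p).source := mem_chart_source _ _
  let L : TangentSpace 𝓘(ℝ, F) p ≃L[ℝ] F := (mdifferentiable_of_mem_maximalAtlas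
    (IsManifold.chart_mem_maximalAtlas (I := 𝓘(ℝ, F)) (n := ∞) p)).mfderiv hx
  have hL : ∀ a : F, differential (E := F) (F := F) (chartAt F p) p (L.symm a) = a :=
    fun a => L.apply_symm_apply a
  have h1 := hc p (L.symm u) (L.symm v) (by
    refine LinearIndependent.pair_iff.2 fun a b hab => LinearIndependent.pair_iff.1 huv a b ?_
    have h2 := congrArg L hab
    rwa [map_add, map_smul, map_smul, L.apply_symm_apply, L.apply_symm_apply, map_zero] at h2)
  rw [sectionalCurvature, hL, hL] at h1
  exact h1

variable (h : ContMDiffRiemannianMetric 𝓘(ℝ, F) ∞ F (fun y : N => TangentSpace 𝓘(ℝ, F) y))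
  {c : ℝ} (hc : HasConstantCurvature h.inner c)
  {φ : M → N} (hφ : ContMDiff 𝓘(ℝ, E) 𝓘(ℝ, F) ∞ φ)
  (hφ_imm : ∀ p : M, Function.Injective (mfderiv 𝓘(ℝ, E) 𝓘(ℝ, F) φ p))
  {η : ∀ q : M, TangentSpace 𝓘(ℝ, F) (φ q)}
  (hη : ContMDiff 𝓘(ℝ, E) (𝓘(ℝ, F).tangent) ∞
    (fun q => (⟨φ q, η q⟩ : TangentBundle 𝓘(ℝ, F) N)))
  (hη_unit : ∀ p : M, h.inner (φ p) (η p) (η p) = 1)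
  (hη_normal : ∀ (p : M) (X : TangentSpace 𝓘(ℝ, E) p),
      h.inner (φ p) (η p) (mfderiv 𝓘(ℝ, E) 𝓘(ℝ, F) φ p X) = 0)
  {s : X → M} {U : Set X} (hU : IsOpen U) (hs : ContMDiffOn 𝓘(ℝ, X) 𝓘(ℝ, E) ∞ s U)
  (hinj : ∀ x ∈ U, Function.Injective (mfderiv 𝓘(ℝ, X) 𝓘(ℝ, E) s x))
  (hrank : Module.finrank ℝ F = Module.finrank ℝ X + 1)
include hφ hφ_imm hη hη_unit hη_normal hU hs hinj hrank

omit [FiniteDimensional ℝ X] in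
/-- An immersion is a hypersurface in the coordinates of a parametrization of the source and of
a chart of the target. -/
theorem isHypersurfaceOn_chart {ψ : OpenPartialHomeomorph N F}
    (hψ : ψ ∈ IsManifold.maximalAtlas 𝓘(ℝ, F) ∞ N) :
    IsHypersurfaceOn (paramMetric h.inner ψ.symm) ψ.target (fun z => ψ (φ (s z)))
      (fun z => differential ψ (φ (s z)) (η (s z)))
      (U ∩ (fun z => φ (s z)) ⁻¹' ψ.source) where
  metric := isMetricOn_paramMetric_symm h hψ
  isOpen := (hφ.continuous.comp_continuousOn hs.continuousOn).isOpen_inter_preimage hU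
    ψ.open_source
  mapsTo _ hx := ψ.map_source hx.2
  contDiffAt _ hx := contDiffAt_chart_comp hφ hψ (hs.contMDiffAt (hU.mem_nhds hx.1)) hx.2
  contDiffAt_normal x hx := (fderiv_differential_apply hφ hψ (hs.contMDiffAt (hU.mem_nhds hx.1)) hx.2
    hη (0 : X)).1
  injective x hx := by
    intro u v huv
    rw [fderiv_chart_comp hφ hψ (hs.contMDiffAt (hU.mem_nhds hx.1)) hx.2,
      fderiv_chart_comp hφ hψ (hs.contMDiffAt (hU.mem_nhds hx.1)) hx.2] at huv
    exact hinj x hx.1 (hφ_imm _ ((mdifferentiable_of_mem_maximalAtlas hψ).mfderiv_injective hx.2 huv))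
  unit x hx := (paramMetric_symm_apply h.inner hψ hx.2 _ _).trans (hη_unit _)
  normal x hx u := by
    rw [fderiv_chart_comp hφ hψ (hs.contMDiffAt (hU.mem_nhds hx.1)) hx.2]
    exact (paramMetric_symm_apply h.inner hψ hx.2 _ _).trans (hη_normal _ _)
  finrank_eq := hrank

include hc

/-- The Gauss and Codazzi equations of an immersed hypersurface, in the coordinates of a
parametrization `s` of the source. -/
theorem fundamentalEquations_param :
    FundamentalEquations (paramMetric (inducedMetric (E := E) h.inner φ) s)
      (paramSecondForm (E := E) h.inner φ η s) c U := by
  -- near each point, pass to the chart preferred at the image point, where the curvature is known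
  have key : ∀ x ∈ U, ∃ (H : F → F →L[ℝ] F →L[ℝ] ℝ) (W : Set F) (Φ n : X → F) (U' : Set X),
      x ∈ U' ∧ IsHypersurfaceOn H W Φ n U' ∧ (∀ u v : F, LinearIndependent ℝ ![u, v] →
        localSectionalCurvature H (Φ x) u v = c) ∧
      pullbackMetric H Φ =ᶠ[𝓝 x] paramMetric (inducedMetric (E := E) h.inner φ) s ∧
      ∀ᶠ z in 𝓝 x, ∀ u v, localSecondForm H Φ n z u v =
        paramSecondForm (E := E) h.inner φ η s z u v := by
    intro x hx
    have hψ := IsManifold.chart_mem_maximalAtlas (I := 𝓘(ℝ, F)) (n := ∞) (φ (s x))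
    have hS := isHypersurfaceOn_chart h hφ hφ_imm hη hη_unit hη_normal hU hs hinj hrank hψ
    have hxs : x ∈ U ∩ (fun z => φ (s z)) ⁻¹' (chartAt F (φ (s x))).source :=
      ⟨hx, mem_chart_source _ _⟩
    refine ⟨_, _, _, _, _, hxs, hS, hc.localSectionalCurvature_eq _, ?_, ?_⟩
    · filter_upwards [hS.eventually_mem hxs] with z hz
      exact pullbackMetric_chart_comp hφ hψ (hs.contMDiffAt (hU.mem_nhds hz.1)) hz.2 h.inner
    · filter_upwards [hS.eventually_mem hxs] with z hz u v
      exact (paramSecondForm_eq h hφ hη (hs.contMDiffAt (hU.mem_nhds hz.1)) hψ hz.2 u v).symm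
  have hb : ∀ {x : X} {b b' : X → X → X → ℝ}, (∀ᶠ z in 𝓝 x, ∀ u v, b z u v = b' z u v) →
      ∀ u v, (fun z => b z u v) =ᶠ[𝓝 x] fun z => b' z u v := by
    intro x b b' hb u v
    filter_upwards [hb] with z hz using hz u v
  refine ⟨⟨hU, ?_, ?_, ?_⟩, ?_, ?_, ?_, ?_, ?_, ?_⟩
  · intro x hx
    obtain ⟨H, W, Φ, n, U', hxU, hS, -, hG, -⟩ := key x hx
    exact (hS.isMetricOn_pullback.contDiffAt x hxU).congr_of_eventuallyEq hG.symm
  · intro x hx u v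
    exact h.symm _ _ _
  · intro x hx v hv
    exact h.pos _ _ ((map_ne_zero_iff _ (hφ_imm _)).2 ((map_ne_zero_iff _ (hinj x hx)).2 hv))
  · intro x hx u v
    obtain ⟨H, W, Φ, n, U', hxU, hS, -, -, hB⟩ := key x hx
    exact (hS.contDiffAt_localSecondForm hxU u v).congr_of_eventuallyEq (hb hB u v).symm
  · intro x hx u v
    obtain ⟨H, W, Φ, n, U', hxU, hS, -, -, hB⟩ := key x hx
    rw [← hB.self_of_nhds, ← hB.self_of_nhds, hS.localSecondForm_symm hxU]
  · intro x hx u v v'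
    exact ((secondFundamentalForm h.inner φ η (s x) (mfderiv 𝓘(ℝ, X) 𝓘(ℝ, E) s x u)).comp
      (mfderiv 𝓘(ℝ, X) 𝓘(ℝ, E) s x)).map_add v v'
  · intro x hx r u v
    exact ((secondFundamentalForm h.inner φ η (s x) (mfderiv 𝓘(ℝ, X) 𝓘(ℝ, E) s x u)).comp
      (mfderiv 𝓘(ℝ, X) 𝓘(ℝ, E) s x)).map_smul r v
  · intro x hx u v w
    obtain ⟨H, W, Φ, n, U', hxU, hS, hcH, hG, hB⟩ := key x hx
    have := hS.codazzi hxU hcH u v w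
    rw [(hb hB v w).fderiv_eq, (hb hB u w).fderiv_eq, christoffel_congr hG, christoffel_congr hG,
      hB.self_of_nhds, hB.self_of_nhds] at this
    exact this
  · intro x hx u v
    obtain ⟨H, W, Φ, n, U', hxU, hS, hcH, hG, hB⟩ := key x hx
    have := hS.gauss hxU hcH u v
    rw [curvature_congr hG, hG.self_of_nhds, hB.self_of_nhds, hB.self_of_nhds,
      hB.self_of_nhds] at this
    exact this

end SurfaceGeometry

end

/-! ### Shape operator and mean curvature in coordinates -/

section

open Filter Topology Bundle
set_option maxSynthPendingDepth 3

namespace SurfaceGeometry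

section Trace

/-- The determinant and the trace of the endomorphism `A` of a plane, in terms of the matrices of
the bilinear forms `g` and `B = g(A ·, ·)` in a basis. -/
theorem det_trace_of_bilin {V : Type*} [AddCommGroup V] [Module ℝ V] (v : Module.Basis (Fin 2) ℝ V)
    (A : V →ₗ[ℝ] V) (g : V →ₗ[ℝ] V →ₗ[ℝ] ℝ) (B : V → V → ℝ) (hB : ∀ X Y, g (A X) Y = B X Y) :
    LinearMap.det A * (g (v 0) (v 0) * g (v 1) (v 1) - g (v 0) (v 1) * g (v 1) (v 0)) =
        B (v 0) (v 0) * B (v 1) (v 1) - B (v 0) (v 1) * B (v 1) (v 0) ∧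
      LinearMap.trace ℝ V A *
          (g (v 0) (v 0) * g (v 1) (v 1) - g (v 0) (v 1) * g (v 1) (v 0)) =
        B (v 0) (v 0) * g (v 1) (v 1) - B (v 0) (v 1) * g (v 1) (v 0) -
          B (v 1) (v 0) * g (v 0) (v 1) + B (v 1) (v 1) * g (v 0) (v 0) := by
  have h : ∀ i Y, B (v i) Y =
      LinearMap.toMatrix v v A 0 i * g (v 0) Y + LinearMap.toMatrix v v A 1 i * g (v 1) Y := by
    intro i Y
    have h1 := v.sum_repr (A (v i))
    rw [Fin.sum_univ_two] at h1
    rw [← hB]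
    conv_lhs => rw [← h1]
    simp only [LinearMap.toMatrix_apply, map_add, map_smul, LinearMap.add_apply,
      LinearMap.smul_apply, smul_eq_mul]
  rw [← LinearMap.det_toMatrix v, LinearMap.trace_eq_matrix_trace ℝ v, Matrix.det_fin_two,
    Matrix.trace_fin_two, h, h, h, h]
  constructor <;> ring

end Trace

section Scaling

variable {E : Type*} [NormedAddCommGroup E] [NormedSpace ℝ E]
  {F : Type*} [NormedAddCommGroup F] [NormedSpace ℝ F]
  {M : Type*} [TopologicalSpace M] [ChartedSpace E M] [IsManifold 𝓘(ℝ, E) ∞ M]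
  {N : Type*} [TopologicalSpace N] [ChartedSpace F N] [IsManifold 𝓘(ℝ, F) ∞ N]

/-- The second fundamental form in the direction `f η` is `f` times that in the direction `η`: the
term `df(X) η` of `∇_X (f η)` is normal. -/
theorem secondFundamentalForm_smul
    (h : ∀ y : N, TangentSpace 𝓘(ℝ, F) y →L[ℝ] TangentSpace 𝓘(ℝ, F) y →L[ℝ] ℝ)
    {φ : M → N} (hφ : ContMDiff 𝓘(ℝ, E) 𝓘(ℝ, F) ∞ φ) {η : ∀ q : M, TangentSpace 𝓘(ℝ, F) (φ q)}
    (hη : ContMDiff 𝓘(ℝ, E) (𝓘(ℝ, F).tangent) ∞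
      (fun q => (⟨φ q, η q⟩ : TangentBundle 𝓘(ℝ, F) N)))
    {f : M → ℝ} {p : M} (hf : MDifferentiableAt 𝓘(ℝ, E) 𝓘(ℝ) f p)
    (hn : ∀ Y : TangentSpace 𝓘(ℝ, E) p, h (φ p) (η p) (mfderiv 𝓘(ℝ, E) 𝓘(ℝ, F) φ p Y) = 0)
    (X Y : TangentSpace 𝓘(ℝ, E) p) :
    secondFundamentalForm h φ (fun q => f q • η q) p X Y =
      f p * secondFundamentalForm h φ η p X Y := by
  have hx : φ p ∈ (chartAt F (φ p)).source := mem_chart_source _ _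
  have hψ := IsManifold.chart_mem_maximalAtlas (I := 𝓘(ℝ, F)) (n := ∞) (φ p)
  have h1 := (contMDiffAt_differential_apply (E := E) hη hψ hφ.continuous.continuousAt
    hx).mdifferentiableAt (by simp)
  have h2 := congrArg (fun L : E →L[ℝ] F => L X) (mvfderiv_smul hf h1)
  have h3 : (f • fun q => differential (E := F) (F := F) (chartAt F (φ p)) (φ q) (η q)) =
      fun q => differential (E := F) (F := F) (chartAt F (φ p)) (φ q) (f q • η q) := by
    ext1 q
    exact (map_smul _ _ _).symm
  have hinv : (differential (E := F) (F := F) (chartAt F (φ p)) (φ p)).inverse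
      (differential (E := F) (F := F) (chartAt F (φ p)) (φ p) (η p)) = η p := by
    have h1 : (differential (E := F) (F := F) (chartAt F (φ p)) (φ p)).IsInvertible :=
      ⟨(mdifferentiable_of_mem_maximalAtlas hψ).mfderiv hx, rfl⟩
    obtain ⟨L, hL⟩ := h1
    rw [← hL]
    simp
  -- Leibniz rule, with `t = df(X)`
  have key : ∃ t : ℝ, covDerivAlong h φ (fun q => f q • η q) p X =
      f p • covDerivAlong h φ η p X + t • η p := by
    refine ⟨mvfderiv 𝓘(ℝ, E) f p X, ?_⟩
    rw [h3] at h2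
    have h4 : differential (E := E) (F := F)
        (fun q => differential (E := F) (F := F) (chartAt F (φ p)) (φ q) (f q • η q)) p X =
        f p • differential (E := E) (F := F)
          (fun q => differential (E := F) (F := F) (chartAt F (φ p)) (φ q) (η q)) p X +
        mvfderiv 𝓘(ℝ, E) f p X • differential (E := F) (F := F) (chartAt F (φ p)) (φ p) (η p) := h2
    have h5 : ∀ a : F, differential (E := F) (F := F) (chartAt F (φ p)) (φ p) (f p • a) =
        f p • differential (E := F) (F := F) (chartAt F (φ p)) (φ p) a := fun a => map_smul _ _ _
    have h6 : differential (E := E) (F := F)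
        (fun q => differential (E := F) (F := F) (chartAt F (φ p)) (φ q) (f q • η q)) p X +
        christoffel (metricInChart h (φ p)) (chartAt F (φ p) (φ p))
          (differential (E := F) (F := F) (chartAt F (φ p)) (φ p) (mfderiv 𝓘(ℝ, E) 𝓘(ℝ, F) φ p X))
          (differential (E := F) (F := F) (chartAt F (φ p)) (φ p) (f p • η p)) =
        f p • (differential (E := E) (F := F)
          (fun q => differential (E := F) (F := F) (chartAt F (φ p)) (φ q) (η q)) p X +
        christoffel (metricInChart h (φ p)) (chartAt F (φ p) (φ p))
          (differential (E := F) (F := F) (chartAt F (φ p)) (φ p) (mfderiv 𝓘(ℝ, E) 𝓘(ℝ, F) φ p X))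
          (differential (E := F) (F := F) (chartAt F (φ p)) (φ p) (η p))) +
        mvfderiv 𝓘(ℝ, E) f p X •
          differential (E := F) (F := F) (chartAt F (φ p)) (φ p) (η p) := by
      rw [h4]
      erw [h5 (η p)]
      rw [christoffel_smul_right]
      module
    refine (congrArg (differential (E := F) (F := F) (chartAt F (φ p)) (φ p)).inverse h6).trans ?_
    rw [map_add, map_smul, map_smul, hinv]
    rfl
  obtain ⟨t, ht⟩ := key
  simp only [secondFundamentalForm, neg_apply, ContinuousLinearMap.comp_apply]
  rw [ht, map_add, map_smul, map_smul, add_apply, smul_apply, smul_apply, hn]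
  simp

end Scaling

section Surface

variable {X : Type*} [NormedAddCommGroup X] [NormedSpace ℝ X] [FiniteDimensional ℝ X]
  {F : Type*} [NormedAddCommGroup F] [NormedSpace ℝ F] [FiniteDimensional ℝ F]
  {M : Type*} [TopologicalSpace M] [ChartedSpace (EuclideanSpace ℝ (Fin 2)) M]
  {N : Type*} [TopologicalSpace N] [ChartedSpace F N]
  {h : ∀ y : N, TangentSpace 𝓘(ℝ, F) y →L[ℝ] TangentSpace 𝓘(ℝ, F) y →L[ℝ] ℝ}
  {φ : M → N}

omit [FiniteDimensional ℝ F] in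
theorem inducedMetric_pos (hpos : ∀ y v, v ≠ 0 → 0 < h y v v)
    (hφ_imm : ∀ p : M, Function.Injective (mfderiv (𝓡 2) 𝓘(ℝ, F) φ p)) (p : M)
    (v : TangentSpace (𝓡 2) p) (hv : v ≠ 0) : 0 < inducedMetric h φ p v v :=
  hpos _ _ ((map_ne_zero_iff _ (hφ_imm p)).2 hv)

theorem inducedMetric_shapeOperator (hpos : ∀ y v, v ≠ 0 → 0 < h y v v)
    (hφ_imm : ∀ p : M, Function.Injective (mfderiv (𝓡 2) 𝓘(ℝ, F) φ p))
    (ξ : ∀ q : M, TangentSpace 𝓘(ℝ, F) (φ q)) (p : M) (v w : TangentSpace (𝓡 2) p) :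
    inducedMetric h φ p (shapeOperator h φ ξ p v) w = secondFundamentalForm h φ ξ p v w := by
  have h1 := apply_inverse_of_pos (F := EuclideanSpace ℝ (Fin 2)) (B := inducedMetric h φ p)
    (inducedMetric_pos hpos hφ_imm p) (secondFundamentalForm h φ ξ p v)
  exact congrArg (fun L : EuclideanSpace ℝ (Fin 2) →L[ℝ] ℝ => L w) h1

theorem inducedMetric_gradient (hpos : ∀ y v, v ≠ 0 → 0 < h y v v)
    (hφ_imm : ∀ p : M, Function.Injective (mfderiv (𝓡 2) 𝓘(ℝ, F) φ p))
    (f : M → ℝ) (p : M) (w : TangentSpace (𝓡 2) p) :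
    inducedMetric h φ p (gradient (inducedMetric h φ) f p) w = differential f p w := by
  have h1 := apply_inverse_of_pos (F := EuclideanSpace ℝ (Fin 2)) (B := inducedMetric h φ p)
    (inducedMetric_pos hpos hφ_imm p) (differential f p)
  exact congrArg (fun L : EuclideanSpace ℝ (Fin 2) →L[ℝ] ℝ => L w) h1

omit [FiniteDimensional ℝ X] in
/-- The determinant of the shape operator and the mean curvature, in the coordinates of a
parametrization. -/
theorem det_meanCurvature_param (hpos : ∀ y v, v ≠ 0 → 0 < h y v v)
    (hφ_imm : ∀ p : M, Function.Injective (mfderiv (𝓡 2) 𝓘(ℝ, F) φ p))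
    (η : ∀ q : M, TangentSpace 𝓘(ℝ, F) (φ q)) {s : X → M} {x : X}
    (hs : Function.Bijective (mfderiv 𝓘(ℝ, X) (𝓡 2) s x)) (u : Module.Basis (Fin 2) ℝ X)
    {G : X →L[ℝ] X →L[ℝ] ℝ}
    (hG : G = paramMetric (inducedMetric (E := EuclideanSpace ℝ (Fin 2)) h φ) s x)
    {b : X → X → ℝ} (hb : b = paramSecondForm (E := EuclideanSpace ℝ (Fin 2)) h φ η s x) :
    LinearMap.det (shapeOperator (E := EuclideanSpace ℝ (Fin 2)) h φ η (s x)) *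
        (G (u 0) (u 0) * G (u 1) (u 1) - G (u 0) (u 1) * G (u 1) (u 0)) =
      b (u 0) (u 0) * b (u 1) (u 1) - b (u 0) (u 1) * b (u 1) (u 0) ∧
    2 * meanCurvature h φ η (s x) *
        (G (u 0) (u 0) * G (u 1) (u 1) - G (u 0) (u 1) * G (u 1) (u 0)) =
      b (u 0) (u 0) * G (u 1) (u 1) - b (u 0) (u 1) * G (u 1) (u 0) -
          b (u 1) (u 0) * G (u 0) (u 1) + b (u 1) (u 1) * G (u 0) (u 0) := by
  subst hG hb
  let T : X →L[ℝ] EuclideanSpace ℝ (Fin 2) := mfderiv 𝓘(ℝ, X) (𝓡 2) s x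
  let L : X ≃ₗ[ℝ] EuclideanSpace ℝ (Fin 2) := LinearEquiv.ofBijective T.toLinearMap hs
  let g : EuclideanSpace ℝ (Fin 2) →L[ℝ] EuclideanSpace ℝ (Fin 2) →L[ℝ] ℝ :=
    inducedMetric h φ (s x)
  have key := det_trace_of_bilin (V := EuclideanSpace ℝ (Fin 2)) (u.map L)
    (shapeOperator h φ η (s x))
    (LinearMap.mk₂ ℝ (fun v w => g v w) (by simp) (by simp) (by simp) (by simp))
    (fun v w => secondFundamentalForm h φ η (s x) v w)
    (inducedMetric_shapeOperator hpos hφ_imm η (s x))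
  refine ⟨key.1, ?_⟩
  refine Eq.trans ?_ key.2
  rw [meanCurvature, ← mul_assoc 2 (1 / 2 : ℝ), mul_one_div_cancel two_ne_zero, one_mul]
  rfl

end Surface

end SurfaceGeometry

end

/-! ### Immersed surfaces -/

section

open Filter Topology Bundle
set_option maxSynthPendingDepth 3

namespace SurfaceGeometry

section ImmersedSurface

variable {F : Type*} [NormedAddCommGroup F] [NormedSpace ℝ F] [FiniteDimensional ℝ F]
  {M : Type*} [TopologicalSpace M] [ChartedSpace (EuclideanSpace ℝ (Fin 2)) M]
  [IsManifold (𝓡 2) ∞ M]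
  {N : Type*} [TopologicalSpace N] [ChartedSpace F N] [IsManifold 𝓘(ℝ, F) ∞ N]

/-- The data of an isometric immersion of a surface, with a unit normal field, in a three-dimensional
manifold of constant curvature `c`. -/
structure IsImmersedSurface
    (h : ContMDiffRiemannianMetric 𝓘(ℝ, F) ∞ F (fun y : N => TangentSpace 𝓘(ℝ, F) y))
    (c : ℝ) (φ : M → N) (η : ∀ q : M, TangentSpace 𝓘(ℝ, F) (φ q)) : Prop where
  finrank_eq : Module.finrank ℝ F = 3
  curvature : HasConstantCurvature h.inner c
  contMDiff : ContMDiff (𝓡 2) 𝓘(ℝ, F) ∞ φ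
  injective : ∀ p : M, Function.Injective (mfderiv (𝓡 2) 𝓘(ℝ, F) φ p)
  contMDiff_normal : ContMDiff (𝓡 2) (𝓘(ℝ, F).tangent) ∞
    (fun q => (⟨φ q, η q⟩ : TangentBundle 𝓘(ℝ, F) N))
  unit : ∀ p : M, h.inner (φ p) (η p) (η p) = 1
  normal : ∀ (p : M) (X : TangentSpace (𝓡 2) p),
      h.inner (φ p) (η p) (mfderiv (𝓡 2) 𝓘(ℝ, F) φ p X) = 0

namespace IsImmersedSurface

variable {h : ContMDiffRiemannianMetric 𝓘(ℝ, F) ∞ F (fun y : N => TangentSpace 𝓘(ℝ, F) y)}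
  {c : ℝ} {φ : M → N} {η : ∀ q : M, TangentSpace 𝓘(ℝ, F) (φ q)} (hS : IsImmersedSurface h c φ η)
include hS

/-- The Gauss and Codazzi equations of the surface, in any local parametrization. -/
theorem fundamentalEquations {X : Type*} [NormedAddCommGroup X] [NormedSpace ℝ X]
    [FiniteDimensional ℝ X] (hX : Module.finrank ℝ X = 2)
    {s : X → M} {U : Set X} (hU : IsOpen U) (hs : ContMDiffOn 𝓘(ℝ, X) (𝓡 2) ∞ s U)
    (hinj : ∀ x ∈ U, Function.Injective (mfderiv 𝓘(ℝ, X) (𝓡 2) s x)) :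
    FundamentalEquations (paramMetric (inducedMetric (E := EuclideanSpace ℝ (Fin 2)) h.inner φ) s)
      (paramSecondForm (E := EuclideanSpace ℝ (Fin 2)) h.inner φ η s) c U :=
  fundamentalEquations_param h hS.curvature hS.contMDiff hS.injective hS.contMDiff_normal hS.unit
    hS.normal hU hs hinj (by rw [hS.finrank_eq, hX])

/-- The Gauss equation and the smoothness of the mean curvature, in the preferred chart at `p`. -/
theorem det_contMDiffAt (p : M) :
    LinearMap.det (shapeOperator (E := EuclideanSpace ℝ (Fin 2)) h.inner φ η p) =
        gaussianCurvature (inducedMetric h.inner φ) p - c ∧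
      ContMDiffAt (𝓡 2) 𝓘(ℝ) ∞ (meanCurvature h.inner φ η) p := by
  have he := IsManifold.chart_mem_maximalAtlas (I := 𝓡 2) (n := ∞) p
  set e := chartAt (EuclideanSpace ℝ (Fin 2)) p with hedef
  have hd := (mdifferentiable_of_mem_maximalAtlas he).symm
  have hFE := hS.fundamentalEquations (by simp) e.open_target
    (contMDiffOn_symm_of_mem_maximalAtlas he) fun x hx => hd.mfderiv_injective hx
  let u := (EuclideanSpace.basisFun (Fin 2) ℝ).toBasis
  have hu : LinearIndependent ℝ ![u 0, u 1] := by
    have h1 : ![u 0, u 1] = u := by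
      funext i
      fin_cases i <;> rfl
    rw [h1]
    exact u.linearIndependent
  have hgram := fun x hx => gram_pos (hFE.metric.symm x hx) (hFE.metric.pos x hx) hu
  have key := fun x hx => det_meanCurvature_param (h := h.inner) h.pos hS.injective η
    (hd.mfderiv_bijective (x := x) hx) u rfl rfl
  set G := paramMetric (inducedMetric (E := EuclideanSpace ℝ (Fin 2)) h.inner φ) e.symm with hG
  set b := paramSecondForm (E := EuclideanSpace ℝ (Fin 2)) h.inner φ η e.symm with hb
  have hp : p ∈ e.source := mem_chart_source _ _
  have hx := e.map_source hp
  constructor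
  · have h1 := (key (e p) hx).1
    have h2 : LinearMap.det (shapeOperator (E := EuclideanSpace ℝ (Fin 2)) h.inner φ η (e.symm (e p))) =
        LinearMap.det (shapeOperator (E := EuclideanSpace ℝ (Fin 2)) h.inner φ η p) :=
      congrArg (fun q => LinearMap.det (shapeOperator (E := EuclideanSpace ℝ (Fin 2)) h.inner φ η q)) (e.left_inv hp)
    rw [h2] at h1
    have h3 := hFE.gauss (e p) hx (u 0) (u 1)
    have h4 := hgram _ hx
    have hK : gaussianCurvature (inducedMetric h.inner φ) p =
        localSectionalCurvature G (e p) (u 0) (u 1) := by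
      simp only [gaussianCurvature, u, OrthonormalBasis.coe_toBasis, EuclideanSpace.basisFun_apply]
      rfl
    rw [hK, localSectionalCurvature, h3, eq_sub_iff_add_eq, eq_div_iff h4.ne', add_mul]
    rw [hFE.metric.symm _ hx (u 1) (u 0), hFE.symm _ hx (u 1) (u 0)] at h1
    linear_combination h1
  · have hsm : ContDiffAt ℝ ∞ (fun x => meanCurvature h.inner φ η (e.symm x)) (e p) := by
      have hg : ∀ a a', ContDiffAt ℝ ∞ (fun x => G x a a') (e p) := fun a a' =>
        ((hFE.metric.contDiffAt _ hx).clm_apply contDiffAt_const).clm_apply contDiffAt_const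
      have hB := fun a a' => hFE.contDiffAt _ hx a a'
      have h1 : ContDiffAt ℝ ∞ (fun x => (b x (u 0) (u 0) * G x (u 1) (u 1) -
          2 * (b x (u 0) (u 1) * G x (u 0) (u 1)) + b x (u 1) (u 1) * G x (u 0) (u 0)) /
          (2 * (G x (u 0) (u 0) * G x (u 1) (u 1) - G x (u 0) (u 1) ^ 2))) (e p) :=
        ContDiffAt.div (((((hB _ _).mul (hg _ _)).sub (contDiffAt_const.mul
          ((hB _ _).mul (hg _ _))))).add ((hB _ _).mul (hg _ _)))
          (contDiffAt_const.mul (((hg _ _).mul (hg _ _)).sub ((hg _ _).pow 2)))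
          (mul_ne_zero two_ne_zero (hgram _ hx).ne')
      refine h1.congr_of_eventuallyEq ?_
      filter_upwards [e.open_target.mem_nhds hx] with x hx
      have h2 := (key x hx).2
      rw [hFE.metric.symm _ hx (u 1) (u 0), hFE.symm _ hx (u 1) (u 0)] at h2
      rw [eq_div_iff (mul_ne_zero two_ne_zero (hgram _ hx).ne')]
      linear_combination h2
    have h2 := (contMDiffAt_iff_contDiffAt.2 hsm).comp p (contMDiffAt_of_mem_maximalAtlas he hp)
    refine h2.congr_of_eventuallyEq ?_
    filter_upwards [e.open_source.mem_nhds hp] with q hq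
    simp [e.left_inv hq]

theorem contMDiff_meanCurvature : ContMDiff (𝓡 2) 𝓘(ℝ) ∞ (meanCurvature h.inner φ η) :=
  fun p => (hS.det_contMDiffAt p).2

/-- The shape operator in the direction of the mean curvature vector. -/
theorem secondFundamentalForm_meanCurvatureVector (p : M) (X Y : TangentSpace (𝓡 2) p) :
    secondFundamentalForm h.inner φ (meanCurvatureVector h.inner φ η) p X Y =
      meanCurvature h.inner φ η p * secondFundamentalForm h.inner φ η p X Y :=
  secondFundamentalForm_smul h.inner hS.contMDiff hS.contMDiff_normal
    ((hS.contMDiff_meanCurvature p).mdifferentiableAt (by simp)) (hS.normal p) X Y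

end IsImmersedSurface

end ImmersedSurface

end SurfaceGeometry

end

/-! ### Laplacians and unique continuation in the plane -/

section

open Filter Topology Bundle
set_option maxSynthPendingDepth 3

namespace SurfaceGeometry

section Analysis

open Laplacian InnerProductSpace

theorem two_le_smooth : (2 : WithTop ℕ∞) ≤ ∞ := by
  norm_cast

theorem laplacian_eq_fderiv {w : ℂ → ℝ} {z : ℂ} (hw : ContDiffAt ℝ 2 w z) :
    Δ w z = fderiv ℝ (fun y => fderiv ℝ w y 1) z 1 +
      fderiv ℝ (fun y => fderiv ℝ w y Complex.I) z Complex.I := by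
  have hd : DifferentiableAt ℝ (fderiv ℝ w) z :=
    (hw.fderiv_right (m := 1) (by norm_num)).differentiableAt (by simp)
  have h1 : ∀ u : ℂ, fderiv ℝ (fun y => fderiv ℝ w y u) z u = fderiv ℝ (fderiv ℝ w) z u u := by
    intro u
    rw [fderiv_clm_apply hd (differentiableAt_const u)]
    simp
  rw [laplacian_eq_iteratedFDeriv_complexPlane, h1, h1]
  simp [iteratedFDeriv_two_apply]

theorem continuousAt_laplacian {w : ℂ → ℝ} {z : ℂ} (hw : ContDiffAt ℝ ∞ w z) :
    ContinuousAt (Δ w) z := by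
  have h1 : ∀ u : ℂ, ContinuousAt (fun x => fderiv ℝ (fun y => fderiv ℝ w y u) x u) z := by
    intro u
    have h2 : ContDiffAt ℝ ∞ (fun y => fderiv ℝ w y u) z :=
      (hw.fderiv_right (m := ∞) (by simp)).clm_apply contDiffAt_const
    exact ((h2.fderiv_right (m := ∞) (by simp)).clm_apply contDiffAt_const).continuousAt
  refine ((h1 1).add (h1 Complex.I)).congr ?_
  filter_upwards [(hw.of_le two_le_smooth).eventually (by simp)] with y hy
  exact (laplacian_eq_fderiv hy).symm

theorem laplacian_eq_zero_of_fderiv {w : ℂ → ℝ} {z : ℂ} (hw : ContDiffAt ℝ ∞ w z)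
    (h : ∀ᶠ y in 𝓝 z, fderiv ℝ w y = 0) : Δ w z = 0 := by
  have h1 : ∀ u : ℂ, fderiv ℝ (fun y => fderiv ℝ w y u) z = 0 := by
    intro u
    have : (fun y => fderiv ℝ w y u) =ᶠ[𝓝 z] fun _ => 0 := by
      filter_upwards [h] with y hy
      simp [hy]
    rw [this.fderiv_eq]
    simp
  rw [laplacian_eq_fderiv (hw.of_le two_le_smooth), h1, h1]
  simp

theorem ext_fderiv_complex {E : Type*} [NormedAddCommGroup E] [NormedSpace ℝ E] {A B : ℂ →L[ℝ] E}
    (h1 : A 1 = B 1) (hI : A Complex.I = B Complex.I) : A = B := by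
  ext z
  have hz : z = z.re • (1 : ℂ) + z.im • Complex.I := by simp
  rw [hz, map_add, map_smul, map_smul, map_add, map_smul, map_smul, h1, hI]

/-- If `Δ w = c L` wherever `dw ≠ 0`, with `L > 0`, then the set where `dw ≠ 0` is empty or dense.
Indeed `Δ w = c L` on the closure of this set, and `Δ w = 0` outside. For `c ≠ 0` the closure is
therefore open; for `c = 0` the function `w` is harmonic, and `∂w/∂z` is holomorphic. -/
theorem subset_closure_of_laplacian {w L : ℂ → ℝ} {B : Set ℂ} {c : ℝ} (hB : IsOpen B)
    (hBc : IsPreconnected B) (hw : ∀ z ∈ B, ContDiffAt ℝ ∞ w z) (hL : ∀ z ∈ B, 0 < L z)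
    (hLc : ∀ z ∈ B, ContinuousAt L z)
    (hD : ∀ z ∈ B, fderiv ℝ w z ≠ 0 → Δ w z = c * L z) (hne : ∃ z ∈ B, fderiv ℝ w z ≠ 0) :
    B ⊆ closure {z | fderiv ℝ w z ≠ 0} := by
  set D := {z | fderiv ℝ w z ≠ 0} with hDdef
  have hin : ∀ z ∈ B, z ∈ closure D → Δ w z = c * L z := by
    intro z hz hzD
    by_contra hcon
    have h1 : ContinuousAt (fun z => Δ w z - c * L z) z :=
      (continuousAt_laplacian (hw z hz)).sub ((hLc z hz).const_mul c)
    have h2 := h1.eventually_ne (sub_ne_zero.2 hcon)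
    obtain ⟨y, hyD, hy, hyB⟩ := ((mem_closure_iff_frequently.1 hzD).and_eventually
      (h2.and (hB.mem_nhds hz))).exists
    exact hy (sub_eq_zero.2 (hD y hyB hyD))
  have hout' : ∀ z, z ∉ closure D → ∀ᶠ y in 𝓝 z, fderiv ℝ w y = 0 := by
    intro z hzD
    filter_upwards [isClosed_closure.isOpen_compl.mem_nhds hzD] with y hy
    by_contra hcon
    exact hy (subset_closure hcon)
  have hout : ∀ z ∈ B, z ∉ closure D → Δ w z = 0 := fun z hz hzD =>
    laplacian_eq_zero_of_fderiv (hw z hz) (hout' z hzD)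
  rcases eq_or_ne c 0 with rfl | hc
  · have hharm : ∀ z ∈ B, HarmonicAt w z := by
      intro z hz
      refine ⟨(hw z hz).of_le two_le_smooth, ?_⟩
      filter_upwards [hB.mem_nhds hz] with y hy
      by_cases hyD : y ∈ closure D
      · simpa using hin y hy hyD
      · exact hout y hy hyD
    have han : AnalyticOnNhd ℂ (fun z ↦ (fderiv ℝ w z 1 : ℂ) - Complex.I * fderiv ℝ w z Complex.I) B :=
      fun z hz => HarmonicAt.analyticAt_complex_partial (hharm z hz)
    intro z hz
    by_contra hzD
    have h0 := han.eqOn_zero_of_preconnected_of_eventuallyEq_zero hBc hz (by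
      filter_upwards [hout' z hzD] with y hy
      simp [hy])
    obtain ⟨y, hy, hy0⟩ := hne
    refine hy0 (ext_fderiv_complex ?_ ?_)
    · simpa using congrArg Complex.re (h0 hy)
    · simpa using congrArg Complex.im (h0 hy)
  -- `Δ w = c L ≠ 0` persists near a point of the closure, whereas `Δ w = 0` off the closure
  · have hsub : B ∩ closure D ⊆ interior (closure D) := by
      rintro z ⟨hz, hzD⟩
      have h1 : Δ w z ≠ 0 := by
        rw [hin z hz hzD]
        exact mul_ne_zero hc (hL z hz).ne'
      rw [mem_interior_iff_mem_nhds]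
      filter_upwards [(continuousAt_laplacian (hw z hz)).eventually_ne h1, hB.mem_nhds hz] with y hy hyB
      by_contra hyD
      exact hy (hout y hyB hyD)
    obtain ⟨y, hy, hy0⟩ := hne
    refine (hBc.subset_of_closure_inter_subset isOpen_interior
      ⟨y, hy, hsub ⟨hy, subset_closure hy0⟩⟩ ?_).trans interior_subset
    rintro z ⟨hz, hzB⟩
    exact hsub ⟨hzB, (closure_minimal interior_subset isClosed_closure) hz⟩

/-- A punctured disc is the image of a strip under polar coordinates. -/
theorem isPreconnected_punctured_ball (p : ℂ) (r : ℝ) :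
    IsPreconnected (Metric.ball p r \ {p}) := by
  have h : Metric.ball p r \ {p} = (fun x : ℝ × ℝ => p + x.1 * Complex.exp (x.2 * Complex.I)) ''
      (Set.Ioo 0 r ×ˢ Set.univ) := by
    ext z
    simp only [Set.mem_sdiff, Metric.mem_ball, dist_eq_norm, Set.mem_singleton_iff, Set.mem_image,
      Set.mem_prod, Set.mem_Ioo, Set.mem_univ, and_true, Prod.exists]
    constructor
    · rintro ⟨h1, h2⟩
      refine ⟨‖z - p‖, (z - p).arg, ⟨norm_pos_iff.2 (sub_ne_zero.2 h2), h1⟩, ?_⟩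
      rw [Complex.norm_mul_exp_arg_mul_I]
      ring
    · rintro ⟨ρ, θ, ⟨h1, h2⟩, rfl⟩
      have h3 : ‖(ρ : ℂ) * Complex.exp (θ * Complex.I)‖ = ρ := by
        rw [norm_mul, Complex.norm_exp_ofReal_mul_I, mul_one, Complex.norm_real, Real.norm_of_nonneg h1.le]
      rw [add_sub_cancel_left, h3]
      refine ⟨h2, fun h4 => h1.ne' ?_⟩
      rw [← h3, norm_eq_zero]
      simpa using h4
  rw [h]
  refine (isPreconnected_Ioo.prod isPreconnected_univ).image _ (Continuous.continuousOn ?_)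
  fun_prop

end Analysis

end SurfaceGeometry

end

/-! ### Gauss and Codazzi equations in isothermal coordinates -/

section

open Filter Topology Bundle
set_option maxSynthPendingDepth 3

namespace SurfaceGeometry

section Isothermal

open Laplacian InnerProductSpace

theorem inner_complex (u v : ℂ) : (inner ℝ u v : ℝ) = u.re * v.re + u.im * v.im := by
  rw [Complex.inner, Complex.mul_re, Complex.conj_re, Complex.conj_im]
  ring

variable {G : ℂ → ℂ →L[ℝ] ℂ →L[ℝ] ℝ} {L : ℂ → ℝ} {U : Set ℂ}

section Metric

variable (hG : IsMetricOn G U) (hL : ∀ z ∈ U, ∀ u v, G z u v = L z * inner ℝ u v)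
include hG hL

omit hG in
theorem conformalFactor_eq {z : ℂ} (hz : z ∈ U) : G z 1 1 = L z := by
  rw [hL z hz]
  simp

theorem conformalFactor_pos {z : ℂ} (hz : z ∈ U) : 0 < L z := by
  rw [← conformalFactor_eq hL hz]
  exact hG.pos z hz 1 one_ne_zero

theorem contDiffAt_conformalFactor {z : ℂ} (hz : z ∈ U) : ContDiffAt ℝ ∞ L z := by
  have h1 : ContDiffAt ℝ ∞ (fun z => G z 1 1) z :=
    ((hG.contDiffAt z hz).clm_apply contDiffAt_const).clm_apply contDiffAt_const
  refine h1.congr_of_eventuallyEq ?_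
  filter_upwards [hG.eventually_mem hz] with y hy
  exact (conformalFactor_eq hL hy).symm

theorem fderiv_conformal_apply {z : ℂ} (hz : z ∈ U) (u v w : ℂ) :
    fderiv ℝ G z u v w = fderiv ℝ L z u * inner ℝ v w := by
  rw [← hG.fderiv_apply hz]
  have h1 : (fun x => G x v w) =ᶠ[𝓝 z] fun x => L x * inner ℝ v w := by
    filter_upwards [hG.eventually_mem hz] with y hy using hL y hy v w
  rw [h1.fderiv_eq, fderiv_mul_const
    ((contDiffAt_conformalFactor hG hL hz).differentiableAt (by simp))]
  simp [mul_comm]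

/-- The Christoffel symbols of the metric `L (dx² + dy²)`. -/
theorem christoffel_conformal {z : ℂ} (hz : z ∈ U) (u v : ℂ) :
    christoffel G z u v = (1 / (2 * L z)) • (fderiv ℝ L z u • v + fderiv ℝ L z v • u -
      (inner ℝ u v : ℝ) • (fderiv ℝ L z 1 • (1 : ℂ) + fderiv ℝ L z Complex.I • Complex.I)) := by
  have h0 := (conformalFactor_pos hG hL hz).ne'
  refine eq_of_forall_apply_eq (hG.pos z hz) fun w => ?_
  rw [hG.apply_christoffel hz, koszul_apply, fderiv_conformal_apply hG hL hz,
    fderiv_conformal_apply hG hL hz, fderiv_conformal_apply hG hL hz, hL z hz]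
  have hw : fderiv ℝ L z w = w.re * fderiv ℝ L z 1 + w.im * fderiv ℝ L z Complex.I := by
    conv_lhs => rw [show w = w.re • (1 : ℂ) + w.im • Complex.I by simp]
    simp only [map_add, map_smul, smul_eq_mul]
  rw [hw]
  simp only [inner_smul_left, inner_sub_left, inner_add_left, inner_complex, Complex.one_re,
    Complex.one_im, Complex.I_re, Complex.I_im, conj_trivial]
  field_simp
  ring

theorem christoffel_conformal_one_one {z : ℂ} (hz : z ∈ U) :
    christoffel G z 1 1 = (fderiv ℝ L z 1 / (2 * L z)) • (1 : ℂ) +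
      (-(fderiv ℝ L z Complex.I / (2 * L z))) • Complex.I := by
  rw [christoffel_conformal hG hL hz]
  simp only [inner_complex, Complex.one_re, Complex.one_im, mul_zero, mul_one, add_zero]
  module

theorem christoffel_conformal_one_I {z : ℂ} (hz : z ∈ U) :
    christoffel G z 1 Complex.I = (fderiv ℝ L z Complex.I / (2 * L z)) • (1 : ℂ) +
      (fderiv ℝ L z 1 / (2 * L z)) • Complex.I := by
  rw [christoffel_conformal hG hL hz]
  simp only [inner_complex, Complex.one_re, Complex.one_im, Complex.I_re, Complex.I_im, mul_zero, mul_one, add_zero]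
  module

theorem christoffel_conformal_I_I {z : ℂ} (hz : z ∈ U) :
    christoffel G z Complex.I Complex.I = (-(fderiv ℝ L z 1 / (2 * L z))) • (1 : ℂ) +
      (fderiv ℝ L z Complex.I / (2 * L z)) • Complex.I := by
  rw [christoffel_conformal hG hL hz]
  simp only [inner_complex, Complex.I_re, Complex.I_im, mul_zero, mul_one, zero_add]
  module

/-- The curvature of the metric `L (dx² + dy²)` is `-Δ(log L) / (2 L)`. -/
theorem curvature_conformal {z : ℂ} (hz : z ∈ U) :
    G z (curvature G z 1 Complex.I Complex.I) 1 = -(L z / 2 * Δ (fun y => Real.log (L y)) z) := by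
  have hLpos := fun y hy => conformalFactor_pos hG hL (z := y) hy
  have hLs := fun y hy => contDiffAt_conformalFactor hG hL (z := y) hy
  have hev := hG.eventually_mem hz
  have hlog : ∀ y ∈ U, ContDiffAt ℝ ∞ (fun y => Real.log (L y)) y :=
    fun y hy => (hLs y hy).log (hLpos y hy).ne'
  have hdlog : ∀ u, (fun y => fderiv ℝ L y u / (2 * L y)) =ᶠ[𝓝 z]
      fun y => 1 / 2 * fderiv ℝ (fun y => Real.log (L y)) y u := by
    intro u
    filter_upwards [hev] with y hy
    rw [fderiv.log ((hLs y hy).differentiableAt (by simp)) (hLpos y hy).ne']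
    simp only [smul_apply, smul_eq_mul]
    have := (hLpos y hy).ne'
    field_simp
  have hdd : ∀ u, DifferentiableAt ℝ (fun y => fderiv ℝ L y u / (2 * L y)) z := by
    intro u
    have h1 : DifferentiableAt ℝ (fun y => fderiv ℝ L y u) z :=
      (((hLs z hz).fderiv_right (m := ∞) (by simp)).clm_apply contDiffAt_const).differentiableAt
        (by simp)
    have h2 : DifferentiableAt ℝ (fun y => 2 * L y) z :=
      ((hLs z hz).differentiableAt (by simp)).const_mul 2
    have h3 : 2 * L z ≠ 0 := mul_ne_zero two_ne_zero (hLpos z hz).ne'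
    exact (h1.mul (h2.inv h3)).congr_of_eventuallyEq
      (Eventually.of_forall fun y => div_eq_mul_inv _ _)
  have hΔ : Δ (fun y => Real.log (L y)) z =
      2 * (fderiv ℝ (fun y => fderiv ℝ L y 1 / (2 * L y)) z 1 +
        fderiv ℝ (fun y => fderiv ℝ L y Complex.I / (2 * L y)) z Complex.I) := by
    have h1 : ∀ u, DifferentiableAt ℝ (fun y => fderiv ℝ (fun y => Real.log (L y)) y u) z :=
      fun u => (((hlog z hz).fderiv_right (m := ∞) (by simp)).clm_apply
        contDiffAt_const).differentiableAt (by simp)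
    rw [laplacian_eq_fderiv ((hlog z hz).of_le two_le_smooth), (hdlog 1).fderiv_eq,
      (hdlog Complex.I).fderiv_eq, fderiv_const_mul (h1 _), fderiv_const_mul (h1 _)]
    simp only [smul_apply, smul_eq_mul]
    ring
  set a := fun y => fderiv ℝ L y 1 / (2 * L y) with ha
  set d := fun y => fderiv ℝ L y Complex.I / (2 * L y) with hd
  have e1 : (fun x => christoffel G x Complex.I Complex.I) =ᶠ[𝓝 z]
      fun x => (-a x) • (1 : ℂ) + d x • Complex.I := by
    filter_upwards [hev] with y hy using christoffel_conformal_I_I hG hL hy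
  have e2 : (fun x => christoffel G x 1 Complex.I) =ᶠ[𝓝 z]
      fun x => d x • (1 : ℂ) + a x • Complex.I := by
    filter_upwards [hev] with y hy using christoffel_conformal_one_I hG hL hy
  have had : DifferentiableAt ℝ a z := hdd 1
  have hddz : DifferentiableAt ℝ d z := hdd Complex.I
  have f1 := ((had.hasFDerivAt.neg.smul_const (1 : ℂ)).add
    (hddz.hasFDerivAt.smul_const Complex.I)).fderiv
  have f2 := ((hddz.hasFDerivAt.smul_const (1 : ℂ)).add
    (had.hasFDerivAt.smul_const Complex.I)).fderiv
  have g1 : fderiv ℝ (fun x => christoffel G x Complex.I Complex.I) z 1 =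
      (-(fderiv ℝ a z 1)) • (1 : ℂ) + (fderiv ℝ d z 1) • Complex.I := by
    rw [e1.fderiv_eq]
    refine (congrArg (fun T : ℂ →L[ℝ] ℂ => T 1) f1).trans ?_
    simp
  have g2 : fderiv ℝ (fun x => christoffel G x 1 Complex.I) z Complex.I =
      (fderiv ℝ d z Complex.I) • (1 : ℂ) + (fderiv ℝ a z Complex.I) • Complex.I := by
    rw [e2.fderiv_eq]
    refine (congrArg (fun T : ℂ →L[ℝ] ℂ => T Complex.I) f2).trans ?_
    simp
  have k1 : christoffel G z 1 (christoffel G z Complex.I Complex.I) =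
      christoffel G z Complex.I (christoffel G z 1 Complex.I) := by
    rw [christoffel_conformal_I_I hG hL hz, christoffel_conformal_one_I hG hL hz]
    simp only [christoffel_add_right, christoffel_smul_right]
    rw [hG.christoffel_symm hz Complex.I 1, christoffel_conformal_one_one hG hL hz,
      christoffel_conformal_one_I hG hL hz, christoffel_conformal_I_I hG hL hz]
    module
  rw [curvature, k1, g1, g2, hL z hz, hΔ, add_sub_add_right_eq_sub]
  simp only [inner_sub_left, inner_add_left, inner_smul_left, inner_complex, Complex.one_re,
    Complex.one_im, Complex.I_re, Complex.I_im, conj_trivial]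
  ring

end Metric

variable {b : ℂ → ℂ → ℂ → ℝ} {c : ℝ} (hE : FundamentalEquations G b c U)
  (hL : ∀ z ∈ U, ∀ u v, G z u v = L z * inner ℝ u v)
include hE hL

/-- The Codazzi equation `l_y = m_x + L_y f`, with `f = (l + n) / (2 L)`. -/
theorem codazzi_conformal_I {z : ℂ} (hz : z ∈ U) :
    fderiv ℝ (fun y => b y 1 1) z Complex.I = fderiv ℝ (fun y => b y 1 Complex.I) z 1 +
      fderiv ℝ L z Complex.I * ((b z 1 1 + b z Complex.I Complex.I) / (2 * L z)) := by
  have h1 := hE.codazzi z hz Complex.I 1 1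
  have h2 : (fun y => b y Complex.I 1) =ᶠ[𝓝 z] fun y => b y 1 Complex.I := by
    filter_upwards [hE.metric.eventually_mem hz] with y hy using hE.symm y hy _ _
  rw [h2.fderiv_eq, hE.metric.christoffel_symm hz Complex.I 1,
    christoffel_conformal_one_one hE.metric hL hz, christoffel_conformal_one_I hE.metric hL hz] at h1
  simp only [hE.add_right z hz, hE.smul_right z hz] at h1
  rw [hE.symm z hz Complex.I 1] at h1
  linear_combination h1

/-- The Codazzi equation `n_x = m_y + L_x f`, with `f = (l + n) / (2 L)`. -/
theorem codazzi_conformal_one {z : ℂ} (hz : z ∈ U) :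
    fderiv ℝ (fun y => b y Complex.I Complex.I) z 1 =
      fderiv ℝ (fun y => b y 1 Complex.I) z Complex.I +
      fderiv ℝ L z 1 * ((b z 1 1 + b z Complex.I Complex.I) / (2 * L z)) := by
  have h1 := hE.codazzi z hz 1 Complex.I Complex.I
  rw [christoffel_conformal_I_I hE.metric hL hz, christoffel_conformal_one_I hE.metric hL hz] at h1
  simp only [hE.add_right z hz, hE.smul_right z hz] at h1
  rw [hE.symm z hz Complex.I 1] at h1
  linear_combination h1

/-- The Gauss equation `L Δ (log L) = -2 (c L² + l n - m²)`. -/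
theorem gauss_conformal {z : ℂ} (hz : z ∈ U) :
    L z * Δ (fun y => Real.log (L y)) z =
      -2 * (c * L z ^ 2 + (b z 1 1 * b z Complex.I Complex.I - b z 1 Complex.I ^ 2)) := by
  have h1 := hE.gauss z hz 1 Complex.I
  rw [curvature_conformal hE.metric hL hz, hL z hz, hL z hz, hL z hz] at h1
  simp only [inner_complex, Complex.one_re, Complex.one_im, Complex.I_re, Complex.I_im] at h1
  linear_combination (-2) * h1

end Isothermal

end SurfaceGeometry

end

/-! ### The Hopf differential in isothermal coordinates -/

section

open Filter Topology Bundle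
set_option maxSynthPendingDepth 3

namespace SurfaceGeometry

section HopfDifferential

open Laplacian InnerProductSpace

theorem dbar_congr {Q Q' : ℂ → ℂ} {z : ℂ} (h : Q =ᶠ[𝓝 z] Q') : dbar Q z = dbar Q' z := by
  rw [dbar, dbar, h.fderiv_eq]

theorem dbar_ofReal_add {P R : ℂ → ℝ} {z : ℂ} (hP : DifferentiableAt ℝ P z)
    (hR : DifferentiableAt ℝ R z) :
    DifferentiableAt ℝ (fun y => (P y : ℂ) + Complex.I * (R y : ℂ)) z ∧
    4 * dbar (fun y => (P y : ℂ) + Complex.I * (R y : ℂ)) z =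
      ((2 * (fderiv ℝ P z 1 - fderiv ℝ R z Complex.I) : ℝ) : ℂ) +
        Complex.I * ((2 * (fderiv ℝ P z Complex.I + fderiv ℝ R z 1) : ℝ) : ℂ) := by
  have h1 := (Complex.ofRealCLM.hasFDerivAt.comp z hP.hasFDerivAt).add
    ((Complex.ofRealCLM.hasFDerivAt.comp z hR.hasFDerivAt).const_mul Complex.I)
  have h2 : fderiv ℝ (fun y => (P y : ℂ) + Complex.I * (R y : ℂ)) z = _ := h1.fderiv
  refine ⟨h1.differentiableAt, ?_⟩
  rw [dbar, h2]
  simp only [add_apply, smul_apply, ContinuousLinearMap.comp_apply, Complex.ofRealCLM_apply,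
    smul_eq_mul]
  push_cast
  linear_combination (-2 * (fderiv ℝ R z Complex.I : ℂ)) * (-Complex.I_mul_I)

/-- The Cauchy-Riemann equations, in the form `∂Q/∂z̄ = 0`. -/
theorem differentiableAt_complex_iff_dbar {Q : ℂ → ℂ} {z : ℂ} :
    DifferentiableAt ℂ Q z ↔ DifferentiableAt ℝ Q z ∧ dbar Q z = 0 := by
  rw [differentiableAt_complex_iff_differentiableAt_real, and_congr_right_iff]
  intro _
  rw [dbar, smul_eq_mul]
  constructor
  · intro h
    rw [h]
    linear_combination (1 / 2 * fderiv ℝ Q z 1) * Complex.I_mul_I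
  · intro h
    linear_combination (-2 * Complex.I) * h + (fderiv ℝ Q z Complex.I) * Complex.I_mul_I

/-- The function `f ⟨(l - n) - 2 i m⟩ / 4`, where `l`, `m`, `n` are the coefficients of the second
fundamental form `b` in isothermal coordinates. -/
noncomputable def localHopf (b : ℂ → ℂ → ℂ → ℝ) (f : ℂ → ℝ) (z : ℂ) : ℂ :=
  ((f z * (b z 1 1 - b z Complex.I Complex.I) / 4 : ℝ) : ℂ) +
    Complex.I * ((-(f z * b z 1 Complex.I / 2) : ℝ) : ℂ)

variable {G : ℂ → ℂ →L[ℝ] ℂ →L[ℝ] ℝ} {L : ℂ → ℝ} {U : Set ℂ} {b : ℂ → ℂ → ℂ → ℝ} {c : ℝ}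
  (hE : FundamentalEquations G b c U) (hL : ∀ z ∈ U, ∀ u v, G z u v = L z * inner ℝ u v)
  {f : ℂ → ℝ} (hf : ∀ z ∈ U, 2 * L z * f z = b z 1 1 + b z Complex.I Complex.I)
include hE hL hf

theorem contDiffAt_localMean {z : ℂ} (hz : z ∈ U) : ContDiffAt ℝ ∞ f z := by
  have hpos := fun y hy => conformalFactor_pos hE.metric hL (z := y) hy
  have h1 : ContDiffAt ℝ ∞
      (fun y => (b y 1 1 + b y Complex.I Complex.I) / (2 * L y)) z :=
    ((hE.contDiffAt z hz _ _).add (hE.contDiffAt z hz _ _)).div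
      (contDiffAt_const.mul (contDiffAt_conformalFactor hE.metric hL hz))
      (mul_ne_zero two_ne_zero (hpos z hz).ne')
  refine h1.congr_of_eventuallyEq ?_
  filter_upwards [hE.metric.eventually_mem hz] with y hy
  rw [eq_div_iff (mul_ne_zero two_ne_zero (hpos y hy).ne'), ← hf y hy]
  ring

/-- The Codazzi equations give the `z̄`-derivative of the Hopf differential. -/
theorem dbar_localHopf {z : ℂ} (hz : z ∈ U) :
    DifferentiableAt ℝ (localHopf b f) z ∧
    4 * dbar (localHopf b f) z =
      ((b z 1 1 * fderiv ℝ f z 1 + b z 1 Complex.I * fderiv ℝ f z Complex.I : ℝ) : ℂ) -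
      Complex.I * ((b z 1 Complex.I * fderiv ℝ f z 1 +
        b z Complex.I Complex.I * fderiv ℝ f z Complex.I : ℝ) : ℂ) := by
  have hLne := (conformalFactor_pos hE.metric hL hz).ne'
  have hLd : DifferentiableAt ℝ L z :=
    (contDiffAt_conformalFactor hE.metric hL hz).differentiableAt (by simp)
  have hfd : DifferentiableAt ℝ f z := (contDiffAt_localMean hE hL hf hz).differentiableAt (by simp)
  have hbd : ∀ u v, DifferentiableAt ℝ (fun y => b y u v) z := fun u v =>
    (hE.contDiffAt z hz u v).differentiableAt (by simp)
  have hP : HasFDerivAt (fun y => f y * (b y 1 1 - b y Complex.I Complex.I) / 4) _ z :=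
    (hfd.hasFDerivAt.mul ((hbd 1 1).hasFDerivAt.sub
      (hbd Complex.I Complex.I).hasFDerivAt)).mul_const (4⁻¹ : ℝ)
  have hR : HasFDerivAt (fun y => -(f y * b y 1 Complex.I / 2)) _ z :=
    ((hfd.hasFDerivAt.mul (hbd 1 Complex.I).hasFDerivAt).mul_const (2⁻¹ : ℝ)).neg
  obtain ⟨h1, h2⟩ := dbar_ofReal_add hP.differentiableAt hR.differentiableAt
  refine ⟨h1, h2.trans ?_⟩
  -- differentiate `2 L f = l + n`
  have htr : ∀ u, 2 * (fderiv ℝ L z u * f z + L z * fderiv ℝ f z u) =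
      fderiv ℝ (fun y => b y 1 1) z u + fderiv ℝ (fun y => b y Complex.I Complex.I) z u := by
    intro u
    have e1 : (fun y => 2 * (L y * f y)) =ᶠ[𝓝 z]
        fun y => b y 1 1 + b y Complex.I Complex.I := by
      filter_upwards [hE.metric.eventually_mem hz] with y hy
      rw [← hf y hy, mul_assoc]
    have e2 := congrArg (fun T : ℂ →L[ℝ] ℝ => T u)
      (((hLd.hasFDerivAt.mul hfd.hasFDerivAt).const_mul 2).fderiv.symm.trans
      (e1.fderiv_eq.trans ((hbd 1 1).hasFDerivAt.add
      (hbd Complex.I Complex.I).hasFDerivAt).fderiv))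
    simp only [add_apply, smul_apply, smul_eq_mul] at e2
    linear_combination e2
  have c1 := codazzi_conformal_I hE hL hz
  have c2 := codazzi_conformal_one hE hL hz
  have hfz : (b z 1 1 + b z Complex.I Complex.I) / (2 * L z) = f z := by
    rw [← hf z hz]
    field_simp
  rw [hfz] at c1 c2
  have t1 := htr 1
  have t2 := htr Complex.I
  have hf' := hf z hz
  have hA : 2 * (fderiv ℝ (fun y => f y * (b y 1 1 - b y Complex.I Complex.I) / 4) z 1 -
      fderiv ℝ (fun y => -(f y * b y 1 Complex.I / 2)) z Complex.I) =
      b z 1 1 * fderiv ℝ f z 1 + b z 1 Complex.I * fderiv ℝ f z Complex.I := by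
    rw [hP.fderiv, hR.fderiv]
    simp only [add_apply, sub_apply, smul_apply, neg_apply, smul_eq_mul, Pi.sub_apply]
    linear_combination (-(1 / 2 * f z)) * t1 - f z * c2 + (1 / 2 * fderiv ℝ f z 1) * hf'
  have hB : 2 * (fderiv ℝ (fun y => f y * (b y 1 1 - b y Complex.I Complex.I) / 4) z Complex.I +
      fderiv ℝ (fun y => -(f y * b y 1 Complex.I / 2)) z 1) =
      -(b z 1 Complex.I * fderiv ℝ f z 1 + b z Complex.I Complex.I * fderiv ℝ f z Complex.I) := by
    rw [hP.fderiv, hR.fderiv]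
    simp only [add_apply, sub_apply, smul_apply, neg_apply, smul_eq_mul, Pi.sub_apply]
    linear_combination (1 / 2 * f z) * t2 + f z * c1 - (1 / 2 * fderiv ℝ f z Complex.I) * hf'
  rw [hA, hB]
  push_cast
  ring

variable (hQ : DifferentiableOn ℂ (localHopf b f) U)
include hQ

/-- If the Hopf differential is holomorphic, the second fundamental form annihilates the gradient
of the mean curvature. -/
theorem secondForm_gradient_eq_zero {z : ℂ} (hz : z ∈ U) :
    b z 1 1 * fderiv ℝ f z 1 + b z 1 Complex.I * fderiv ℝ f z Complex.I = 0 ∧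
    b z 1 Complex.I * fderiv ℝ f z 1 + b z Complex.I Complex.I * fderiv ℝ f z Complex.I = 0 := by
  have h1 := (dbar_localHopf hE hL hf hz).2
  have h2 := (differentiableAt_complex_iff_dbar.1
    (hQ.differentiableAt (hE.metric.isOpen.mem_nhds hz))).2
  rw [h2, mul_zero] at h1
  have h3 := congrArg Complex.re h1
  have h4 := congrArg Complex.im h1
  simp only [Complex.zero_re, Complex.zero_im, Complex.sub_re, Complex.sub_im, Complex.mul_re,
    Complex.mul_im, Complex.I_re, Complex.I_im, Complex.ofReal_re, Complex.ofReal_im] at h3 h4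
  constructor <;> linarith

/-- A non-zero gradient in the kernel of the second fundamental form makes the latter degenerate. -/
theorem det_secondForm_eq_zero {z : ℂ} (hz : z ∈ U) (hfz : fderiv ℝ f z ≠ 0) :
    b z 1 1 * b z Complex.I Complex.I - b z 1 Complex.I ^ 2 = 0 := by
  obtain ⟨h1, h2⟩ := secondForm_gradient_eq_zero hE hL hf hQ hz
  by_contra hne
  refine hfz (ext_fderiv_complex ?_ ?_)
  · refine (mul_eq_zero.1 ?_).resolve_left hne
    linear_combination b z Complex.I Complex.I * h1 - b z 1 Complex.I * h2
  · refine (mul_eq_zero.1 ?_).resolve_left hne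
    linear_combination b z 1 1 * h2 - b z 1 Complex.I * h1

/-- Where `df ≠ 0` the identity `l n = m²` gives `|l - n - 2 i m| = |l + n| = 2 L |f|`. -/
theorem norm_localHopf {z : ℂ} (hz : z ∈ U) (hfz : fderiv ℝ f z ≠ 0) :
    ‖localHopf b f z‖ = f z ^ 2 * L z / 2 := by
  have hpos := conformalFactor_pos hE.metric hL hz
  have hdet := det_secondForm_eq_zero hE hL hf hQ hz hfz
  have hf' := hf z hz
  rw [← sq_eq_sq₀ (norm_nonneg _) (by positivity), ← Complex.normSq_eq_norm_sq,
    Complex.normSq_apply, localHopf]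
  simp only [Complex.add_re, Complex.add_im, Complex.mul_re, Complex.mul_im, Complex.I_re,
    Complex.I_im, Complex.ofReal_re, Complex.ofReal_im]
  linear_combination (-(f z ^ 2 / 4)) * hdet -
    (f z ^ 2 / 16) * (2 * L z * f z + b z 1 1 + b z Complex.I Complex.I) * hf'

/-- Where `df ≠ 0` and `f ≠ 0` one has `|Q| = f² L / 2`, and `log |Q|` is harmonic. -/
theorem laplacian_log_mean {z : ℂ} (hz : z ∈ U) (hfz : fderiv ℝ f z ≠ 0) (hf0 : f z ≠ 0) :
    Δ (fun y => Real.log (f y)) z = c * L z := by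
  have hpos := fun y hy => conformalFactor_pos hE.metric hL (z := y) hy
  have hfs := contDiffAt_localMean hE hL hf hz
  have hLs := contDiffAt_conformalFactor hE.metric hL hz
  have hdf : ∀ᶠ y in 𝓝 z, fderiv ℝ f y ≠ 0 :=
    (hfs.fderiv_right (m := ∞) (by simp)).continuousAt.eventually_ne hfz
  have hne : ∀ᶠ y in 𝓝 z, f y ≠ 0 := hfs.continuousAt.eventually_ne hf0
  have hQz : localHopf b f z ≠ 0 := by
    rw [← norm_pos_iff, norm_localHopf hE hL hf hQ hz hfz]
    have := hpos z hz
    positivity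
  have hharm : HarmonicAt (fun y => Real.log ‖localHopf b f y‖) z :=
    (hQ.analyticAt (hE.metric.isOpen.mem_nhds hz)).harmonicAt_log_norm hQz
  have hlogf : ContDiffAt ℝ ∞ (fun y => Real.log (f y)) z := hfs.log hf0
  have hlogL : ContDiffAt ℝ ∞ (fun y => Real.log (L y)) z := hLs.log (hpos z hz).ne'
  -- `log |Q| = 2 log |f| + log L - log 2`; `Real.log` ignores the sign of `f`
  have heq : (fun y => Real.log ‖localHopf b f y‖) =ᶠ[𝓝 z]
      ((fun y => Real.log (f y)) + fun y => Real.log (f y)) +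
        ((fun y => Real.log (L y)) + fun _ => -Real.log 2) := by
    filter_upwards [hE.metric.eventually_mem hz, hdf, hne] with y hy h1 h2
    have := hpos y hy
    rw [norm_localHopf hE hL hf hQ hy h1, Real.log_div (by positivity) (by norm_num),
      Real.log_mul (by positivity) this.ne', Real.log_pow]
    simp only [Pi.add_apply]
    push_cast
    ring
  have h1 := (laplacian_congr_nhds heq).self_of_nhds
  have h2 := hharm.2.self_of_nhds
  have s1 := hlogf.of_le two_le_smooth
  have s2 := hlogL.of_le two_le_smooth
  have s3 : ContDiffAt ℝ 2 (fun _ : ℂ => -Real.log 2) z := contDiffAt_const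
  have k1 := ContDiffAt.laplacian_add
    (f₁ := (fun y => Real.log (f y)) + fun y => Real.log (f y))
    (f₂ := (fun y => Real.log (L y)) + fun _ => -Real.log 2) (s1.add s1) (s2.add s3)
  rw [h2, k1, s1.laplacian_add s1, s2.laplacian_add s3, laplacian_const] at h1
  simp only [Pi.zero_apply, add_zero] at h1
  have h3 := gauss_conformal hE hL hz
  rw [det_secondForm_eq_zero hE hL hf hQ hz hfz] at h3
  refine mul_left_cancel₀ (hpos z hz).ne' ?_
  linear_combination (-(1 / 2 * L z)) * h1 - 1 / 2 * h3

/-- If the Hopf differential is holomorphic, the closure of the set where `df ≠ 0` is open. -/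
theorem eventually_mem_closure_support {p : ℂ} (hp : p ∈ U)
    (hpD : p ∈ closure {z | fderiv ℝ f z ≠ 0}) :
    ∀ᶠ z in 𝓝 p, z ∈ closure {z | fderiv ℝ f z ≠ 0} := by
  have hUo := hE.metric.isOpen
  have hfs := fun z hz => contDiffAt_localMean hE hL hf (z := z) hz
  have hpos := fun y hy => conformalFactor_pos hE.metric hL (z := y) hy
  have hDo : ∀ z ∈ U, fderiv ℝ f z ≠ 0 → ∀ᶠ y in 𝓝 z, fderiv ℝ f y ≠ 0 := fun z hz h =>
    ((hfs z hz).fderiv_right (m := ∞) (by simp)).continuousAt.eventually_ne h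
  rcases (hQ.analyticAt (hUo.mem_nhds hp)).eventually_eq_zero_or_eventually_ne_zero with h0 | h0
  -- `Q` vanishes near `p`: then `|Q| = f² L / 2` forces `f = 0` near a point where `df ≠ 0`
  · exfalso
    obtain ⟨z, hzD, hz0, hzU⟩ := ((mem_closure_iff_frequently.1 hpD).and_eventually
      (h0.eventually_nhds.and (hUo.mem_nhds hp))).exists
    refine hzD ?_
    have h1 : f =ᶠ[𝓝 z] fun _ => 0 := by
      filter_upwards [hDo z hzU hzD, hz0, hUo.mem_nhds hzU] with y h1 h2 h3
      have h4 := norm_localHopf hE hL hf hQ h3 h1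
      rw [h2, norm_zero] at h4
      have h5 := hpos y h3
      by_contra h6
      have : 0 < f y ^ 2 * L y / 2 := by positivity
      exact this.ne h4
    rw [h1.fderiv_eq]
    simp
  -- `Q` has no zero in a punctured disc, and neither has `f`: use `w = log |f|` there
  · rw [eventually_nhdsWithin_iff] at h0
    obtain ⟨r, hr, hball⟩ := Metric.mem_nhds_iff.1 (h0.and (hUo.mem_nhds hp))
    set B := Metric.ball p r \ {p} with hBdef
    have hBo : IsOpen B := Metric.isOpen_ball.sdiff isClosed_singleton
    have hBU : ∀ z ∈ B, z ∈ U := fun z hz => (hball hz.1).2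
    have hf0 : ∀ z ∈ B, f z ≠ 0 := by
      intro z hz h1
      refine (hball hz.1).1 hz.2 ?_
      rw [localHopf, h1]
      simp
    have hdlog : ∀ z ∈ B, (fderiv ℝ (fun y => Real.log (f y)) z ≠ 0 ↔ fderiv ℝ f z ≠ 0) := by
      intro z hz
      rw [fderiv.log ((hfs z (hBU z hz)).differentiableAt (by simp)) (hf0 z hz), Ne, Ne,
        smul_eq_zero, inv_eq_zero, or_iff_right (hf0 z hz)]
    have hne : ∃ z ∈ B, fderiv ℝ (fun y => Real.log (f y)) z ≠ 0 := by
      obtain ⟨y, hyD, hy⟩ := ((mem_closure_iff_frequently.1 hpD).and_eventually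
        (Metric.ball_mem_nhds p hr)).exists
      have h1 : ∀ᶠ x in 𝓝 y, fderiv ℝ f x ≠ 0 ∧ x ∈ Metric.ball p r :=
        (hDo y (hball hy).2 hyD).and (Metric.isOpen_ball.mem_nhds hy)
      obtain ⟨x, hxp, hxD, hxr⟩ := ((mem_closure_iff_frequently.1
        ((dense_compl_singleton p) y)).and_eventually h1).exists
      exact ⟨x, ⟨hxr, hxp⟩, (hdlog x ⟨hxr, hxp⟩).2 hxD⟩
    have key := subset_closure_of_laplacian (w := fun y => Real.log (f y)) (L := L) (c := c) hBo
      (isPreconnected_punctured_ball p r) (fun z hz => (hfs z (hBU z hz)).log (hf0 z hz))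
      (fun z hz => hpos z (hBU z hz))
      (fun z hz => (contDiffAt_conformalFactor hE.metric hL (hBU z hz)).continuousAt)
      (fun z hz h1 => laplacian_log_mean hE hL hf hQ (hBU z hz) ((hdlog z hz).1 h1) (hf0 z hz)) hne
    filter_upwards [Metric.ball_mem_nhds p hr] with z hz
    by_cases hzp : z = p
    · rwa [hzp]
    · have hzB : z ∈ B := ⟨hz, hzp⟩
      rw [mem_closure_iff_frequently]
      refine ((mem_closure_iff_frequently.1 (key hzB)).and_eventually (hBo.mem_nhds hzB)).mono ?_
      rintro y ⟨h1, h2⟩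
      exact (hdlog y h2).1 h1

end HopfDifferential

end SurfaceGeometry

end

/-! ### The complex coordinate of a chart -/

section

open Filter Topology Bundle
set_option maxSynthPendingDepth 3

namespace SurfaceGeometry

section IsothermalChart

variable {M : Type*} [TopologicalSpace M] [ChartedSpace (EuclideanSpace ℝ (Fin 2)) M]

/-- The local parametrization of a surface by the complex coordinate of a chart. -/
noncomputable def complexParam (e : OpenPartialHomeomorph M (EuclideanSpace ℝ (Fin 2))) (z : ℂ) : M :=
  e.symm (toPlane z)

variable [IsManifold (𝓡 2) ∞ M] {e : OpenPartialHomeomorph M (EuclideanSpace ℝ (Fin 2))}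
  (he : e ∈ IsManifold.maximalAtlas (𝓡 2) ∞ M)

omit [ChartedSpace (EuclideanSpace ℝ (Fin 2)) M] [IsManifold (𝓡 2) ∞ M] in
theorem isOpen_preimage_target (e : OpenPartialHomeomorph M (EuclideanSpace ℝ (Fin 2))) :
    IsOpen (toPlane ⁻¹' e.target) :=
  e.open_target.preimage planeEquiv.continuous

omit [ChartedSpace (EuclideanSpace ℝ (Fin 2)) M] [IsManifold (𝓡 2) ∞ M] in
/-- The parametrization is a local homeomorphism, in terms of neighbourhood filters. -/
theorem map_nhds_complexParam {z : ℂ} (hz : toPlane z ∈ e.target) :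
    map (complexParam e) (𝓝 z) = 𝓝 (complexParam e z) := by
  have h1 : map toPlane (𝓝 z) = 𝓝 (toPlane z) := planeEquiv.toHomeomorph.map_nhds_eq z
  rw [complexParam, ← e.symm.map_nhds_eq hz, ← h1, Filter.map_map]
  rfl

include he

omit [IsManifold (𝓡 2) ∞ M] in
theorem contMDiffOn_complexParam :
    ContMDiffOn 𝓘(ℝ, ℂ) (𝓡 2) ∞ (complexParam e) (toPlane ⁻¹' e.target) := by
  have h1 : ContMDiff 𝓘(ℝ, ℂ) (𝓡 2) ∞ toPlane :=
    contMDiff_iff_contDiff.2 (planeEquiv : ℂ →L[ℝ] EuclideanSpace ℝ (Fin 2)).contDiff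
  exact (contMDiffOn_symm_of_mem_maximalAtlas he).comp h1.contMDiffOn fun z hz => hz

theorem differential_mfderiv_complexParam {z : ℂ} (hz : toPlane z ∈ e.target) (u : ℂ) :
    differential e (complexParam e z) (mfderiv 𝓘(ℝ, ℂ) (𝓡 2) (complexParam e) z u) = toPlane u := by
  have h1 := ((contMDiffOn_complexParam he).contMDiffAt
    ((isOpen_preimage_target e).mem_nhds hz)).mdifferentiableAt (by simp)
  have h2 := (contMDiffAt_of_mem_maximalAtlas he (e.map_target hz)).mdifferentiableAt (by simp)
  have h3 := mfderiv_comp (I := 𝓘(ℝ, ℂ)) (I' := 𝓡 2) (I'' := 𝓡 2) z (f := complexParam e) (g := e)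
    h2 h1
  have h4 : e ∘ complexParam e =ᶠ[𝓝 z] planeEquiv := by
    filter_upwards [(isOpen_preimage_target e).mem_nhds hz] with y hy
    exact e.right_inv hy
  rw [h4.mfderiv_eq, mfderiv_eq_fderiv] at h3
  refine (congrArg (fun L : ℂ →L[ℝ] EuclideanSpace ℝ (Fin 2) => L u) h3).symm.trans ?_
  exact congrArg (fun L : ℂ →L[ℝ] EuclideanSpace ℝ (Fin 2) => L u)
    (planeEquiv : ℂ →L[ℝ] EuclideanSpace ℝ (Fin 2)).fderiv

theorem isInvertible_differential {q : M} (hq : q ∈ e.source) :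
    (differential (E := EuclideanSpace ℝ (Fin 2)) e q).IsInvertible :=
  ⟨(mdifferentiable_of_mem_maximalAtlas he).mfderiv hq, rfl⟩

theorem mfderiv_complexParam {z : ℂ} (hz : toPlane z ∈ e.target) (u : ℂ) :
    mfderiv 𝓘(ℝ, ℂ) (𝓡 2) (complexParam e) z u =
      (differential e (complexParam e z)).inverse (toPlane u) := by
  rw [← differential_mfderiv_complexParam he hz u]
  obtain ⟨L, hL⟩ := isInvertible_differential (q := complexParam e z) he (e.map_target hz)
  rw [← hL]
  simp

theorem mfderiv_complexParam_one {z : ℂ} (hz : toPlane z ∈ e.target) :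
    mfderiv 𝓘(ℝ, ℂ) (𝓡 2) (complexParam e) z (1 : ℂ) = coordVector e 0 (complexParam e z) := by
  rw [coordVector, ← planeEquiv_one]
  exact mfderiv_complexParam he hz 1

theorem mfderiv_complexParam_I {z : ℂ} (hz : toPlane z ∈ e.target) :
    mfderiv 𝓘(ℝ, ℂ) (𝓡 2) (complexParam e) z Complex.I = coordVector e 1 (complexParam e z) := by
  rw [coordVector, ← planeEquiv_I]
  exact mfderiv_complexParam he hz Complex.I

theorem bijective_mfderiv_complexParam {z : ℂ} (hz : toPlane z ∈ e.target) :
    Function.Bijective (mfderiv 𝓘(ℝ, ℂ) (𝓡 2) (complexParam e) z) := by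
  constructor
  · intro u v huv
    have h1 := differential_mfderiv_complexParam he hz u
    rw [huv, differential_mfderiv_complexParam he hz v] at h1
    exact (planeEquiv.injective h1).symm
  · intro w
    obtain ⟨u, hu⟩ := planeEquiv.surjective (differential e (complexParam e z) w)
    refine ⟨u, (mdifferentiable_of_mem_maximalAtlas he).mfderiv_injective (e.map_target hz) ?_⟩
    exact (differential_mfderiv_complexParam he hz u).trans hu

theorem paramMetric_complexParam
    {g : ∀ q : M, TangentSpace (𝓡 2) q →L[ℝ] TangentSpace (𝓡 2) q →L[ℝ] ℝ} {lam : M → ℝ}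
    (hg : IsIsothermal g e lam) {z : ℂ} (hz : toPlane z ∈ e.target) (u v : ℂ) :
    paramMetric g (complexParam e) z u v = lam (complexParam e z) ^ 2 * inner ℝ u v := by
  rw [paramMetric_apply, (hg (complexParam e z) (e.map_target hz)).2]
  congr 1
  rw [← planeEquiv.inner_map_map]
  exact congrArg₂ (fun a b : EuclideanSpace ℝ (Fin 2) => (inner ℝ a b : ℝ))
    (differential_mfderiv_complexParam he hz u) (differential_mfderiv_complexParam he hz v)

end IsothermalChart

end SurfaceGeometry

end

/-! ### The function `Q` in an isothermal chart -/

section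

open Filter Topology Bundle
set_option maxSynthPendingDepth 3

namespace SurfaceGeometry

section ScalarFunction

variable {M : Type*} [TopologicalSpace M] [ChartedSpace (EuclideanSpace ℝ (Fin 2)) M]
  [IsManifold (𝓡 2) ∞ M] {e : OpenPartialHomeomorph M (EuclideanSpace ℝ (Fin 2))}
  (he : e ∈ IsManifold.maximalAtlas (𝓡 2) ∞ M)
include he

theorem fderiv_complexParam {f : M → ℝ} (hf : ContMDiff (𝓡 2) 𝓘(ℝ) ∞ f) {z : ℂ}
    (hz : toPlane z ∈ e.target) (u : ℂ) :
    fderiv ℝ (fun y => f (complexParam e y)) z u =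
      differential f (complexParam e z) (mfderiv 𝓘(ℝ, ℂ) (𝓡 2) (complexParam e) z u) := by
  have h1 := ((contMDiffOn_complexParam he).contMDiffAt
    ((isOpen_preimage_target e).mem_nhds hz)).mdifferentiableAt (by simp)
  have h3 := mfderiv_comp (I := 𝓘(ℝ, ℂ)) (I' := 𝓡 2) (I'' := 𝓘(ℝ)) z (f := complexParam e) (g := f)
    ((hf _).mdifferentiableAt (by simp)) h1
  rw [mfderiv_eq_fderiv] at h3
  exact congrArg (fun L : ℂ →L[ℝ] ℝ => L u) h3

theorem fderiv_complexParam_ne_zero_iff {f : M → ℝ} (hf : ContMDiff (𝓡 2) 𝓘(ℝ) ∞ f) {z : ℂ}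
    (hz : toPlane z ∈ e.target) :
    fderiv ℝ (fun y => f (complexParam e y)) z ≠ 0 ↔
      differential (E := EuclideanSpace ℝ (Fin 2)) f (complexParam e z) ≠ 0 := by
  refine not_congr ⟨fun h0 => ?_, fun h0 => ?_⟩
  · refine ContinuousLinearMap.ext fun w => ?_
    obtain ⟨u, rfl⟩ := (bijective_mfderiv_complexParam he hz).2 w
    rw [← fderiv_complexParam he hf hz u, h0]
    rfl
  · refine ContinuousLinearMap.ext fun u => ?_
    rw [fderiv_complexParam he hf hz u, h0]
    rfl

end ScalarFunction

namespace IsImmersedSurface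

variable {F : Type*} [NormedAddCommGroup F] [NormedSpace ℝ F] [FiniteDimensional ℝ F]
  {M : Type*} [TopologicalSpace M] [ChartedSpace (EuclideanSpace ℝ (Fin 2)) M]
  [IsManifold (𝓡 2) ∞ M]
  {N : Type*} [TopologicalSpace N] [ChartedSpace F N] [IsManifold 𝓘(ℝ, F) ∞ N]
  {h : ContMDiffRiemannianMetric 𝓘(ℝ, F) ∞ F (fun y : N => TangentSpace 𝓘(ℝ, F) y)}
  {c : ℝ} {φ : M → N} {η : ∀ q : M, TangentSpace 𝓘(ℝ, F) (φ q)} (hS : IsImmersedSurface h c φ η)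
  {e : OpenPartialHomeomorph M (EuclideanSpace ℝ (Fin 2))}
  (he : e ∈ IsManifold.maximalAtlas (𝓡 2) ∞ M)
include hS he

theorem fundamentalEquations_complexParam :
    FundamentalEquations
      (paramMetric (inducedMetric (E := EuclideanSpace ℝ (Fin 2)) h.inner φ) (complexParam e))
      (paramSecondForm (E := EuclideanSpace ℝ (Fin 2)) h.inner φ η (complexParam e)) c
      (toPlane ⁻¹' e.target) :=
  hS.fundamentalEquations Complex.finrank_real_complex (isOpen_preimage_target e)
    (contMDiffOn_complexParam he) fun _ hz => (bijective_mfderiv_complexParam he hz).1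

variable {lam : M → ℝ} (hiso : IsIsothermal (inducedMetric h.inner φ) e lam)
include hiso

theorem det_meanCurvature_isothermal {z : ℂ} (hz : toPlane z ∈ e.target) {b : ℂ → ℂ → ℝ}
    (hb : b = paramSecondForm (E := EuclideanSpace ℝ (Fin 2)) h.inner φ η (complexParam e) z) :
    LinearMap.det (shapeOperator (E := EuclideanSpace ℝ (Fin 2)) h.inner φ η (complexParam e z)) *
        (lam (complexParam e z) ^ 2) ^ 2 = b 1 1 * b Complex.I Complex.I - b 1 Complex.I ^ 2 ∧
      2 * lam (complexParam e z) ^ 2 * meanCurvature h.inner φ η (complexParam e z) =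
        b 1 1 + b Complex.I Complex.I := by
  have hpos := (hiso (complexParam e z) (e.map_target hz)).1
  obtain ⟨h1, h2⟩ := det_meanCurvature_param (h := h.inner) h.pos hS.injective η
    (bijective_mfderiv_complexParam he hz) Complex.basisOneI rfl hb
  have h3 : b Complex.I 1 = b 1 Complex.I := by
    rw [hb]
    exact (hS.fundamentalEquations_complexParam he).symm z hz _ _
  simp only [paramMetric_complexParam he hiso hz, inner_complex, Complex.coe_basisOneI,
    Matrix.cons_val_zero, Matrix.cons_val_one, Complex.one_re, Complex.one_im, Complex.I_re,
    Complex.I_im, h3] at h1 h2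
  constructor
  · linear_combination h1
  · refine mul_left_cancel₀ (pow_pos hpos 2).ne' ?_
    linear_combination h2

omit hiso in
/-- The function `Q` of a chart is `f (l - n - 2 i m) / 4`, as `A_H = f A`. -/
theorem hopfQ_eq_localHopf {z : ℂ} (hz : toPlane z ∈ e.target) :
    hopfQ h.inner φ η e z =
      localHopf (paramSecondForm (E := EuclideanSpace ℝ (Fin 2)) h.inner φ η (complexParam e))
        (fun y => meanCurvature h.inner φ η (complexParam e y)) z := by
  have key : ∀ X Y : TangentSpace (𝓡 2) (complexParam e z),
      inducedMetric h.inner φ (complexParam e z)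
        (shapeOperator h.inner φ (meanCurvatureVector h.inner φ η) (complexParam e z) X) Y =
      meanCurvature h.inner φ η (complexParam e z) *
        secondFundamentalForm h.inner φ η (complexParam e z) X Y := by
    intro X Y
    rw [inducedMetric_shapeOperator h.pos hS.injective,
      hS.secondFundamentalForm_meanCurvatureVector]
  have hE := hS.fundamentalEquations_complexParam he
  have hb : ∀ (r t : ℝ) (u v : ℂ), secondFundamentalForm h.inner φ η (complexParam e z)
      (r • mfderiv 𝓘(ℝ, ℂ) (𝓡 2) (complexParam e) z u)
      (t • mfderiv 𝓘(ℝ, ℂ) (𝓡 2) (complexParam e) z v) = r * t *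
      paramSecondForm (E := EuclideanSpace ℝ (Fin 2)) h.inner φ η (complexParam e) z u v := by
    intro r t u v
    have h1 := hE.smul_right z hz t (r • u) v
    rw [hE.symm z hz (r • u) v, hE.smul_right z hz r v u, hE.symm z hz v u] at h1
    rw [mul_comm r t, mul_assoc, ← h1]
    have h2 := (mfderiv 𝓘(ℝ, ℂ) (𝓡 2) (complexParam e) z).map_smul r u
    have h3 := (mfderiv 𝓘(ℝ, ℂ) (𝓡 2) (complexParam e) z).map_smul t v
    exact congrArg₂ (fun X Y : TangentSpace (𝓡 2) (complexParam e z) =>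
      secondFundamentalForm h.inner φ η (complexParam e z) X Y) h2.symm h3.symm
  have h1 : hopfQ h.inner φ η e z = complexBilin (fun X Y : TangentSpace (𝓡 2) (complexParam e z) =>
      inducedMetric h.inner φ (complexParam e z)
        (shapeOperator h.inner φ (meanCurvatureVector h.inner φ η) (complexParam e z) X) Y)
      ((1 / 2 : ℝ) • coordVector e 0 (complexParam e z))
      (-((1 / 2 : ℝ) • coordVector e 1 (complexParam e z)))
      ((1 / 2 : ℝ) • coordVector e 0 (complexParam e z))
      (-((1 / 2 : ℝ) • coordVector e 1 (complexParam e z))) := rfl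
  rw [h1, ← neg_smul, ← mfderiv_complexParam_one he hz, ← mfderiv_complexParam_I he hz]
  simp only [complexBilin, key, hb, localHopf]
  rw [hE.symm z hz Complex.I 1]
  push_cast
  ring

/-- The formula for `∂Q/∂z̄`. -/
theorem dbar_hopfQ {z : ℂ} (hz : toPlane z ∈ e.target) :
    DifferentiableAt ℝ (hopfQ h.inner φ η e) z ∧
    4 * dbar (hopfQ h.inner φ η e) z = ((lam (complexParam e z) ^ 2 : ℝ) : ℂ) *
      (((inducedMetric h.inner φ (complexParam e z) (shapeOperator h.inner φ η (complexParam e z)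
          (gradient (inducedMetric h.inner φ) (meanCurvature h.inner φ η) (complexParam e z)))
          (coordVector e 0 (complexParam e z)) : ℝ) : ℂ) -
        Complex.I * ((inducedMetric h.inner φ (complexParam e z)
          (shapeOperator h.inner φ η (complexParam e z)
          (gradient (inducedMetric h.inner φ) (meanCurvature h.inner φ η) (complexParam e z)))
          (coordVector e 1 (complexParam e z)) : ℝ) : ℂ)) := by
  have hE := hS.fundamentalEquations_complexParam he
  have hL : ∀ y ∈ toPlane ⁻¹' e.target, ∀ u v, _ = _ := fun y hy u v =>
    paramMetric_complexParam he hiso hy u v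
  have hd := dbar_localHopf hE hL (fun y hy => (hS.det_meanCurvature_isothermal he hiso hy rfl).2) hz
  have hev : hopfQ h.inner φ η e =ᶠ[𝓝 z] localHopf
      (paramSecondForm (E := EuclideanSpace ℝ (Fin 2)) h.inner φ η (complexParam e))
      (fun y => meanCurvature h.inner φ η (complexParam e y)) := by
    filter_upwards [(isOpen_preimage_target e).mem_nhds hz] with y hy
    exact hS.hopfQ_eq_localHopf he hy
  refine ⟨hev.differentiableAt_iff.2 hd.1, ?_⟩
  rw [dbar_congr hev, hd.2]
  -- `w` is the coordinate expression of the gradient of the mean curvature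
  obtain ⟨w, hw⟩ : ∃ w : ℂ, mfderiv 𝓘(ℝ, ℂ) (𝓡 2) (complexParam e) z w =
      gradient (inducedMetric h.inner φ) (meanCurvature h.inner φ η) (complexParam e z) :=
    (bijective_mfderiv_complexParam he hz).2 _
  have hgrad : ∀ u : ℂ, lam (complexParam e z) ^ 2 * inner ℝ w u =
      fderiv ℝ (fun y => meanCurvature h.inner φ η (complexParam e y)) z u := by
    intro u
    rw [fderiv_complexParam he hS.contMDiff_meanCurvature hz, ← hL z hz w u,
      ← inducedMetric_gradient h.pos hS.injective, ← hw]
    rfl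
  have hb : ∀ u : ℂ, inducedMetric h.inner φ (complexParam e z)
      (shapeOperator h.inner φ η (complexParam e z)
        (gradient (inducedMetric h.inner φ) (meanCurvature h.inner φ η) (complexParam e z)))
      (mfderiv 𝓘(ℝ, ℂ) (𝓡 2) (complexParam e) z u) =
      w.re * paramSecondForm (E := EuclideanSpace ℝ (Fin 2)) h.inner φ η (complexParam e) z u 1 +
      w.im * paramSecondForm (E := EuclideanSpace ℝ (Fin 2)) h.inner φ η (complexParam e) z u
        Complex.I := by
    intro u
    rw [inducedMetric_shapeOperator h.pos hS.injective, ← hw, ← hE.smul_right z hz,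
      ← hE.smul_right z hz, ← hE.add_right z hz, hE.symm z hz]
    have : w.re • (1 : ℂ) + w.im • Complex.I = w := by simp
    rw [this]
    rfl
  rw [← mfderiv_complexParam_one he hz, ← mfderiv_complexParam_I he hz, hb, hb,
    ← hgrad, ← hgrad, hE.symm z hz Complex.I 1]
  simp only [inner_complex, Complex.one_re, Complex.one_im, Complex.I_re, Complex.I_im]
  push_cast
  ring

end IsImmersedSurface

end SurfaceGeometry

end

/-! ### Existence of positively oriented isothermal charts -/

section

open Filter Topology Bundle
set_option maxSynthPendingDepth 3

namespace SurfaceGeometry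

section ExistsChart

variable {M : Type*} [TopologicalSpace M] [ChartedSpace (EuclideanSpace ℝ (Fin 2)) M]

theorem trans_mem_maximalAtlas {e : OpenPartialHomeomorph M (EuclideanSpace ℝ (Fin 2))}
    (he : e ∈ IsManifold.maximalAtlas (𝓡 2) ∞ M)
    {ψ : OpenPartialHomeomorph (EuclideanSpace ℝ (Fin 2)) (EuclideanSpace ℝ (Fin 2))}
    (hψ : ψ ∈ contDiffGroupoid ∞ (𝓡 2)) : e.trans ψ ∈ IsManifold.maximalAtlas (𝓡 2) ∞ M := by
  rw [IsManifold.maximalAtlas, mem_maximalAtlas_iff] at he ⊢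
  intro e' he'
  obtain ⟨h1, h2⟩ := he e' he'
  refine ⟨?_, ?_⟩
  · rw [OpenPartialHomeomorph.trans_symm_eq_symm_trans_symm, OpenPartialHomeomorph.trans_assoc]
    exact StructureGroupoid.trans _ (StructureGroupoid.symm _ hψ) h1
  · rw [← OpenPartialHomeomorph.trans_assoc]
    exact StructureGroupoid.trans _ h2 hψ

/-- The inverse function theorem for a local diffeomorphism of the plane, with the domain of the
inverse adapted to a given neighbourhood. -/
theorem exists_planeDiffeo {w : EuclideanSpace ℝ (Fin 2) → EuclideanSpace ℝ (Fin 2)}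
    (hw : ContDiff ℝ ∞ w) {x₀ : EuclideanSpace ℝ (Fin 2)} {V : Set (EuclideanSpace ℝ (Fin 2))}
    (hV : V ∈ 𝓝 x₀) (hdet : ∀ x ∈ V, (fderiv ℝ w x).det ≠ 0) :
    ∃ ψ : OpenPartialHomeomorph (EuclideanSpace ℝ (Fin 2)) (EuclideanSpace ℝ (Fin 2)),
      ⇑ψ = w ∧ x₀ ∈ ψ.source ∧ ψ.source ⊆ V ∧ ψ ∈ contDiffGroupoid ∞ (𝓡 2) := by
  have hd : ∀ x (hx : x ∈ V), HasFDerivAt w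
      (((fderiv ℝ w x).toContinuousLinearEquivOfDetNeZero (hdet x hx) :
        EuclideanSpace ℝ (Fin 2) ≃L[ℝ] EuclideanSpace ℝ (Fin 2)) :
        EuclideanSpace ℝ (Fin 2) →L[ℝ] EuclideanSpace ℝ (Fin 2)) x := by
    intro x hx
    exact (hw.differentiable (by simp) x).hasFDerivAt
  let ψ₀ := hw.contDiffAt.toOpenPartialHomeomorph w (hd x₀ (mem_of_mem_nhds hV)) (by simp)
  have hcoe : ∀ x, ψ₀ x = w x := fun x => rfl
  refine ⟨ψ₀.restr V, rfl, ?_, ?_, ?_⟩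
  · rw [OpenPartialHomeomorph.restr_source]
    exact ⟨hw.contDiffAt.mem_toOpenPartialHomeomorph_source _ _, mem_interior_iff_mem_nhds.2 hV⟩
  · rw [OpenPartialHomeomorph.restr_source]
    exact fun x hx => interior_subset hx.2
  · have hsub : ∀ x ∈ (ψ₀.restr V).source, x ∈ V := by
      rw [OpenPartialHomeomorph.restr_source]
      exact fun x hx => interior_subset hx.2
    rw [contDiffGroupoid, mem_groupoid_of_pregroupoid]
    simp only [contDiffPregroupoid, modelWithCornersSelf_coe,
      modelWithCornersSelf_coe_symm, Function.comp_id, Function.id_comp, Set.preimage_id,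
      Set.range_id, Set.inter_univ]
    refine ⟨hw.contDiffOn, fun y hy => ContDiffAt.contDiffWithinAt ?_⟩
    exact (ψ₀.restr V).contDiffAt_symm hy (hd _ (hsub _ ((ψ₀.restr V).map_target hy)))
      hw.contDiffAt

variable [IsManifold (𝓡 2) ∞ M]

/-- Existence of positively oriented isothermal coordinates. -/
theorem exists_isothermal_chart (o : SurfaceOrientation M)
    (g : ∀ q : M, TangentSpace (𝓡 2) q →L[ℝ] TangentSpace (𝓡 2) q →L[ℝ] ℝ)
    (hg : ∀ e ∈ IsManifold.maximalAtlas (𝓡 2) ∞ M, IsMetricOn (paramMetric g e.symm) e.target)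
    (p : M) :
    ∃ (e : OpenPartialHomeomorph M (EuclideanSpace ℝ (Fin 2))) (lam : M → ℝ),
      p ∈ e.source ∧ IsPositiveChart o e ∧ IsIsothermal g e lam := by
  obtain ⟨e₀, he₀, hp⟩ := o.cover p
  have hmax := o.subset_maximalAtlas he₀
  have hG := hg e₀ hmax
  have hmem := hG.isOpen.mem_nhds (e₀.map_source hp)
  obtain ⟨w, lam, hw, hev⟩ := exists_isothermal_plane (x₀ := e₀ p)
    (Filter.eventually_of_mem hmem fun y hy => hG.contDiffAt y hy)
    (Filter.eventually_of_mem hmem fun y hy => hG.symm y hy)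
    (Filter.eventually_of_mem hmem fun y hy => hG.pos y hy)
  obtain ⟨ψ, rfl, hψ, hsub, hgr⟩ := exists_planeDiffeo hw hev fun x hx => hx.2.1.ne'
  have hψd : Differentiable ℝ ψ := hw.differentiable (by simp)
  refine ⟨e₀.trans ψ, fun q => lam (e₀ q), ?_, ⟨trans_mem_maximalAtlas hmax hgr, ?_⟩, ?_⟩
  · rw [OpenPartialHomeomorph.trans_source]
    exact ⟨hp, hψ⟩
  · intro e' he' q hq
    rw [OpenPartialHomeomorph.trans_source] at hq
    obtain ⟨⟨hq1, hq2 : e₀ q ∈ ψ.source⟩, hq'⟩ := hq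
    have hdet := (hsub hq2).2.1
    have h1 := o.jacobian_pos e₀ he₀ e' he' q ⟨hq1, hq'⟩
    -- the Jacobian would vanish at a point of non-differentiability
    have hd1 : DifferentiableAt ℝ (e' ∘ e₀.symm) (e₀ q) := by
      by_contra hnd
      rw [fderiv_zero_of_not_differentiableAt hnd] at h1
      simp [ContinuousLinearMap.det] at h1
    let T := (fderiv ℝ ψ (e₀ q)).toContinuousLinearEquivOfDetNeZero hdet.ne'
    have hT : HasFDerivAt ψ (T : EuclideanSpace ℝ (Fin 2) →L[ℝ] EuclideanSpace ℝ (Fin 2))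
        (ψ.symm (ψ (e₀ q))) := by
      rw [ψ.left_inv hq2]
      exact (hψd _).hasFDerivAt
    have h2 := ψ.hasFDerivAt_symm (ψ.map_source hq2) hT
    have hd1' : HasFDerivAt (e' ∘ e₀.symm) (fderiv ℝ (e' ∘ e₀.symm) (e₀ q))
        (ψ.symm (ψ (e₀ q))) := by
      rw [ψ.left_inv hq2]
      exact hd1.hasFDerivAt
    have h3 := (hd1'.comp _ h2).fderiv
    have h4 : (e' ∘ (e₀.trans ψ).symm) = (e' ∘ e₀.symm) ∘ ψ.symm := rfl
    rw [h4, OpenPartialHomeomorph.coe_trans, Function.comp_apply, h3]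
    have h5 : (T.symm : EuclideanSpace ℝ (Fin 2) →L[ℝ] EuclideanSpace ℝ (Fin 2)).det *
        (fderiv ℝ ψ (e₀ q)).det = 1 := by
      have : ((T.symm : EuclideanSpace ℝ (Fin 2) →L[ℝ] EuclideanSpace ℝ (Fin 2)) :
          EuclideanSpace ℝ (Fin 2) →ₗ[ℝ] EuclideanSpace ℝ (Fin 2)) ∘ₗ
          (fderiv ℝ ψ (e₀ q) : EuclideanSpace ℝ (Fin 2) →ₗ[ℝ] EuclideanSpace ℝ (Fin 2)) =
          LinearMap.id := LinearMap.ext fun x => T.symm_apply_apply x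
      rw [ContinuousLinearMap.det, ContinuousLinearMap.det, ← LinearMap.det_comp, this,
        LinearMap.det_id]
    have h6 : 0 < (T.symm : EuclideanSpace ℝ (Fin 2) →L[ℝ] EuclideanSpace ℝ (Fin 2)).det :=
      pos_of_mul_pos_left (h5 ▸ one_pos) hdet.le
    have h7 := mul_pos h1 h6
    rw [ContinuousLinearMap.det, ContinuousLinearMap.det, ← LinearMap.det_comp] at h7
    exact h7
  · intro q hq
    rw [OpenPartialHomeomorph.trans_source] at hq
    obtain ⟨hq1, hq2 : e₀ q ∈ ψ.source⟩ := hq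
    obtain ⟨hl, -, hin⟩ := hsub hq2
    refine ⟨hl, fun X Y => ?_⟩
    have h1 : ∀ X, differential (E := EuclideanSpace ℝ (Fin 2)) (e₀.trans ψ) q X =
        fderiv ℝ ψ (e₀ q) (differential e₀ q X) := by
      intro X
      have h2 := mfderiv_comp (I := 𝓡 2) (I' := 𝓡 2) (I'' := 𝓡 2) q (f := e₀) (g := ψ)
        (hψd _).mdifferentiableAt
        ((contMDiffAt_of_mem_maximalAtlas hmax hq1).mdifferentiableAt (by simp))
      rw [mfderiv_eq_fderiv] at h2
      exact congrArg (fun L : EuclideanSpace ℝ (Fin 2) →L[ℝ] EuclideanSpace ℝ (Fin 2) => L X) h2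
    rw [h1, h1, ← hin, paramMetric_symm_apply g hmax hq1]

end ExistsChart

end SurfaceGeometry

end

/-! ### From charts to the surface -/

section

open Filter Topology Bundle
set_option maxSynthPendingDepth 3

namespace SurfaceGeometry

theorem exists_complexParam_eq {M : Type*} [TopologicalSpace M]
    {e : OpenPartialHomeomorph M (EuclideanSpace ℝ (Fin 2))} {p : M} (hp : p ∈ e.source) :
    ∃ z, toPlane z ∈ e.target ∧ complexParam e z = p := by
  obtain ⟨z, hz⟩ := planeEquiv.surjective (e p)
  have hz' : toPlane z = e p := hz
  refine ⟨z, ?_, ?_⟩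
  · rw [hz']
    exact e.map_source hp
  · rw [complexParam, hz', e.left_inv hp]

section ScalarFunction

variable {M : Type*} [TopologicalSpace M] [ChartedSpace (EuclideanSpace ℝ (Fin 2)) M]
  [IsManifold (𝓡 2) ∞ M]

theorem mem_closure_differential_ne_zero_iff {e : OpenPartialHomeomorph M (EuclideanSpace ℝ (Fin 2))}
    (he : e ∈ IsManifold.maximalAtlas (𝓡 2) ∞ M)
    {f : M → ℝ} (hf : ContMDiff (𝓡 2) 𝓘(ℝ) ∞ f) {z : ℂ} (hz : toPlane z ∈ e.target) :
    complexParam e z ∈ closure {q | differential (E := EuclideanSpace ℝ (Fin 2)) f q ≠ 0} ↔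
      z ∈ closure {y | fderiv ℝ (fun x => f (complexParam e x)) y ≠ 0} := by
  rw [mem_closure_iff_frequently, mem_closure_iff_frequently, ← map_nhds_complexParam hz,
    frequently_map]
  refine frequently_congr ?_
  filter_upwards [(isOpen_preimage_target e).mem_nhds hz] with y hy
  exact (fderiv_complexParam_ne_zero_iff he hf hy).symm

/-- On a connected manifold a function with vanishing differential is constant. -/
theorem exists_eq_const_of_differential_eq_zero [ConnectedSpace M] {f : M → ℝ}
    (hf : ContMDiff (𝓡 2) 𝓘(ℝ) ∞ f)
    (h0 : ∀ p, differential (E := EuclideanSpace ℝ (Fin 2)) f p = 0) : ∃ k, ∀ p, f p = k := by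
  have hloc : IsLocallyConstant f := by
    rw [IsLocallyConstant.iff_eventually_eq]
    intro p
    obtain ⟨e, he, hp⟩ : ∃ e ∈ IsManifold.maximalAtlas (𝓡 2) ∞ M, p ∈ e.source :=
      ⟨_, IsManifold.chart_mem_maximalAtlas p, mem_chart_source (EuclideanSpace ℝ (Fin 2)) p⟩
    obtain ⟨z, hz, rfl⟩ := exists_complexParam_eq hp
    rw [← map_nhds_complexParam hz, eventually_map]
    obtain ⟨r, hr, hball⟩ := Metric.isOpen_iff.1 (isOpen_preimage_target e) z hz
    filter_upwards [Metric.ball_mem_nhds z hr] with y hy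
    refine Metric.isOpen_ball.is_const_of_fderiv_eq_zero (𝕜 := ℝ)
      (f := fun x => f (complexParam e x)) (convex_ball z r).isPreconnected ?_ ?_ hy
      (Metric.mem_ball_self hr)
    · intro x hx
      have h1 := (contMDiffOn_complexParam he).contMDiffAt
        ((isOpen_preimage_target e).mem_nhds (hball hx))
      have h2 := (hf.contMDiffAt.comp x h1).mdifferentiableAt (by simp)
      exact h2.differentiableAt.differentiableWithinAt
    · intro x hx
      by_contra hne
      exact (fderiv_complexParam_ne_zero_iff he hf (hball hx)).1 hne (h0 _)
  obtain ⟨p⟩ := ‹ConnectedSpace M›.toNonempty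
  exact ⟨f p, fun q => hloc.apply_eq_of_preconnectedSpace q p⟩

end ScalarFunction

namespace IsImmersedSurface

variable {F : Type*} [NormedAddCommGroup F] [NormedSpace ℝ F] [FiniteDimensional ℝ F]
  {M : Type*} [TopologicalSpace M] [ChartedSpace (EuclideanSpace ℝ (Fin 2)) M]
  [IsManifold (𝓡 2) ∞ M]
  {N : Type*} [TopologicalSpace N] [ChartedSpace F N] [IsManifold 𝓘(ℝ, F) ∞ N]
  {h : ContMDiffRiemannianMetric 𝓘(ℝ, F) ∞ F (fun y : N => TangentSpace 𝓘(ℝ, F) y)}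
  {c : ℝ} {φ : M → N} {η : ∀ q : M, TangentSpace 𝓘(ℝ, F) (φ q)} (hS : IsImmersedSurface h c φ η)
include hS

section Chart

variable {e : OpenPartialHomeomorph M (EuclideanSpace ℝ (Fin 2))}
  (he : e ∈ IsManifold.maximalAtlas (𝓡 2) ∞ M)
  {lam : M → ℝ} (hiso : IsIsothermal (inducedMetric h.inner φ) e lam)
  (hQ : DifferentiableOn ℂ (hopfQ h.inner φ η e) (toPlane ⁻¹' e.target))
  {p : M} (hp : p ∈ e.source)
  (hpD : p ∈ closure {q | differential (E := EuclideanSpace ℝ (Fin 2))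
    (meanCurvature h.inner φ η) q ≠ 0})
include he hiso hQ hp hpD

/-- If `Q` is holomorphic, the closure of the set where `df ≠ 0` is a neighbourhood of each of its
points. -/
theorem eventually_mem_closure_differential_ne_zero :
    ∀ᶠ q in 𝓝 p, q ∈ closure {q | differential (E := EuclideanSpace ℝ (Fin 2))
      (meanCurvature h.inner φ η) q ≠ 0} := by
  obtain ⟨z, hz, rfl⟩ := exists_complexParam_eq hp
  have hQ' : DifferentiableOn ℂ (localHopf (paramSecondForm (E := EuclideanSpace ℝ (Fin 2))
      h.inner φ η (complexParam e)) fun y => meanCurvature h.inner φ η (complexParam e y))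
      (toPlane ⁻¹' e.target) :=
    hQ.congr fun y hy => (hS.hopfQ_eq_localHopf he hy).symm
  rw [mem_closure_differential_ne_zero_iff he hS.contMDiff_meanCurvature hz] at hpD
  have h1 := eventually_mem_closure_support (hS.fundamentalEquations_complexParam he)
    (fun y hy u v => paramMetric_complexParam he hiso hy u v)
    (fun y hy => (hS.det_meanCurvature_isothermal he hiso hy rfl).2) hQ' hz hpD
  rw [← map_nhds_complexParam hz, eventually_map]
  filter_upwards [h1, (isOpen_preimage_target e).mem_nhds hz] with y hy hyU
  exact (mem_closure_differential_ne_zero_iff he hS.contMDiff_meanCurvature hyU).2 hy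

/-- If `Q` is holomorphic, then `det A = 0` where `df ≠ 0`, and by continuity on the closure of this
set. -/
theorem det_shapeOperator_eq_zero_of_isothermal :
    LinearMap.det (shapeOperator (E := EuclideanSpace ℝ (Fin 2)) h.inner φ η p) = 0 := by
  obtain ⟨z, hz, rfl⟩ := exists_complexParam_eq hp
  have hE := hS.fundamentalEquations_complexParam he
  have hQ' : DifferentiableOn ℂ (localHopf (paramSecondForm (E := EuclideanSpace ℝ (Fin 2))
      h.inner φ η (complexParam e)) fun y => meanCurvature h.inner φ η (complexParam e y))
      (toPlane ⁻¹' e.target) :=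
    hQ.congr fun y hy => (hS.hopfQ_eq_localHopf he hy).symm
  rw [mem_closure_differential_ne_zero_iff he hS.contMDiff_meanCurvature hz] at hpD
  set b := paramSecondForm (E := EuclideanSpace ℝ (Fin 2)) h.inner φ η (complexParam e)
  have h1 : b z 1 1 * b z Complex.I Complex.I - b z 1 Complex.I ^ 2 = 0 := by
    have hc := fun u v => (hE.contDiffAt z hz u v).continuousAt
    have h2 : ContinuousAt (fun y => b y 1 1 * b y Complex.I Complex.I - b y 1 Complex.I ^ 2) z :=
      ((hc 1 1).mul (hc _ _)).sub ((hc _ _).pow 2)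
    -- the determinant of the second fundamental form vanishes on a set that accumulates at `z`
    by_contra hne
    obtain ⟨y, hy, hy1, hy2⟩ := ((mem_closure_iff_frequently.1 hpD).and_eventually
      ((h2.eventually_ne hne).and ((isOpen_preimage_target e).mem_nhds hz))).exists
    exact hy1 (det_secondForm_eq_zero hE
      (fun y hy u v => paramMetric_complexParam he hiso hy u v)
      (fun y hy => (hS.det_meanCurvature_isothermal he hiso hy rfl).2) hQ' hy2 hy)
  have h2 := (hS.det_meanCurvature_isothermal he hiso hz rfl).1
  have hpos := (hiso (complexParam e z) (e.map_target hz)).1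
  exact (mul_eq_zero.1 (h2.trans h1)).resolve_right (by positivity)

end Chart

theorem isMetricOn_paramMetric_inducedMetric {e : OpenPartialHomeomorph M (EuclideanSpace ℝ (Fin 2))}
    (he : e ∈ IsManifold.maximalAtlas (𝓡 2) ∞ M) :
    IsMetricOn (paramMetric (inducedMetric (E := EuclideanSpace ℝ (Fin 2)) h.inner φ) e.symm)
      e.target :=
  (hS.fundamentalEquations (by simp) e.open_target (contMDiffOn_symm_of_mem_maximalAtlas he)
    fun _ hx => (mdifferentiable_of_mem_maximalAtlas he).symm.mfderiv_injective hx).metric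

variable (o : SurfaceOrientation M)

theorem isHolomorphicQ_of_const {k : ℝ} (hk : ∀ p, meanCurvature h.inner φ η p = k) :
    IsHolomorphicQ o h.inner φ η := by
  intro e lam he hiso z hz
  obtain ⟨h1, h2⟩ := hS.dbar_hopfQ he.1 hiso hz
  refine (differentiableAt_complex_iff_dbar.2 ⟨h1, ?_⟩).differentiableWithinAt
  have h3 : gradient (inducedMetric (E := EuclideanSpace ℝ (Fin 2)) h.inner φ)
      (meanCurvature h.inner φ η) (complexParam e z) = 0 := by
    have h4 : differential (E := EuclideanSpace ℝ (Fin 2)) (meanCurvature h.inner φ η)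
        (complexParam e z) = 0 := by
      rw [funext hk]
      exact mfderiv_const
    rw [gradient, h4]
    exact map_zero _
  rw [h3] at h2
  simpa using h2

variable (hQ : IsHolomorphicQ o h.inner φ η)
include hQ

theorem det_shapeOperator_eq_zero_of_mem_closure {p : M}
    (hpD : p ∈ closure {q | differential (E := EuclideanSpace ℝ (Fin 2))
      (meanCurvature h.inner φ η) q ≠ 0}) :
    LinearMap.det (shapeOperator (E := EuclideanSpace ℝ (Fin 2)) h.inner φ η p) = 0 := by
  obtain ⟨e, lam, hp, he, hiso⟩ := exists_isothermal_chart o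
    (inducedMetric (E := EuclideanSpace ℝ (Fin 2)) h.inner φ)
    (fun e he => hS.isMetricOn_paramMetric_inducedMetric he) p
  exact hS.det_shapeOperator_eq_zero_of_isothermal he.1 hiso (hQ e lam he hiso) hp hpD

theorem isOpen_closure_differential_ne_zero :
    IsOpen (closure {q | differential (E := EuclideanSpace ℝ (Fin 2))
      (meanCurvature h.inner φ η) q ≠ 0}) := by
  rw [isOpen_iff_eventually]
  intro p hpD
  obtain ⟨e, lam, hp, he, hiso⟩ := exists_isothermal_chart o
    (inducedMetric (E := EuclideanSpace ℝ (Fin 2)) h.inner φ)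
    (fun e he => hS.isMetricOn_paramMetric_inducedMetric he) p
  exact hS.eventually_mem_closure_differential_ne_zero he.1 hiso (hQ e lam he hiso) hp hpD

/-- If `Q` is holomorphic, then either `df` vanishes identically or it is non-zero on a dense set,
because the closure of `{df ≠ 0}` is open and closed. -/
theorem meanCurvature_const_or_det_shapeOperator_eq_zero [ConnectedSpace M] :
    (∃ k, ∀ p, meanCurvature h.inner φ η p = k) ∨
      ∀ p, LinearMap.det (shapeOperator (E := EuclideanSpace ℝ (Fin 2)) h.inner φ η p) = 0 := by
  rcases isClopen_iff.1 ⟨isClosed_closure, hS.isOpen_closure_differential_ne_zero o hQ⟩ with h0 | h0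
  · left
    refine exists_eq_const_of_differential_eq_zero hS.contMDiff_meanCurvature fun p => ?_
    by_contra hp
    have := subset_closure (show p ∈ {q | differential (E := EuclideanSpace ℝ (Fin 2))
      (meanCurvature h.inner φ η) q ≠ 0} from hp)
    rw [h0] at this
    exact this
  · right
    exact fun p => hS.det_shapeOperator_eq_zero_of_mem_closure o hQ (h0 ▸ Set.mem_univ p)

end IsImmersedSurface

end SurfaceGeometry

end

theorem mainTheorem2
    {M : Type*} [TopologicalSpace M] [ChartedSpace (EuclideanSpace ℝ (Fin 2)) M]
    [IsManifold (𝓡 2) ∞ M] [ConnectedSpace M]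
    (o : SurfaceGeometry.SurfaceOrientation M)
    {N : Type*} [TopologicalSpace N] [ChartedSpace (EuclideanSpace ℝ (Fin 3)) N]
    [IsManifold (𝓡 3) ∞ N]
    (h : Bundle.ContMDiffRiemannianMetric (𝓡 3) ∞ (EuclideanSpace ℝ (Fin 3))
      (fun y : N => TangentSpace (𝓡 3) y))
    (c : ℝ) (hc : SurfaceGeometry.HasConstantCurvature h.inner c)
    (φ : M → N) (hφ : ContMDiff (𝓡 2) (𝓡 3) ∞ φ)
    (hφ_imm : ∀ p : M, Function.Injective (mfderiv (𝓡 2) (𝓡 3) φ p))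
    (η : ∀ p : M, TangentSpace (𝓡 3) (φ p))
    (hη : ContMDiff (𝓡 2) (𝓡 3).tangent ∞
      (fun p : M => (⟨φ p, η p⟩ : TangentBundle (𝓡 3) N)))
    (hη_unit : ∀ p : M, h.inner (φ p) (η p) (η p) = 1)
    (hη_normal : ∀ (p : M) (X : TangentSpace (𝓡 2) p),
      h.inner (φ p) (η p) (mfderiv (𝓡 2) (𝓡 3) φ p X) = 0) :
    let g : ∀ p : M, TangentSpace (𝓡 2) p →L[ℝ] TangentSpace (𝓡 2) p →L[ℝ] ℝ :=
      SurfaceGeometry.inducedMetric h.inner φ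
    let A : ∀ p : M, TangentSpace (𝓡 2) p →ₗ[ℝ] TangentSpace (𝓡 2) p :=
      SurfaceGeometry.shapeOperator h.inner φ η
    let f : M → ℝ := SurfaceGeometry.meanCurvature h.inner φ η
    let K : M → ℝ := SurfaceGeometry.gaussianCurvature g
    -- the identity `det A = K - c`
    (∀ p : M, LinearMap.det (A p) = K p - c) ∧
    -- part (a)
    ((∀ p : M, LinearMap.det (A p) ≠ 0) →
      ((∃ k : ℝ, ∀ p : M, f p = k) ↔ SurfaceGeometry.IsHolomorphicQ o h.inner φ η)) ∧
    -- part (b)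
    ((¬ ∃ k : ℝ, ∀ p : M, f p = k) → SurfaceGeometry.IsHolomorphicQ o h.inner φ η →
      ∀ p : M, K p = c) ∧
    -- the identity for the `z̄`-derivative of `Q` in isothermal coordinates
    (∀ (e : OpenPartialHomeomorph M (EuclideanSpace ℝ (Fin 2))) (lam : M → ℝ),
      SurfaceGeometry.IsPositiveChart o e → SurfaceGeometry.IsIsothermal g e lam →
      ∀ z : ℂ, SurfaceGeometry.toPlane z ∈ e.target →
        let q : M := e.symm (SurfaceGeometry.toPlane z)
        DifferentiableAt ℝ (SurfaceGeometry.hopfQ h.inner φ η e) z ∧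
        4 * SurfaceGeometry.dbar (SurfaceGeometry.hopfQ h.inner φ η e) z =
          ((lam q ^ 2 : ℝ) : ℂ) *
            (((g q (A q (SurfaceGeometry.gradient g f q))
                (SurfaceGeometry.coordVector e 0 q) : ℝ) : ℂ) -
              Complex.I * ((g q (A q (SurfaceGeometry.gradient g f q))
                (SurfaceGeometry.coordVector e 1 q) : ℝ) : ℂ))) := by
  intro g A f K
  have hS : SurfaceGeometry.IsImmersedSurface h c φ η :=
    ⟨by simp, hc, hφ, hφ_imm, hη, hη_unit, hη_normal⟩
  have hdet : ∀ p : M, LinearMap.det (A p) = K p - c := fun p => (hS.det_contMDiffAt p).1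
  refine ⟨hdet, fun hne => ⟨fun ⟨k, hk⟩ => hS.isHolomorphicQ_of_const o hk, fun hQ => ?_⟩,
    fun hf hQ p => ?_, fun e lam he hiso z hz => hS.dbar_hopfQ he.1 hiso hz⟩
  · obtain ⟨p⟩ := ‹ConnectedSpace M›.toNonempty
    exact (hS.meanCurvature_const_or_det_shapeOperator_eq_zero o hQ).resolve_right fun h0 => hne p (h0 p)
  · have h0 := (hS.meanCurvature_const_or_det_shapeOperator_eq_zero o hQ).resolve_left hf p
    exact sub_eq_zero.1 ((hdet p).symm.trans h0)
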